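/- Let $k\ge 2$ be an integer, let $\psi:(0,\infty)\to(0,\infty)$ be any function (no monotonicity is assumed), and let $f:(0,\infty)\to(0,\infty)$ be a dimension function, that is, a continuous nondecreasing function with $f(r)\to 0$ as $r\to 0$; assume that $r\mapsto r^{-k}f(r)$ is monotonic (nondecreasing or nonincreasing) on $(0,\infty)$. Let $\mathcal S_k(\psi)$ be the set of $\mathbf y=(y_1,\dots,y_k)\in[0,1]^k$ for which there are infinitely many pairs $(q,\mathbf p)$ with $q\in\mathbb N$, $q\ge 1$, and $\mathbf p=(p_1,\dots,p_k)\in\mathbb Z^k$ such that $$\Bigl|y_i-\frac{p_i}{q}\Bigr|<\frac{\psi(q)}{q}\quad\text{and}\quad \gcd(p_i,q)=1\qquad(1\le i\le k).$$ For $F\subset\mathbb R^k$ (with the Euclidean metric) let $\mathcal H^f(F)=\sup_{\rho>0}\,\inf\sum_i f(r_i)$, where the infimum is over all countable collections of closed balls $B(x_i,r_i)$ with $0<r_i\le\rho$ that cover $F$. If $$\sum_{n=1}^{\infty} f\!\left(\frac{\psi(n)}{n}\right)\varphi(n)^k=\infty,$$ where $\varphi$ is Euler's totient function, then $$\mathcal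 H^f(\mathcal S_k(\psi))=\mathcal H^f([0,1]^k).$$ -/

import Mathlib

open Set Filter Topology
open scoped ENNReal

namespace DuffinSchaeffer

/-- An approximating function: a positive real function on the positive reals. The values of the
total function `ψ` outside `(0, ∞)` are never used. -/
def IsApproximatingFunction (ψ : ℝ → ℝ) : Prop :=
  ∀ x : ℝ, 0 < x → 0 < ψ x

/-- A dimension function: a positive, continuous, nondecreasing function on the positive reals that
tends to `0` at `0`. The values of `f` outside `(0, ∞)` are never used. -/
structure IsDimensionFunction (f : ℝ → ℝ) : Prop where
  pos : ∀ r : ℝ, 0 < r → 0 < f r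
  continuousOn : ContinuousOn f (Ioi 0)
  monotoneOn : MonotoneOn f (Ioi 0)
  tendsto_zero : Tendsto f (𝓝[>] 0) (𝓝 0)

/-- A `ρ`-cover of `F`: a countable collection of closed balls, each given by its centre and its
positive radius, with radii at most `ρ`, whose union contains `F`. -/
def IsBallCover {X : Type*} [MetricSpace X] (ρ : ℝ) (F : Set X) (T : Set (X × ℝ)) : Prop :=
  T.Countable ∧ (∀ b ∈ T, 0 < b.2 ∧ b.2 ≤ ρ) ∧ F ⊆ ⋃ b ∈ T, Metric.closedBall b.1 b.2

/-- `𝓗^f_ρ(F)`: the infimum, over all `ρ`-covers of `F`, of the sum of `f (radius)`. -/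
noncomputable def hausdorffContent {X : Type*} [MetricSpace X] (f : ℝ → ℝ) (ρ : ℝ)
    (F : Set X) : ℝ≥0∞ :=
  ⨅ (T : Set (X × ℝ)) (_ : IsBallCover ρ F T), ∑' b : T, ENNReal.ofReal (f b.1.2)

/-- The Hausdorff `f`-measure `𝓗^f(F) = sup_{ρ > 0} 𝓗^f_ρ(F)`. -/
noncomputable def hausdorffMeasure {X : Type*} [MetricSpace X] (f : ℝ → ℝ)
    (F : Set X) : ℝ≥0∞ :=
  ⨆ (ρ : ℝ) (_ : 0 < ρ), hausdorffContent f ρ F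

/-- The unit cube `[0,1]^k` in Euclidean space `ℝ^k`. -/
def unitCube (k : ℕ) : Set (EuclideanSpace ℝ (Fin k)) :=
  {y | ∀ i, y i ∈ Icc (0 : ℝ) 1}

/-- The set `𝓢_k(ψ)` of points `y` of the unit cube such that there are infinitely many pairs
`(q, p)`, with `q` a positive integer and `p` an integer vector all of whose coordinates are coprime
to `q`, that satisfy `|y_i - p_i / q| < ψ(q) / q` for every `i`. -/
def simApprox (k : ℕ) (ψ : ℝ → ℝ) : Set (EuclideanSpace ℝ (Fin k)) :=
  {y | y ∈ unitCube k ∧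
    {a : ℕ × (Fin k → ℤ) | 0 < a.1 ∧ ∀ i,
      |y i - (a.2 i : ℝ) / (a.1 : ℝ)| < ψ (a.1 : ℝ) / (a.1 : ℝ) ∧
        Int.gcd (a.2 i) (a.1 : ℤ) = 1}.Infinite}

end DuffinSchaeffer

namespace DuffinSchaeffer

/-! ### Counting residues and solutions of a linear equation -/

/-- A set of integers, distinct modulo `g`, that avoids given residue classes modulo some primes
dividing `g`. -/
lemma card_le_of_avoid {g : ℕ} (hg : 0 < g) (s : Finset ℕ) (hs : ∀ p ∈ s, p.Prime ∧ p ∣ g)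
    (B : (p : ℕ) → Finset (ZMod p)) (S : Finset ℤ)
    (hinj : ∀ t ∈ S, ∀ t' ∈ S, (g : ℤ) ∣ t - t' → t = t')
    (hB : ∀ t ∈ S, ∀ p ∈ s, (t : ZMod p) ∉ B p) :
    (S.card : ℝ) ≤ g * ∏ p ∈ s, (1 - (B p).card / (p : ℝ)) := by
  classical
  have hpr : ∀ i : s, (i : ℕ).Prime := fun i => (hs i i.2).1
  have : ∀ i : s, Fact (i : ℕ).Prime := fun i => ⟨hpr i⟩
  set P : ℕ := ∏ p ∈ s, p with hP
  have hPpos : 0 < P := Finset.prod_pos fun p hp => (hs p hp).1.pos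
  have hPg : P ∣ g := Finset.prod_primes_dvd g (fun p hp => (hs p hp).1.prime)
    (fun p hp => (hs p hp).2)
  obtain ⟨q, hq⟩ := hPg
  have hqpos : 0 < q := Nat.pos_of_ne_zero (by rintro rfl; simp at hq; omega)
  have : NeZero q := ⟨hqpos.ne'⟩
  let f : ℤ → ((i : s) → ZMod (i : ℕ)) := fun t i => (t : ZMod (i : ℕ))
  have hmaps : S.image f ⊆ Fintype.piFinset fun i : s => (B i)ᶜ := by
    intro x hx
    obtain ⟨t, ht, rfl⟩ := Finset.mem_image.1 hx
    rw [Fintype.mem_piFinset]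
    intro i
    simpa [f] using hB t ht i i.2
  -- Elements congruent modulo every `p ∈ s` differ by multiples of `P`, and their quotients by `P`
  -- are distinct modulo `q = g / P`.
  have hfib : ∀ c ∈ S.image f, (S.filter fun t => f t = c).card ≤ q := by
    intro c hc
    obtain ⟨t0, ht0, rfl⟩ := Finset.mem_image.1 hc
    have hdvd : ∀ t ∈ S.filter (fun t => f t = f t0), (P : ℤ) ∣ t - t0 := by
      intro t ht
      have h1 := (Finset.mem_filter.1 ht).2
      rw [hP, Nat.cast_prod]
      refine Finset.prod_dvd_of_coprime ?_ ?_
      · intro a ha b hb hab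
        exact Nat.isCoprime_iff_coprime.2 ((Nat.coprime_primes (hs a ha).1 (hs b hb).1).2 hab)
      · intro p hp
        have := congrFun h1 ⟨p, hp⟩
        simp only [f] at this
        rw [← ZMod.intCast_zmod_eq_zero_iff_dvd _ p] <;> try exact ⟨(hs p hp).1.ne_zero⟩
        push_cast
        exact sub_eq_zero.2 this
    calc (S.filter fun t => f t = f t0).card
        ≤ (Finset.univ : Finset (ZMod q)).card := by
          refine Finset.card_le_card_of_injOn (fun t => (((t - t0) / P : ℤ) : ZMod q))
            (fun _ _ => Finset.mem_coe.2 (Finset.mem_univ _)) ?_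
          intro t ht t' ht' h
          obtain ⟨j, hj⟩ := hdvd t ht
          obtain ⟨j', hj'⟩ := hdvd t' ht'
          have hP0 : (P : ℤ) ≠ 0 := by exact_mod_cast hPpos.ne'
          simp only [hj, hj', Int.mul_ediv_cancel_left _ hP0] at h
          have h2 := (ZMod.intCast_eq_intCast_iff_dvd_sub _ _ _).1 h
          refine hinj t (Finset.mem_filter.1 ht).1 t' (Finset.mem_filter.1 ht').1 ?_
          have : t - t' = -(P * (j' - j)) := by linear_combination hj - hj'
          rw [this, hq, dvd_neg]
          push_cast
          exact mul_dvd_mul_left _ h2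
      _ = q := by rw [Finset.card_univ, ZMod.card]
  have h1 : S.card ≤ q * (S.image f).card :=
    Finset.card_le_mul_card_image S q hfib
  have h2 : (S.image f).card ≤ ∏ i : s, ((i : ℕ) - (B i).card) := by
    refine (Finset.card_le_card hmaps).trans (le_of_eq ?_)
    rw [Fintype.card_piFinset]
    refine Finset.prod_congr rfl fun i _ => ?_
    rw [Finset.card_compl, ZMod.card]
  have h3 : (∏ i : s, (((i : ℕ) - (B i).card : ℕ) : ℝ)) =
      P * ∏ p ∈ s, (1 - (B p).card / (p : ℝ)) := by
    rw [hP, Nat.cast_prod, ← Finset.prod_mul_distrib, ← Finset.prod_coe_sort s]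
    refine Finset.prod_congr rfl fun i _ => ?_
    have : (B i).card ≤ (i : ℕ) := by
      simpa [ZMod.card] using Finset.card_le_univ (B i)
    have hi : ((i : ℕ) : ℝ) ≠ 0 := by exact_mod_cast (hpr i).ne_zero
    rw [Nat.cast_sub this]
    field_simp
  calc (S.card : ℝ) ≤ q * ∏ i : s, (((i : ℕ) - (B i).card : ℕ) : ℝ) := by
        exact_mod_cast h1.trans (Nat.mul_le_mul_left q h2)
    _ = g * ∏ p ∈ s, (1 - (B p).card / (p : ℝ)) := by
        rw [h3, hq]; push_cast; ring

/-- The product of `1 - 1/p` over a finite set. -/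
noncomputable def eulerProd (s : Finset ℕ) : ℝ := ∏ p ∈ s, (1 - (p : ℝ)⁻¹)

lemma one_sub_inv_pos {p : ℕ} (hp : p.Prime) : 0 < 1 - (p : ℝ)⁻¹ := by
  have : (1 : ℝ) < p := by exact_mod_cast hp.one_lt
  exact sub_pos.2 (inv_lt_one_of_one_lt₀ this)

lemma one_sub_inv_le_one (p : ℕ) : 1 - (p : ℝ)⁻¹ ≤ 1 := by
  have : (0 : ℝ) ≤ (p : ℝ)⁻¹ := by positivity
  linarith

lemma eulerProd_pos {s : Finset ℕ} (hs : ∀ p ∈ s, p.Prime) : 0 < eulerProd s :=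
  Finset.prod_pos fun p hp => one_sub_inv_pos (hs p hp)

/-- Solutions of `a v - b u = h` with `a` coprime to `g u` in an interval of length `g u` and `b`
coprime to `g v`. -/
lemma card_solutions_le {g u v : ℕ} (hg : 0 < g) (hu : 0 < u) (huv : u.Coprime v)
    (h : ℤ) (S : Finset (ℤ × ℤ))
    (hS : ∀ q ∈ S, 1 ≤ q.1 ∧ q.1 ≤ (g * u : ℕ) ∧ Int.gcd q.1 (g * u : ℕ) = 1 ∧
      Int.gcd q.2 (g * v : ℕ) = 1 ∧ q.1 * v - q.2 * u = h) :
    (S.card : ℝ) ≤ g * eulerProd g.primeFactors *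
      eulerProd (g.primeFactors.filter fun p => ¬ p ∣ u * v ∧ ¬ (p : ℤ) ∣ h) := by
  classical
  have hnn : 0 ≤ g * eulerProd g.primeFactors *
      eulerProd (g.primeFactors.filter fun p => ¬ p ∣ u * v ∧ ¬ (p : ℤ) ∣ h) :=
    mul_nonneg (mul_nonneg (Nat.cast_nonneg _)
      (eulerProd_pos fun p hp => Nat.prime_of_mem_primeFactors hp).le)
      (eulerProd_pos fun p hp => Nat.prime_of_mem_primeFactors (Finset.mem_filter.1 hp).1).le
  rcases S.eq_empty_or_nonempty with rfl | ⟨⟨a0, b0⟩, h0⟩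
  · simpa using hnn
  obtain ⟨-, -, -, -, hab0⟩ := hS _ h0
  simp only at hab0
  have hu0 : (u : ℤ) ≠ 0 := by exact_mod_cast hu.ne'
  have hcop : IsCoprime (u : ℤ) v := Nat.isCoprime_iff_coprime.2 huv
  have hpar : ∀ q ∈ S, q.1 = a0 + u * ((q.1 - a0) / u) ∧ q.2 = b0 + v * ((q.1 - a0) / u) := by
    intro q hq
    have hq' := (hS q hq).2.2.2.2
    have h1 : (q.1 - a0) * v = (q.2 - b0) * u := by linear_combination hq' - hab0
    have h2 : (u : ℤ) ∣ q.1 - a0 := hcop.dvd_of_dvd_mul_right ⟨q.2 - b0, by rw [h1]; ring⟩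
    obtain ⟨t, ht⟩ := h2
    rw [ht, Int.mul_ediv_cancel_left _ hu0]
    refine ⟨by linear_combination ht, ?_⟩
    have : (q.2 - b0) * u = (v * t) * u := by rw [← h1, ht]; ring
    have := mul_right_cancel₀ hu0 this
    linear_combination this
  -- All solutions are `(a0 + u t, b0 + v t)`. Since `a` ranges over an interval of `g u` integers,
  -- the parameters `t` are distinct modulo `g`, so the residue count applies to them.
  set τ : ℤ × ℤ → ℤ := fun q => (q.1 - a0) / u with hτ
  have hτinj : Set.InjOn τ S := by
    intro q hq q' hq' he
    have h1 := hpar q hq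
    have h2 := hpar q' hq'
    simp only [hτ] at he
    rw [he] at h1
    exact Prod.ext (h1.1.trans h2.1.symm) (h1.2.trans h2.2.symm)
  have hcard : (S.image τ).card = S.card := Finset.card_image_of_injOn hτinj
  -- the excluded residue classes
  let B : (p : ℕ) → Finset (ZMod p) := fun p =>
    if hp : p.Prime then
      have : Fact p.Prime := ⟨hp⟩
      Finset.univ.filter fun t : ZMod p => ((a0 : ZMod p) + u * t) * ((b0 : ZMod p) + v * t) = 0
    else ∅
  have key := card_le_of_avoid hg g.primeFactors
    (fun p hp => ⟨Nat.prime_of_mem_primeFactors hp, Nat.dvd_of_mem_primeFactors hp⟩) B (S.image τ)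
    (by
      intro t ht t' ht' hd
      obtain ⟨q, hq, rfl⟩ := Finset.mem_image.1 ht
      obtain ⟨q', hq', rfl⟩ := Finset.mem_image.1 ht'
      obtain ⟨j, hj⟩ := hd
      have h1 := (hpar q hq).1
      have h2 := (hpar q' hq').1
      obtain ⟨a1, a2, -⟩ := hS q hq
      obtain ⟨b1, b2, -⟩ := hS q' hq'
      push_cast at a2 b2
      simp only [hτ] at hj ⊢
      have h3 : q.1 - q'.1 = (g * u : ℤ) * j := by
        linear_combination h1 - h2 + u * hj
      have hgu : (0 : ℤ) < g * u := by positivity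
      have h4 : j = 0 := by
        have h5 : (g * u : ℤ) * j < g * u * 1 := by linarith
        have h6 : (g * u : ℤ) * (-1) < g * u * j := by linarith
        have := lt_of_mul_lt_mul_left h5 hgu.le
        have := lt_of_mul_lt_mul_left h6 hgu.le
        omega
      rw [h4] at hj
      linarith)
    (by
      intro t ht p hp
      obtain ⟨q, hq, rfl⟩ := Finset.mem_image.1 ht
      have hpp := Nat.prime_of_mem_primeFactors hp
      have hpg := Nat.dvd_of_mem_primeFactors hp
      have : Fact p.Prime := ⟨hpp⟩
      obtain ⟨-, -, c1, c2, -⟩ := hS q hq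
      obtain ⟨e1, e2⟩ := hpar q hq
      simp only [B, dif_pos hpp, Finset.mem_filter, Finset.mem_univ, true_and]
      have n1 : ∀ (a : ℤ) (w : ℕ), Int.gcd a (g * w : ℕ) = 1 → (a : ZMod p) ≠ 0 := by
        intro a w hc hz
        rw [ZMod.intCast_zmod_eq_zero_iff_dvd] at hz
        have : (p : ℤ) ∣ Int.gcd a (g * w : ℕ) :=
          Int.dvd_coe_gcd hz (by exact_mod_cast hpg.mul_right w)
        rw [hc] at this
        exact hpp.one_lt.ne' (by exact_mod_cast Int.natAbs_dvd_natAbs.2 this |> Nat.dvd_one.1)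
      have e1' : (q.1 : ZMod p) = a0 + u * (τ q : ZMod p) := by
        conv_lhs => rw [e1]
        push_cast; rfl
      have e2' : (q.2 : ZMod p) = b0 + v * (τ q : ZMod p) := by
        conv_lhs => rw [e2]
        push_cast; rfl
      rw [← e1', ← e2']
      exact mul_ne_zero (n1 _ _ c1) (n1 _ _ c2))
  rw [hcard] at key
  refine key.trans ?_
  rw [mul_assoc]
  refine mul_le_mul_of_nonneg_left ?_ (Nat.cast_nonneg _)
  rw [eulerProd, eulerProd, Finset.prod_filter, ← Finset.prod_mul_distrib]
  refine Finset.prod_le_prod ?_ ?_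
  · intro p hp
    have hpp := Nat.prime_of_mem_primeFactors hp
    have : Fact p.Prime := ⟨hpp⟩
    have h1 : (B p).card ≤ p := by simpa [ZMod.card] using Finset.card_le_univ (B p)
    have hp0 : (0 : ℝ) < p := by exact_mod_cast hpp.pos
    rw [sub_nonneg, div_le_one hp0]
    exact_mod_cast h1
  · intro p hp
    have hpp := Nat.prime_of_mem_primeFactors hp
    have : Fact p.Prime := ⟨hpp⟩
    have hp0 : (0 : ℝ) < p := by exact_mod_cast hpp.pos
    have mem_u : (u : ZMod p) ≠ 0 → (-(a0 : ZMod p) * (u : ZMod p)⁻¹) ∈ B p := by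
      intro hne
      simp only [B, dif_pos hpp, Finset.mem_filter, Finset.mem_univ, true_and]
      field_simp
      ring
    have mem_v : (v : ZMod p) ≠ 0 → (-(b0 : ZMod p) * (v : ZMod p)⁻¹) ∈ B p := by
      intro hne
      simp only [B, dif_pos hpp, Finset.mem_filter, Finset.mem_univ, true_and]
      field_simp
      ring
    -- A prime cannot divide both `u` and `v`, so at least one of the two linear forms in `t` has a
    -- root modulo `p`.
    have hone : 1 ≤ (B p).card := by
      rw [Finset.one_le_card]
      by_cases hpu : (u : ZMod p) = 0
      · have hpv : (v : ZMod p) ≠ 0 := by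
          rw [Ne, ZMod.natCast_eq_zero_iff]
          rw [ZMod.natCast_eq_zero_iff] at hpu
          exact fun hpv => hpp.one_lt.ne' (Nat.dvd_one.1 (huv ▸ Nat.dvd_gcd hpu hpv))
        exact ⟨_, mem_v hpv⟩
      · exact ⟨_, mem_u hpu⟩
    split_ifs with hc
    · have hpu : (u : ZMod p) ≠ 0 := by
        rw [Ne, ZMod.natCast_eq_zero_iff]; exact fun hd => hc.1 (hd.mul_right v)
      have hpv : (v : ZMod p) ≠ 0 := by
        rw [Ne, ZMod.natCast_eq_zero_iff]; exact fun hd => hc.1 (hd.mul_left u)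
      -- The roots `-a0 / u` and `-b0 / v` coincide modulo `p` only if `p ∣ a0 v - b0 u = h`. Two
      -- excluded classes give `1 - 2/p ≤ (1 - 1/p) ^ 2`.
      have htwo : 2 ≤ (B p).card := by
        refine Finset.one_lt_card.2 ⟨_, mem_u hpu, _, mem_v hpv, ?_⟩
        intro heq
        apply hc.2
        rw [← ZMod.intCast_zmod_eq_zero_iff_dvd, ← hab0]
        push_cast
        field_simp at heq
        linear_combination -heq
      have h2 : (2 : ℝ) ≤ (B p).card := by exact_mod_cast htwo
      have h3 : (2 : ℝ) * (p : ℝ)⁻¹ ≤ (B p).card / p := by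
        rw [div_eq_mul_inv]; gcongr
      nlinarith [sq_nonneg ((p : ℝ)⁻¹)]
    · have h2 : (1 : ℝ) ≤ (B p).card := by exact_mod_cast hone
      have h3 : (1 : ℝ) * (p : ℝ)⁻¹ ≤ (B p).card / p := by
        rw [div_eq_mul_inv]; gcongr
      linarith

/-- Modulo a prime of `u` the value `h` is `a v`, and modulo a prime of `v` it is `-b u`; neither
vanishes. This is what allows sieving `h` by the primes of `u v`. -/
lemma coprime_of_solution {g u v : ℕ} {a b h : ℤ} (huv : u.Coprime v)
    (ha : Int.gcd a (g * u : ℕ) = 1) (hb : Int.gcd b (g * v : ℕ) = 1) (hab : a * v - b * u = h) :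
    h.natAbs.Coprime (u * v) := by
  have hau : IsCoprime a (u : ℤ) := by
    have := Int.isCoprime_iff_gcd_eq_one.2 ha
    push_cast at this
    exact this.of_mul_right_right
  have hbv : IsCoprime b (v : ℤ) := by
    have := Int.isCoprime_iff_gcd_eq_one.2 hb
    push_cast at this
    exact this.of_mul_right_right
  have hcop : IsCoprime (u : ℤ) v := Nat.isCoprime_iff_coprime.2 huv
  have h1 : IsCoprime h (u : ℤ) := by
    have : IsCoprime (a * v) (u : ℤ) := hau.mul_left hcop.symm
    have := (IsCoprime.add_mul_right_left_iff (z := -b)).2 this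
    rwa [show a * v + -b * u = h by rw [← hab]; ring] at this
  have h2 : IsCoprime h (v : ℤ) := by
    have : IsCoprime (-(b * u)) (v : ℤ) := (hbv.mul_left hcop).neg_left
    have := (IsCoprime.add_mul_right_left_iff (z := a)).2 this
    rwa [show -(b * u) + a * v = h by rw [← hab]; ring] at this
  have h3 := h1.mul_right h2
  rw [Int.isCoprime_iff_gcd_eq_one] at h3
  simpa [Int.gcd, Int.natAbs_mul] using h3

/-! ### Sieve estimates -/

lemma sum_inv_mul_pred_Ico (a N : ℕ) (ha : 2 ≤ a) (haN : a ≤ N) :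
    ∑ p ∈ Finset.Ico a N, ((p : ℝ) * (p - 1))⁻¹ = ((a : ℝ) - 1)⁻¹ - ((N : ℝ) - 1)⁻¹ := by
  induction N, haN using Nat.le_induction with
  | base => simp
  | succ N hN ih =>
    rw [Finset.sum_Ico_succ_top hN, ih]
    have h1 : (2 : ℝ) ≤ N := by exact_mod_cast ha.trans hN
    have h2 : (N : ℝ) - 1 ≠ 0 := by linarith
    have h3 : (N : ℝ) ≠ 0 := by linarith
    push_cast
    rw [add_sub_cancel_right]
    field_simp
    ring

lemma half_succ_le_pred {p l : ℕ} (hp : p.Prime) (hl : l < p) :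
    ((l : ℝ) + 1) / 2 ≤ (p : ℝ) - 1 := by
  have h1 : (2 : ℝ) ≤ p := by exact_mod_cast hp.two_le
  have h2 : (l : ℝ) + 1 ≤ p := by exact_mod_cast hl
  linarith

/-- A telescoping sum started at `max 2 (l + 1)`. The bound has `l + 1` in place of `l` so that `l =
0` is admissible. -/
lemma sum_inv_mul_pred_le (s : Finset ℕ) (l : ℕ) (hs : ∀ p ∈ s, p.Prime ∧ l < p) :
    ∑ p ∈ s, ((p : ℝ) * (p - 1))⁻¹ ≤ 2 / (l + 1) := by
  set a := max 2 (l + 1) with ha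
  set N := max a (s.sup id + 1) with hN
  have ha2 : 2 ≤ a := le_max_left _ _
  have hsub : s ⊆ Finset.Ico a N := by
    intro p hp
    rw [Finset.mem_Ico]
    refine ⟨max_le (hs p hp).1.two_le (hs p hp).2, lt_of_lt_of_le ?_ (le_max_right _ _)⟩
    exact Nat.lt_succ_of_le (Finset.le_sup (f := id) hp)
  have hN2 : (2 : ℝ) ≤ N := by exact_mod_cast ha2.trans (le_max_left _ _)
  have ha3 : ((l : ℝ) + 1) / 2 ≤ a - 1 := by
    have h1 : (2 : ℝ) ≤ a := by exact_mod_cast ha2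
    have h2 : (l : ℝ) + 1 ≤ a := by exact_mod_cast le_max_right 2 (l + 1)
    linarith
  calc ∑ p ∈ s, ((p : ℝ) * (p - 1))⁻¹ ≤ ∑ p ∈ Finset.Ico a N, ((p : ℝ) * (p - 1))⁻¹ := by
        refine Finset.sum_le_sum_of_subset_of_nonneg hsub fun p hp _ => ?_
        have : (2 : ℝ) ≤ p := by exact_mod_cast ha2.trans (Finset.mem_Ico.1 hp).1
        have : (0 : ℝ) ≤ p - 1 := by linarith
        positivity
    _ = ((a : ℝ) - 1)⁻¹ - ((N : ℝ) - 1)⁻¹ := sum_inv_mul_pred_Ico a N ha2 (le_max_left _ _)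
    _ ≤ ((a : ℝ) - 1)⁻¹ := by
        have : (0 : ℝ) ≤ ((N : ℝ) - 1)⁻¹ := inv_nonneg.2 (by linarith)
        linarith
    _ ≤ (((l : ℝ) + 1) / 2)⁻¹ := inv_anti₀ (by positivity) ha3
    _ = 2 / (l + 1) := by rw [inv_div]

lemma inv_one_sub_inv {p : ℕ} (hp : p.Prime) : (1 - (p : ℝ)⁻¹)⁻¹ = 1 + ((p : ℝ) - 1)⁻¹ := by
  have h1 : (2 : ℝ) ≤ p := by exact_mod_cast hp.two_le
  have h2 : (p : ℝ) - 1 ≠ 0 := by linarith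
  have h3 : (p : ℝ) ≠ 0 := by linarith
  field_simp
  ring

lemma pred_pos {p : ℕ} (hp : p.Prime) : (0 : ℝ) < (p : ℝ) - 1 := by
  have h1 : (2 : ℝ) ≤ p := by exact_mod_cast hp.two_le
  linarith

lemma inv_one_sub_inv_le_exp {p l : ℕ} (hp : p.Prime) (hl : l < p) :
    (1 - (p : ℝ)⁻¹)⁻¹ ≤ Real.exp (2 / (l + 1)) := by
  rw [inv_one_sub_inv hp, add_comm]
  refine (Real.add_one_le_exp _).trans (Real.exp_le_exp.2 ?_)
  rw [← inv_div]
  exact inv_anti₀ (by positivity) (half_succ_le_pred hp hl)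

/-- Averages of a multiplicative function over a set equidistributed in multiples. -/
lemma sum_prod_dvd_le (H G : Finset ℕ) (hG : ∀ p ∈ G, p.Prime) (c : ℕ → ℝ)
    (hc : ∀ p ∈ G, 0 ≤ c p) (Y : ℝ)
    (hY : ∀ D ⊆ G, ((H.filter fun h => (∏ p ∈ D, p) ∣ h).card : ℝ) ≤ Y * ∏ p ∈ D, (p : ℝ)⁻¹) :
    ∑ h ∈ H, ∏ p ∈ G.filter (· ∣ h), (1 + c p) ≤ Y * ∏ p ∈ G, (1 + c p * (p : ℝ)⁻¹) := by
  classical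
  calc ∑ h ∈ H, ∏ p ∈ G.filter (· ∣ h), (1 + c p)
      = ∑ h ∈ H, ∑ D ∈ G.powerset, if (∏ p ∈ D, p) ∣ h then ∏ p ∈ D, c p else 0 := by
        refine Finset.sum_congr rfl fun h _ => ?_
        rw [Finset.prod_one_add, ← Finset.sum_filter]
        refine Finset.sum_congr ?_ fun _ _ => rfl
        ext D
        simp only [Finset.mem_powerset, Finset.mem_filter]
        constructor
        · intro hD
          have hDG : D ⊆ G := fun p hp => (Finset.mem_filter.1 (hD hp)).1
          exact ⟨hDG, Finset.prod_primes_dvd h (fun p hp => (hG p (hDG hp)).prime)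
            fun p hp => (Finset.mem_filter.1 (hD hp)).2⟩
        · rintro ⟨hD, hd⟩ p hp
          exact Finset.mem_filter.2 ⟨hD hp, (Finset.dvd_prod_of_mem _ hp).trans hd⟩
    _ = ∑ D ∈ G.powerset, (∏ p ∈ D, c p) * ((H.filter fun h => (∏ p ∈ D, p) ∣ h).card : ℝ) := by
        rw [Finset.sum_comm]
        refine Finset.sum_congr rfl fun D _ => ?_
        rw [← Finset.sum_filter, Finset.sum_const, nsmul_eq_mul, mul_comm]
    _ ≤ ∑ D ∈ G.powerset, (∏ p ∈ D, c p) * (Y * ∏ p ∈ D, (p : ℝ)⁻¹) := by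
        refine Finset.sum_le_sum fun D hD => ?_
        have hD' := Finset.mem_powerset.1 hD
        exact mul_le_mul_of_nonneg_left (hY D hD')
          (Finset.prod_nonneg fun p hp => hc p (hD' hp))
    _ = Y * ∏ p ∈ G, (1 + c p * (p : ℝ)⁻¹) := by
        rw [Finset.prod_one_add, Finset.mul_sum]
        refine Finset.sum_congr rfl fun D _ => ?_
        rw [Finset.prod_mul_distrib]
        ring

lemma totient_prod_primes (A : Finset ℕ) (hA : ∀ p ∈ A, p.Prime) :
    ((∏ p ∈ A, p).totient : ℝ) = (∏ p ∈ A, (p : ℝ)) * eulerProd A := by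
  have h := Nat.totient_eq_mul_prod_factors (∏ p ∈ A, p)
  rw [Nat.primeFactors_prod hA] at h
  have h' : (((∏ p ∈ A, p).totient : ℚ) : ℝ) =
      (((∏ p ∈ A, p : ℕ) * ∏ p ∈ A, (1 - (p : ℚ)⁻¹) : ℚ) : ℝ) := by rw [h]
  push_cast at h'
  exact h'

/-- Integers in an interval that are multiples of `∏ D` and coprime to `∏ A`. -/
lemma card_dvd_coprime_le (A D : Finset ℕ) (hA : ∀ p ∈ A, p.Prime) (hD : ∀ p ∈ D, p.Prime)
    (hAD : Disjoint D A) (l : ℕ) (hAl : ∀ p ∈ A, p ≤ l) (hDl : ∀ p ∈ D, p ≤ l) (x : ℝ)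
    (hx : (4 : ℝ) ^ l ≤ x) :
    (((Finset.Icc 1 ⌊x⌋₊).filter fun h => (∏ p ∈ A, p).Coprime h ∧ (∏ p ∈ D, p) ∣ h).card : ℝ) ≤
      2 * x * eulerProd A * ∏ p ∈ D, (p : ℝ)⁻¹ := by
  classical
  set W := ∏ p ∈ A, p with hW
  set d := ∏ p ∈ D, p with hd
  have hWpos : 0 < W := Finset.prod_pos fun p hp => (hA p hp).pos
  have hdpos : 0 < d := Finset.prod_pos fun p hp => (hD p hp).pos
  have hx0 : 0 < x := lt_of_lt_of_le (by positivity) hx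
  -- The modulus `d W` divides the primorial of `l`, which is at most `4 ^ l ≤ x`. So the incomplete
  -- last period costs no more than the main term, whence the factor `2`.
  have hdW : ((d * W : ℕ) : ℝ) ≤ x := by
    have h1 : d * W ≤ primorial l := by
      rw [hd, hW, ← Finset.prod_union hAD, primorial]
      refine Nat.le_of_dvd (primorial_pos l) (Finset.prod_dvd_prod_of_subset _ _ _ ?_)
      intro p hp
      rw [Finset.mem_filter, Finset.mem_range]
      rcases Finset.mem_union.1 hp with h | h
      · exact ⟨Nat.lt_succ_of_le (hDl p h), hD p h⟩
      · exact ⟨Nat.lt_succ_of_le (hAl p h), hA p h⟩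
    calc ((d * W : ℕ) : ℝ) ≤ ((4 ^ l : ℕ) : ℝ) := by
          exact_mod_cast h1.trans (primorial_le_four_pow l)
      _ ≤ x := by simpa using hx
  have h1 : ((Finset.Icc 1 ⌊x⌋₊).filter fun h => W.Coprime h ∧ d ∣ h).card ≤
      ((Finset.Ico 1 (1 + ⌊x⌋₊ / d)).filter fun h => W.Coprime h).card := by
    refine Finset.card_le_card_of_injOn (fun h => h / d) ?_ ?_
    · intro h hh
      obtain ⟨h2, h3, h4⟩ := Finset.mem_filter.1 hh
      rw [Finset.mem_Icc] at h2
      refine Finset.mem_coe.2 (Finset.mem_filter.2 ⟨Finset.mem_Ico.2 ⟨?_, ?_⟩, ?_⟩)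
      · exact Nat.div_pos (Nat.le_of_dvd h2.1 h4) hdpos
      · have := Nat.div_le_div_right (c := d) h2.2
        show h / d < 1 + ⌊x⌋₊ / d
        omega
      · exact Nat.Coprime.coprime_dvd_right (Nat.div_dvd_of_dvd h4) h3
    · intro h hh h' hh' he
      have h4 := (Finset.mem_filter.1 hh).2.2
      have h5 := (Finset.mem_filter.1 hh').2.2
      rw [← Nat.div_mul_cancel h4, ← Nat.div_mul_cancel h5]
      simp only at he
      rw [he]
  have h2 := h1.trans (Nat.Ico_filter_coprime_le 1 (⌊x⌋₊ / d) hWpos.ne')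
  have h3 : (((⌊x⌋₊ / d) / W + 1 : ℕ) : ℝ) ≤ x / (d * W) + 1 := by
    push_cast
    rw [Nat.div_div_eq_div_mul]
    gcongr
    refine (Nat.cast_div_le).trans ?_
    push_cast
    gcongr
    exact Nat.floor_le hx0.le
  have hEA : 0 < eulerProd A := eulerProd_pos hA
  have hW0 : (0 : ℝ) < W := by exact_mod_cast hWpos
  have hd0 : (0 : ℝ) < d := by exact_mod_cast hdpos
  calc (((Finset.Icc 1 ⌊x⌋₊).filter fun h => W.Coprime h ∧ d ∣ h).card : ℝ)
      ≤ (W.totient : ℝ) * (((⌊x⌋₊ / d) / W + 1 : ℕ) : ℝ) := by exact_mod_cast h2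
    _ ≤ (W * eulerProd A) * (x / (d * W) + 1) := by
        rw [hW, totient_prod_primes A hA, ← Nat.cast_prod, ← hW]
        gcongr
    _ = eulerProd A * ((d : ℝ)⁻¹ * (x + ((d * W : ℕ) : ℝ))) := by
        push_cast; field_simp
    _ ≤ eulerProd A * ((d : ℝ)⁻¹ * (x + x)) := by gcongr
    _ = 2 * x * eulerProd A * ∏ p ∈ D, (p : ℝ)⁻¹ := by
        rw [Finset.prod_inv_distrib, ← Nat.cast_prod, ← hd]; ring

/-- A number below `4 ^ (l + 1)` has at most `2 (l + 1)` prime factors, and each factor above `l`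
contributes at most `exp (2 / (l + 1))`. -/
lemma prod_large_dividing_le (G : Finset ℕ) (hG : ∀ p ∈ G, p.Prime) (l h : ℕ) (hh : 0 < h)
    (hhl : h < 4 ^ (l + 1)) :
    ∏ p ∈ G.filter (fun p => p ∣ h ∧ l < p), (1 - (p : ℝ)⁻¹)⁻¹ ≤ Real.exp 4 := by
  set s := G.filter (fun p => p ∣ h ∧ l < p) with hs
  have hs1 : ∀ p ∈ s, p.Prime ∧ p ∣ h ∧ l < p := fun p hp =>
    ⟨hG p (Finset.mem_filter.1 hp).1, (Finset.mem_filter.1 hp).2⟩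
  have hcard : s.card ≤ 2 * (l + 1) := by
    have h1 : 2 ^ s.card ≤ ∏ p ∈ s, p :=
      Finset.pow_card_le_prod _ _ _ fun p hp => (hs1 p hp).1.two_le
    have h2 : ∏ p ∈ s, p ≤ h := Nat.le_of_dvd hh
      (Finset.prod_primes_dvd h (fun p hp => (hs1 p hp).1.prime) fun p hp => (hs1 p hp).2.1)
    have h3 : 2 ^ s.card < 2 ^ (2 * (l + 1)) := by
      calc 2 ^ s.card ≤ h := h1.trans h2
        _ < 4 ^ (l + 1) := hhl
        _ = 2 ^ (2 * (l + 1)) := by rw [pow_mul]; norm_num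
    exact ((Nat.pow_lt_pow_iff_right (by norm_num)).1 h3).le
  calc ∏ p ∈ s, (1 - (p : ℝ)⁻¹)⁻¹ ≤ ∏ _p ∈ s, Real.exp (2 / (l + 1)) :=
        Finset.prod_le_prod (fun p hp => (inv_pos.2 (one_sub_inv_pos (hs1 p hp).1)).le)
          fun p hp => inv_one_sub_inv_le_exp (hs1 p hp).1 (hs1 p hp).2.2
    _ = Real.exp (s.card * (2 / (l + 1))) := by
        rw [Finset.prod_const, ← Real.exp_nat_mul]
    _ ≤ Real.exp 4 := by
        apply Real.exp_le_exp.2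
        have : (s.card : ℝ) ≤ 2 * (l + 1) := by exact_mod_cast hcard
        have hl : (0 : ℝ) < l + 1 := by positivity
        rw [mul_div_assoc', div_le_iff₀ hl]
        linarith

/-- A weighted sieve upper bound. -/
lemma sieve_sum_le (A G : Finset ℕ) (hA : ∀ p ∈ A, p.Prime) (hG : ∀ p ∈ G, p.Prime)
    (hAG : Disjoint G A) (l : ℕ) (x : ℝ) (hx : (4 : ℝ) ^ l ≤ x) (hx' : x < 4 ^ (l + 1)) :
    ∑ h ∈ (Finset.Icc 1 ⌊x⌋₊).filter (fun h => ∀ p ∈ A, ¬ p ∣ h),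
      ∏ p ∈ G.filter (· ∣ h), (1 - (p : ℝ)⁻¹)⁻¹ ≤
      2 * Real.exp 6 * x * eulerProd (A.filter (· ≤ l)) := by
  classical
  set A' := A.filter (· ≤ l) with hA'
  set G' := G.filter (· ≤ l) with hG'
  have hA'p : ∀ p ∈ A', p.Prime := fun p hp => hA p (Finset.mem_filter.1 hp).1
  have hG'p : ∀ p ∈ G', p.Prime := fun p hp => hG p (Finset.mem_filter.1 hp).1
  have hx0 : 0 < x := lt_of_lt_of_le (by positivity) hx
  set H := (Finset.Icc 1 ⌊x⌋₊).filter (fun h => (∏ p ∈ A', p).Coprime h) with hH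
  have hfac : ∀ p : ℕ, p.Prime → 0 ≤ (1 - (p : ℝ)⁻¹)⁻¹ := fun p hp =>
    (inv_pos.2 (one_sub_inv_pos hp)).le
  -- The weight is reduced to primes at most `l`, for which the multiples in the sifted set can
  -- still be counted exactly enough.
  have step1 : ∀ h ∈ Finset.Icc 1 ⌊x⌋₊, ∏ p ∈ G.filter (· ∣ h), (1 - (p : ℝ)⁻¹)⁻¹ ≤
      Real.exp 4 * ∏ p ∈ G'.filter (· ∣ h), (1 + ((p : ℝ) - 1)⁻¹) := by
    intro h hh
    rw [Finset.mem_Icc] at hh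
    rw [← Finset.prod_filter_mul_prod_filter_not (G.filter (· ∣ h)) (fun p => l < p)]
    refine mul_le_mul ?_ (le_of_eq ?_) ?_ (Real.exp_pos _).le
    · rw [Finset.filter_filter]
      refine prod_large_dividing_le G hG l h hh.1 ?_
      have : (h : ℝ) < 4 ^ (l + 1) :=
        lt_of_le_of_lt ((Nat.cast_le.2 hh.2).trans (Nat.floor_le hx0.le)) hx'
      exact_mod_cast this
    · have : (G.filter (· ∣ h)).filter (fun p => ¬ l < p) = G'.filter (· ∣ h) := by
        ext p; simp [hG']; tauto
      rw [this]
      exact Finset.prod_congr rfl fun p hp => inv_one_sub_inv (hG'p p (Finset.mem_filter.1 hp).1)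
    · exact Finset.prod_nonneg fun p hp =>
        hfac p (hG p (Finset.mem_filter.1 (Finset.mem_filter.1 hp).1).1)
  have hpos : ∀ h, 0 ≤ ∏ p ∈ G'.filter (· ∣ h), (1 + ((p : ℝ) - 1)⁻¹) := fun h =>
    Finset.prod_nonneg fun p hp => by
      have := pred_pos (hG'p p (Finset.mem_filter.1 hp).1)
      positivity
  have step2 : ∑ h ∈ H, ∏ p ∈ G'.filter (· ∣ h), (1 + ((p : ℝ) - 1)⁻¹) ≤
      (2 * x * eulerProd A') * ∏ p ∈ G', (1 + ((p : ℝ) - 1)⁻¹ * (p : ℝ)⁻¹) := by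
    refine sum_prod_dvd_le H G' hG'p _ (fun p hp => (inv_pos.2 (pred_pos (hG'p p hp))).le) _ ?_
    intro D hD
    rw [hH, Finset.filter_filter]
    refine card_dvd_coprime_le A' D hA'p (fun p hp => hG'p p (hD hp)) ?_ l
      (fun p hp => (Finset.mem_filter.1 hp).2) (fun p hp => (Finset.mem_filter.1 (hD hp)).2) x hx
    exact Finset.disjoint_of_subset_left (hD.trans (Finset.filter_subset _ _))
      (Finset.disjoint_of_subset_right (Finset.filter_subset _ _) hAG)
  -- On average the weight over small primes is bounded because `∑ 1 / (p (p - 1))` converges; this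
  -- is the `2` in `exp 6 = exp 4 * exp 2`.
  have step3 : ∏ p ∈ G', (1 + ((p : ℝ) - 1)⁻¹ * (p : ℝ)⁻¹) ≤ Real.exp 2 := by
    refine (Real.prod_one_add_le_exp_sum _ fun p => ?_).trans (Real.exp_le_exp.2 ?_)
    · rcases Nat.eq_zero_or_pos p with rfl | hp
      · simp
      · have : (0 : ℝ) ≤ (p : ℝ) - 1 := sub_nonneg.2 (by exact_mod_cast hp)
        positivity
    · have := sum_inv_mul_pred_le G' 0 fun p hp => ⟨hG'p p hp, (hG'p p hp).pos⟩
      simp only [Nat.cast_zero, zero_add, div_one] at this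
      refine le_trans (le_of_eq (Finset.sum_congr rfl fun p _ => ?_)) this
      rw [mul_inv, mul_comm]
  have hE : 0 < eulerProd A' := eulerProd_pos hA'p
  calc ∑ h ∈ (Finset.Icc 1 ⌊x⌋₊).filter (fun h => ∀ p ∈ A, ¬ p ∣ h),
      ∏ p ∈ G.filter (· ∣ h), (1 - (p : ℝ)⁻¹)⁻¹
      ≤ ∑ h ∈ (Finset.Icc 1 ⌊x⌋₊).filter (fun h => ∀ p ∈ A, ¬ p ∣ h),
        Real.exp 4 * ∏ p ∈ G'.filter (· ∣ h), (1 + ((p : ℝ) - 1)⁻¹) :=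
        Finset.sum_le_sum fun h hh => step1 h (Finset.mem_filter.1 hh).1
    _ ≤ ∑ h ∈ H, Real.exp 4 * ∏ p ∈ G'.filter (· ∣ h), (1 + ((p : ℝ) - 1)⁻¹) := by
        refine Finset.sum_le_sum_of_subset_of_nonneg ?_
          fun h _ _ => mul_nonneg (Real.exp_pos _).le (hpos h)
        intro h hh
        obtain ⟨h1, h2⟩ := Finset.mem_filter.1 hh
        refine Finset.mem_filter.2 ⟨h1, Nat.Coprime.prod_left fun p hp => ?_⟩
        exact (Nat.Prime.coprime_iff_not_dvd (hA'p p hp)).2 (h2 p (Finset.mem_filter.1 hp).1)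
    _ ≤ Real.exp 4 * ((2 * x * eulerProd A') * Real.exp 2) := by
        rw [← Finset.mul_sum]
        gcongr
        exact step2.trans (by gcongr)
    _ = 2 * Real.exp 6 * x * eulerProd A' := by
        rw [show (6 : ℝ) = 4 + 2 by norm_num, Real.exp_add]; ring

/-! ### The overlap estimate -/

/-- The product of `(1 - 1/p)⁻¹` over the prime factors `p > l` of `w`. -/
noncomputable def largePart (l w : ℕ) : ℝ :=
  ∏ p ∈ w.primeFactors.filter (l < ·), (1 - (p : ℝ)⁻¹)⁻¹

lemma largePart_factor_one_le {l w p : ℕ} (hp : p ∈ w.primeFactors.filter (l < ·)) :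
    1 ≤ (1 - (p : ℝ)⁻¹)⁻¹ :=
  (one_le_inv₀ (one_sub_inv_pos (Nat.prime_of_mem_primeFactors (Finset.mem_filter.1 hp).1))).2
    (one_sub_inv_le_one p)

lemma one_le_largePart (l w : ℕ) : 1 ≤ largePart l w :=
  Finset.one_le_prod fun _ hp => largePart_factor_one_le hp

/-- `largePart` is exactly the loss from sieving by the primes up to `l` of `w` only. -/
lemma eulerProd_mul_largePart (l w : ℕ) :
    eulerProd w.primeFactors * largePart l w = eulerProd (w.primeFactors.filter (· ≤ l)) := by
  rw [eulerProd, ← Finset.prod_filter_mul_prod_filter_not w.primeFactors (· ≤ l), mul_assoc]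
  simp only [not_le]
  rw [largePart, ← Finset.prod_mul_distrib, Finset.prod_eq_one (s := w.primeFactors.filter (l < ·)),
    mul_one, eulerProd]
  intro p hp
  exact mul_inv_cancel₀
    (one_sub_inv_pos (Nat.prime_of_mem_primeFactors (Finset.mem_filter.1 hp).1)).ne'

/-- Inclusion–exclusion for prime supports: since `u`, `v` are coprime, those of `g u` and `g v`
meet in the support of `g`, and their union is the support of `u v` together with the primes of `g`
not dividing `u v`. -/
lemma eulerProd_gcd_identity {g u v : ℕ} (hg : 0 < g) (hu : 0 < u) (hv : 0 < v)
    (huv : u.Coprime v) :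
    eulerProd g.primeFactors * (eulerProd (g.primeFactors.filter fun p => ¬ p ∣ u * v) *
      eulerProd (u * v).primeFactors) =
      eulerProd (g * u).primeFactors * eulerProd (g * v).primeFactors := by
  classical
  have h1 : (g * u).primeFactors ∩ (g * v).primeFactors = g.primeFactors := by
    rw [Nat.primeFactors_mul hg.ne' hu.ne', Nat.primeFactors_mul hg.ne' hv.ne',
      ← Finset.union_inter_distrib_left,
      Finset.disjoint_iff_inter_eq_empty.1 huv.disjoint_primeFactors, Finset.union_empty]
  have h2 : (g * u).primeFactors ∪ (g * v).primeFactors =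
      (g.primeFactors.filter fun p => ¬ p ∣ u * v) ∪ (u * v).primeFactors := by
    rw [Nat.primeFactors_mul hg.ne' hu.ne', Nat.primeFactors_mul hg.ne' hv.ne']
    ext p
    simp only [Finset.mem_union, Finset.mem_filter, Nat.mem_primeFactors, Nat.mul_ne_zero_iff]
    by_cases hp : p.Prime
    · simp only [hp, true_and, hp.dvd_mul, ne_eq, hg.ne', hu.ne', hv.ne', not_false_eq_true, and_true]
      tauto
    · simp [hp]
  have h3 : Disjoint (g.primeFactors.filter fun p => ¬ p ∣ u * v) (u * v).primeFactors := by
    rw [Finset.disjoint_left]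
    intro p hp hp'
    exact (Finset.mem_filter.1 hp).2 (Nat.dvd_of_mem_primeFactors hp')
  have h4 := Finset.prod_union_inter (s₁ := (g * u).primeFactors) (s₂ := (g * v).primeFactors)
    (f := fun p : ℕ => 1 - (p : ℝ)⁻¹)
  rw [h1, h2, Finset.prod_union h3] at h4
  simp only [eulerProd]
  linarith

/-- Pairs of reduced fractions with denominators `g u` and `g v` that are close but distinct. -/
lemma card_close_pairs_le {g u v : ℕ} (hg : 0 < g) (hu : 0 < u) (hv : 0 < v) (huv : u.Coprime v)
    (x : ℝ) (l : ℕ) (hx : (4 : ℝ) ^ l ≤ x) (hx' : x < 4 ^ (l + 1)) (S : Finset (ℤ × ℤ))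
    (hS : ∀ q ∈ S, 1 ≤ q.1 ∧ q.1 ≤ (g * u : ℕ) ∧ Int.gcd q.1 (g * u : ℕ) = 1 ∧
      Int.gcd q.2 (g * v : ℕ) = 1 ∧ q.1 * v - q.2 * u ≠ 0 ∧
      |((q.1 * v - q.2 * u : ℤ) : ℝ)| < x) :
    (S.card : ℝ) ≤ 4 * Real.exp 6 * x * g * (eulerProd (g * u).primeFactors *
      eulerProd (g * v).primeFactors) * largePart l (u * v) := by
  classical
  set G := g.primeFactors.filter fun p => ¬ p ∣ u * v with hG
  have hGp : ∀ p ∈ G, p.Prime := fun p hp =>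
    Nat.prime_of_mem_primeFactors (Finset.mem_filter.1 hp).1
  have huv0 : u * v ≠ 0 := (Nat.mul_pos hu hv).ne'
  have hx0 : 0 < x := lt_of_lt_of_le (by positivity) hx
  set A := (u * v).primeFactors with hA
  have hAp : ∀ p ∈ A, p.Prime := fun p hp => Nat.prime_of_mem_primeFactors hp
  set H := (Finset.Icc 1 ⌊x⌋₊).filter (fun h => ∀ p ∈ A, ¬ p ∣ h) with hH
  set δ : ℤ × ℤ → ℤ := fun q => q.1 * v - q.2 * u with hδ
  set E := g * eulerProd g.primeFactors * eulerProd G with hE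
  have hE0 : 0 ≤ E := mul_nonneg (mul_nonneg (Nat.cast_nonneg _)
      (eulerProd_pos fun p hp => Nat.prime_of_mem_primeFactors hp).le) (eulerProd_pos hGp).le
  have hmaps : ∀ q ∈ S, (δ q).natAbs ∈ H := by
    intro q hq
    obtain ⟨-, -, h1, h2, h3, h4⟩ := hS q hq
    refine Finset.mem_filter.2 ⟨Finset.mem_Icc.2 ⟨Int.natAbs_pos.2 h3, ?_⟩, ?_⟩
    · rw [Nat.le_floor_iff hx0.le, Nat.cast_natAbs]
      push_cast
      push_cast at h4
      simpa [hδ] using h4.le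
    · intro p hp hd
      have hc := coprime_of_solution huv h1 h2 rfl
      exact (Nat.prime_of_mem_primeFactors hp).one_lt.ne'
        (Nat.dvd_one.1 (hc ▸ Nat.dvd_gcd hd (Nat.dvd_of_mem_primeFactors hp)))
  have hfib : ∀ h ∈ H, ((S.filter fun q => (δ q).natAbs = h).card : ℝ) ≤
      2 * E * ∏ p ∈ G.filter (· ∣ h), (1 - (p : ℝ)⁻¹)⁻¹ := by
    intro h hh
    have hsub : (S.filter fun q => (δ q).natAbs = h) ⊆
        (S.filter fun q => δ q = h) ∪ (S.filter fun q => δ q = -h) := by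
      intro q hq
      obtain ⟨h1, h2⟩ := Finset.mem_filter.1 hq
      rw [← Finset.filter_or]
      refine Finset.mem_filter.2 ⟨h1, ?_⟩
      omega
    -- A prime of `G` dividing `h` is only guaranteed one excluded class. Factoring out the full
    -- product over `G` leaves the weight `∏ (1 - 1/p)⁻¹` that `sieve_sum_le` averages.
    have hone : ∀ z : ℤ, z.natAbs = h → ((S.filter fun q => δ q = z).card : ℝ) ≤
        E * ∏ p ∈ G.filter (· ∣ h), (1 - (p : ℝ)⁻¹)⁻¹ := by
      intro z hz
      refine (card_solutions_le (v := v) hg hu huv z _ ?_).trans (le_of_eq ?_)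
      · intro q hq
        obtain ⟨h1, h2⟩ := Finset.mem_filter.1 hq
        obtain ⟨a1, a2, a3, a4, -⟩ := hS q h1
        exact ⟨a1, a2, a3, a4, h2⟩
      · rw [hE, mul_assoc _ (eulerProd G)]
        congr 1
        have : (g.primeFactors.filter fun p => ¬ p ∣ u * v ∧ ¬ (p : ℤ) ∣ z) =
            G.filter (fun p => ¬ p ∣ h) := by
          rw [hG, Finset.filter_filter]
          refine Finset.filter_congr fun p _ => ?_
          rw [← hz, ← Int.natCast_dvd]
        rw [this, eulerProd, eulerProd,
          ← Finset.prod_filter_mul_prod_filter_not G (· ∣ h) (fun p : ℕ => 1 - (p : ℝ)⁻¹),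
          mul_comm (∏ p ∈ G.filter (· ∣ h), _), mul_assoc, ← Finset.prod_mul_distrib,
          Finset.prod_eq_one (s := G.filter (· ∣ h)), mul_one]
        intro p hp
        exact mul_inv_cancel₀ (one_sub_inv_pos (hGp p (Finset.mem_filter.1 hp).1)).ne'
    calc ((S.filter fun q => (δ q).natAbs = h).card : ℝ)
        ≤ (S.filter fun q => δ q = h).card + (S.filter fun q => δ q = -h).card := by
          exact_mod_cast (Finset.card_le_card hsub).trans (Finset.card_union_le _ _)
      _ ≤ _ := by
          have h1 := hone h (by simp)
          have h2 := hone (-h) (by simp)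
          linarith
  have hsum := sieve_sum_le A G hAp hGp (by
    rw [Finset.disjoint_left]
    intro p hp hp'
    exact (Finset.mem_filter.1 hp).2 (Nat.dvd_of_mem_primeFactors hp')) l x hx hx'
  calc (S.card : ℝ) = ∑ h ∈ H, ((S.filter fun q => (δ q).natAbs = h).card : ℝ) := by
        exact_mod_cast Finset.card_eq_sum_card_fiberwise hmaps
    _ ≤ ∑ h ∈ H, 2 * E * ∏ p ∈ G.filter (· ∣ h), (1 - (p : ℝ)⁻¹)⁻¹ := Finset.sum_le_sum hfib
    _ ≤ 2 * E * (2 * Real.exp 6 * x * eulerProd (A.filter (· ≤ l))) := by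
        rw [← Finset.mul_sum]
        exact mul_le_mul_of_nonneg_left hsum (by positivity)
    _ = _ := by
        rw [hA, ← eulerProd_mul_largePart, ← eulerProd_gcd_identity hg hu hv huv, hE]
        ring

/-! ### Moments of `largePart` -/

lemma largePart_pos (l w : ℕ) : 0 < largePart l w := zero_lt_one.trans_le (one_le_largePart l w)

lemma largePart_mono_dvd (l : ℕ) {d j : ℕ} (hd : d ∣ j) (hj : j ≠ 0) :
    largePart l d ≤ largePart l j := by
  classical
  have hsub : d.primeFactors.filter (l < ·) ⊆ j.primeFactors.filter (l < ·) :=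
    Finset.filter_subset_filter _ (Nat.primeFactors_mono hd hj)
  rw [largePart, largePart, ← Finset.prod_sdiff hsub]
  refine le_mul_of_one_le_left (largePart_pos l d).le (Finset.one_le_prod fun p hp => ?_)
  exact largePart_factor_one_le (Finset.mem_sdiff.1 hp).1

lemma largePart_mul_le (l : ℕ) {u v : ℕ} (hu : u ≠ 0) (hv : v ≠ 0) :
    largePart l (u * v) ≤ largePart l u * largePart l v := by
  classical
  have h := Finset.prod_union_inter (s₁ := u.primeFactors.filter (l < ·))
    (s₂ := v.primeFactors.filter (l < ·)) (f := fun p : ℕ => (1 - (p : ℝ)⁻¹)⁻¹)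
  rw [← Finset.filter_union, ← Nat.primeFactors_mul hu hv] at h
  rw [largePart, largePart, largePart, ← h]
  refine le_mul_of_one_le_right (largePart_pos l _).le (Finset.one_le_prod fun p hp => ?_)
  exact largePart_factor_one_le (Finset.mem_inter.1 hp).1

/-- A bound for the moments of `largePart`. -/
noncomputable def momentBound (k : ℕ) : ℝ := Real.exp (2 * (k + 1) * Real.exp (2 * (k + 1)))

lemma momentBound_pos (k : ℕ) : 0 < momentBound k := Real.exp_pos _

/-- For `p > l` the quantity `(k + l) / (p - 1)` is bounded in terms of `k` alone, so `exp y - 1 ≤ y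
* exp y` is linear in it up to a constant depending on `k`. -/
lemma inv_one_sub_inv_pow_sub_one_le (k l : ℕ) {p : ℕ} (hp : p.Prime) (hl : l < p) :
    ((1 - (p : ℝ)⁻¹)⁻¹) ^ (k + l) - 1 ≤
      (k + l : ℕ) * Real.exp (2 * (k + 1)) * ((p : ℝ) - 1)⁻¹ := by
  have hp1 := pred_pos hp
  set y : ℝ := (k + l : ℕ) * ((p : ℝ) - 1)⁻¹ with hy
  have hy0 : 0 ≤ y := by positivity
  have hy1 : y ≤ 2 * (k + 1) := by
    have h1 := half_succ_le_pred hp hl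
    rw [hy, ← div_eq_mul_inv, div_le_iff₀ hp1]
    push_cast
    have : (0 : ℝ) ≤ k * l := by positivity
    nlinarith
  have h1 : ((1 - (p : ℝ)⁻¹)⁻¹) ^ (k + l) ≤ Real.exp y := by
    rw [inv_one_sub_inv hp, hy, Real.exp_nat_mul]
    gcongr
    rw [add_comm]
    exact Real.add_one_le_exp _
  have h2 : Real.exp y - 1 ≤ y * Real.exp y := by
    have h3 := Real.add_one_le_exp (-y)
    have h4 : Real.exp (-y) * Real.exp y = 1 := by rw [← Real.exp_add]; simp
    nlinarith [Real.exp_pos y]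
  calc ((1 - (p : ℝ)⁻¹)⁻¹) ^ (k + l) - 1 ≤ y * Real.exp y := by linarith
    _ ≤ y * Real.exp (2 * (k + 1)) := by gcongr
    _ = _ := by rw [hy]; ring

/-- The mean of this multiplicative function is an Euler product over `p > l`, with exponent at most
a constant times `(k + l) * ∑ 1 / (p (p - 1))`. The sum is `O(1 / (l + 1))`, so it absorbs the
growing power and the bound is uniform in `l`. -/
lemma sum_largePart_pow_le (k l N : ℕ) :
    ∑ u ∈ Finset.Ioc 0 N, largePart l u ^ (k + l) ≤ N * momentBound k := by
  classical
  set G := (Finset.range (N + 1)).filter (fun p => p.Prime ∧ l < p) with hG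
  have hGp : ∀ p ∈ G, p.Prime ∧ l < p := fun p hp => (Finset.mem_filter.1 hp).2
  have hone : ∀ p ∈ G, 1 ≤ (1 - (p : ℝ)⁻¹)⁻¹ := fun p hp =>
    (one_le_inv₀ (one_sub_inv_pos (hGp p hp).1)).2 (one_sub_inv_le_one p)
  set c : ℕ → ℝ := fun p => ((1 - (p : ℝ)⁻¹)⁻¹) ^ (k + l) - 1 with hc
  have hc0 : ∀ p ∈ G, 0 ≤ c p := fun p hp => sub_nonneg.2 (one_le_pow₀ (hone p hp))
  have h1 : ∀ u ∈ Finset.Ioc 0 N, largePart l u ^ (k + l) =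
      ∏ p ∈ G.filter (· ∣ u), (1 + c p) := by
    intro u hu
    rw [Finset.mem_Ioc] at hu
    have : u.primeFactors.filter (l < ·) = G.filter (· ∣ u) := by
      ext p
      simp only [Finset.mem_filter, Nat.mem_primeFactors, hG, Finset.mem_range]
      constructor
      · rintro ⟨⟨a1, a2, a3⟩, a4⟩
        exact ⟨⟨Nat.lt_succ_of_le ((Nat.le_of_dvd hu.1 a2).trans hu.2), a1, a4⟩, a2⟩
      · rintro ⟨⟨-, a1, a4⟩, a2⟩
        exact ⟨⟨a1, a2, hu.1.ne'⟩, a4⟩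
    rw [largePart, this, ← Finset.prod_pow]
    exact Finset.prod_congr rfl fun p _ => by simp [hc]
  rw [Finset.sum_congr rfl h1]
  refine (sum_prod_dvd_le _ G (fun p hp => (hGp p hp).1) c hc0 N ?_).trans ?_
  · intro D hD
    rw [Nat.Ioc_filter_dvd_card_eq_div, Finset.prod_inv_distrib, ← Nat.cast_prod,
      ← div_eq_mul_inv]
    exact Nat.cast_div_le
  · refine mul_le_mul_of_nonneg_left ?_ (Nat.cast_nonneg _)
    calc ∏ p ∈ G, (1 + c p * (p : ℝ)⁻¹) ≤ ∏ p ∈ G, Real.exp (c p * (p : ℝ)⁻¹) := by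
          refine Finset.prod_le_prod (fun p hp => ?_) fun p hp => ?_
          · have := hc0 p hp
            positivity
          · rw [add_comm]; exact Real.add_one_le_exp _
      _ = Real.exp (∑ p ∈ G, c p * (p : ℝ)⁻¹) := (Real.exp_sum _ _).symm
      _ ≤ momentBound k := by
          refine Real.exp_le_exp.2 ?_
          calc ∑ p ∈ G, c p * (p : ℝ)⁻¹
              ≤ ∑ p ∈ G, ((k + l : ℕ) * Real.exp (2 * (k + 1))) * ((p : ℝ) * (p - 1))⁻¹ := by
                refine Finset.sum_le_sum fun p hp => ?_
                have := inv_one_sub_inv_pow_sub_one_le k l (hGp p hp).1 (hGp p hp).2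
                calc c p * (p : ℝ)⁻¹ ≤ ((k + l : ℕ) * Real.exp (2 * (k + 1)) *
                      ((p : ℝ) - 1)⁻¹) * (p : ℝ)⁻¹ := by gcongr
                  _ = _ := by rw [mul_inv]; ring
            _ ≤ ((k + l : ℕ) * Real.exp (2 * (k + 1))) * (2 / (l + 1)) := by
                rw [← Finset.mul_sum]
                exact mul_le_mul_of_nonneg_left (sum_inv_mul_pred_le G l hGp) (by positivity)
            _ ≤ 2 * (k + 1) * Real.exp (2 * (k + 1)) := by
                have h3 : ((k + l : ℕ) : ℝ) * (2 / (l + 1)) ≤ 2 * (k + 1) := by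
                  rw [mul_div_assoc', div_le_iff₀ (by positivity)]
                  push_cast
                  have : (0 : ℝ) ≤ k * l := by positivity
                  nlinarith
                calc _ = ((k + l : ℕ) : ℝ) * (2 / (l + 1)) * Real.exp (2 * (k + 1)) := by ring
                  _ ≤ _ := by gcongr

lemma cast_totient_eq (n : ℕ) : (n.totient : ℝ) = n * eulerProd n.primeFactors := by
  have h := Nat.totient_eq_mul_prod_factors n
  have h' : ((n.totient : ℚ) : ℝ) = ((n * ∏ p ∈ n.primeFactors, (1 - (p : ℚ)⁻¹) : ℚ) : ℝ) := by
    rw [h]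
  push_cast at h'
  exact h'

/-- The weight `φ(m / v) / m` is the proportion of residues `j` modulo `m` with `gcd m j = v`. The
sum is thus the average of a power of `largePart l (gcd m j)`, which is at most `largePart l j`. -/
lemma sum_divisors_largePart_le (k l : ℕ) {m : ℕ} (hm : 0 < m) :
    ∑ v ∈ m.divisors, eulerProd (m / v).primeFactors / v * largePart l v ^ (k + l) ≤
      momentBound k := by
  have hm0 : (0 : ℝ) < m := by exact_mod_cast hm
  have h1 : ∀ v ∈ m.divisors, eulerProd (m / v).primeFactors / v * largePart l v ^ (k + l) =
      (m : ℝ)⁻¹ * ∑ j ∈ (Finset.range m).filter (fun j => m.gcd j = v),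
        largePart l (m.gcd j) ^ (k + l) := by
    intro v hv
    have hd := Nat.dvd_of_mem_divisors hv
    have hv0 : (v : ℝ) ≠ 0 := by
      exact_mod_cast (Nat.pos_of_dvd_of_pos hd hm).ne'
    rw [Finset.sum_congr rfl (g := fun _ => largePart l v ^ (k + l))
      (fun j hj => by rw [(Finset.mem_filter.1 hj).2]), Finset.sum_const,
      ← Nat.totient_div_of_dvd hd, nsmul_eq_mul, cast_totient_eq, Nat.cast_div hd hv0]
    field_simp
  rw [Finset.sum_congr rfl h1, ← Finset.mul_sum,
    Finset.sum_fiberwise_of_maps_to (fun j _ => Nat.mem_divisors.2 ⟨Nat.gcd_dvd_left m j, hm.ne'⟩)]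
  -- The residue `0` is replaced by `m`, because monotonicity under divisibility needs a nonzero
  -- multiple.
  have h2 : ∑ j ∈ Finset.range m, largePart l (m.gcd j) ^ (k + l) =
      ∑ j ∈ Finset.range m, largePart l (m.gcd (j + 1)) ^ (k + l) := by
    have h3 := Finset.sum_range_succ (fun j => largePart l (m.gcd j) ^ (k + l)) m
    rw [Finset.sum_range_succ'] at h3
    simp only [Nat.gcd_zero_right, Nat.gcd_self] at h3
    linarith
  rw [h2]
  have h3 : ∑ j ∈ Finset.range m, largePart l (m.gcd (j + 1)) ^ (k + l) ≤
      ∑ u ∈ Finset.Ioc 0 m, largePart l u ^ (k + l) := by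
    have h4 : ∑ u ∈ Finset.Ioc 0 m, largePart l u ^ (k + l) =
        ∑ j ∈ Finset.range m, largePart l (j + 1) ^ (k + l) := by
      rw [← Finset.sum_image (s := Finset.range m) (g := fun j => j + 1)
        (f := fun u => largePart l u ^ (k + l)) (by simp)]
      congr 1
      ext u
      simp only [Finset.mem_Ioc, Finset.mem_image, Finset.mem_range]
      exact ⟨fun h => ⟨u - 1, by omega, by omega⟩, by rintro ⟨a, ha, rfl⟩; omega⟩
    rw [h4]
    refine Finset.sum_le_sum fun j _ => ?_
    exact pow_le_pow_left₀ (largePart_pos _ _).le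
      (largePart_mono_dvd l (Nat.gcd_dvd_right _ _) (Nat.succ_ne_zero j)) _
  calc (m : ℝ)⁻¹ * _ ≤ (m : ℝ)⁻¹ * (m * momentBound k) :=
        mul_le_mul_of_nonneg_left (h3.trans (sum_largePart_pow_le k l m)) (by positivity)
    _ = momentBound k := by field_simp

/-! ### The second moment -/

/-- Bound for the numerator of the difference of two close fractions. -/
noncomputable def gapBound (r : ℕ → ℝ) (n m : ℕ) : ℝ := 2 * max (r n) (r m) * (n.lcm m : ℕ)

/-- The sieving level attached to a pair of denominators. -/
noncomputable def sieveLevel (r : ℕ → ℝ) (n m : ℕ) : ℕ := Nat.log 4 ⌊gapBound r n m⌋₊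

/-- The arithmetic factor in the overlap estimate for a pair of denominators. -/
noncomputable def overlapFactor (r : ℕ → ℝ) (n m : ℕ) : ℝ :=
  largePart (sieveLevel r n m) ((n / n.gcd m) * (m / n.gcd m))

lemma gapBound_comm (r : ℕ → ℝ) (n m : ℕ) : gapBound r n m = gapBound r m n := by
  rw [gapBound, gapBound, max_comm, Nat.lcm_comm]

lemma overlapFactor_comm (r : ℕ → ℝ) (n m : ℕ) : overlapFactor r n m = overlapFactor r m n := by
  rw [overlapFactor, overlapFactor, sieveLevel, sieveLevel, gapBound_comm, Nat.gcd_comm, mul_comm]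

lemma sieveLevel_spec {r : ℕ → ℝ} {n m : ℕ} (h : 1 ≤ gapBound r n m) :
    (4 : ℝ) ^ sieveLevel r n m ≤ gapBound r n m ∧
      gapBound r n m < 4 ^ (sieveLevel r n m + 1) := by
  have h1 : ⌊gapBound r n m⌋₊ ≠ 0 := (Nat.floor_pos.2 h).ne'
  constructor
  · have h2 : 4 ^ sieveLevel r n m ≤ ⌊gapBound r n m⌋₊ := Nat.pow_log_le_self 4 h1
    calc (4 : ℝ) ^ sieveLevel r n m = ((4 ^ sieveLevel r n m : ℕ) : ℝ) := by push_cast; rfl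
      _ ≤ ⌊gapBound r n m⌋₊ := by exact_mod_cast h2
      _ ≤ gapBound r n m := Nat.floor_le (by linarith)
  · have h2 : ⌊gapBound r n m⌋₊ < 4 ^ (sieveLevel r n m + 1) :=
      Nat.lt_pow_succ_log_self (by norm_num) _
    have := (Nat.floor_lt (by linarith)).1 h2
    exact_mod_cast this

lemma eulerProd_le_one {s : Finset ℕ} (hs : ∀ p ∈ s, p.Prime) : eulerProd s ≤ 1 :=
  Finset.prod_le_one (fun p hp => (one_sub_inv_pos (hs p hp)).le) fun p _ => one_sub_inv_le_one p

lemma eulerProd_primeFactors_pos (n : ℕ) : 0 < eulerProd n.primeFactors :=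
  eulerProd_pos fun _ hp => Nat.prime_of_mem_primeFactors hp

lemma eulerProd_anti_dvd {d n : ℕ} (hd : d ∣ n) (hn : n ≠ 0) :
    eulerProd n.primeFactors ≤ eulerProd d.primeFactors := by
  classical
  rw [eulerProd, ← Finset.prod_sdiff (Nat.primeFactors_mono hd hn)]
  refine mul_le_of_le_one_left (eulerProd_primeFactors_pos d).le ?_
  exact eulerProd_le_one fun p hp =>
    Nat.prime_of_mem_primeFactors (Finset.mem_sdiff.1 hp).1

/-- The bound separates into a function of `v = m / gcd`, a function of `u = n / gcd` and a factor
of the level `l`, so that a sum over `n` becomes a product of two sums. The second part confines `u`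
to an interval whose length matches the factor `m * r m`. -/
lemma bad_term_le {k : ℕ} (hk : 2 ≤ k) {r : ℕ → ℝ} {n m : ℕ} (hn : 0 < n) (hm : 0 < m)
    (hrn : 0 < r n) (hrm : 0 < r m) (hlam : r n * n.totient ≤ 1) (hψ : n * r n ≤ m * r m)
    (hgap : 1 ≤ gapBound r n m) (hbad : 32 < overlapFactor r n m) :
    (r n * n.totient * overlapFactor r n m) ^ k ≤
      4 ^ (sieveLevel r n m + 1) / 32 ^ sieveLevel r n m *
      (eulerProd (m / (m / n.gcd m)).primeFactors / (m / n.gcd m : ℕ) *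
        largePart (sieveLevel r n m) (m / n.gcd m) ^ (k + sieveLevel r n m)) *
      ((m * r m) * largePart (sieveLevel r n m) (n / n.gcd m) ^ (k + sieveLevel r n m)) ∧
    ((n / n.gcd m : ℕ) : ℝ) ≤ 4 ^ (sieveLevel r n m + 1) / (m * r m) := by
  obtain ⟨-, hlev⟩ := sieveLevel_spec hgap
  set l := sieveLevel r n m with hl
  set g := n.gcd m with hg
  have hgpos : 0 < g := Nat.gcd_pos_of_pos_left m hn
  set u := n / g with hu
  set v := m / g with hv
  have hnu : n = g * u := (Nat.mul_div_cancel' (Nat.gcd_dvd_left n m)).symm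
  have hmv : m = g * v := (Nat.mul_div_cancel' (Nat.gcd_dvd_right n m)).symm
  have hupos : 0 < u := Nat.pos_of_ne_zero (by rintro h; rw [h] at hnu; omega)
  have hvpos : 0 < v := Nat.pos_of_ne_zero (by rintro h; rw [h] at hmv; omega)
  have hmvg : m / v = g := by rw [hmv]; exact Nat.mul_div_cancel _ hvpos
  have hlcm : n.lcm m = g * u * v := by
    rw [Nat.lcm, ← hg]
    conv_lhs => rw [hnu, hmv]
    rw [show g * u * (g * v) = g * (g * u * v) by ring, Nat.mul_div_cancel_left _ hgpos]
  have hg0 : (0 : ℝ) < g := by exact_mod_cast hgpos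
  have hu0 : (0 : ℝ) < u := by exact_mod_cast hupos
  have hv0 : (0 : ℝ) < v := by exact_mod_cast hvpos
  have hn0 : (0 : ℝ) < n := by exact_mod_cast hn
  have hm0 : (0 : ℝ) < m := by exact_mod_cast hm
  have hgapn : (n * r n) * v ≤ 4 ^ (l + 1) := by
    have : 2 * r n * (n * v) ≤ gapBound r n m := by
      rw [gapBound, hlcm, ← hnu]
      push_cast
      gcongr
      exact le_max_left _ _
    have : 0 < (n * r n) * v := by positivity
    linarith
  have hgapm : (m * r m) * u ≤ 4 ^ (l + 1) := by
    have : 2 * r m * (m * u) ≤ gapBound r n m := by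
      rw [gapBound, hlcm, mul_right_comm g, ← hmv]
      push_cast
      gcongr
      exact le_max_right _ _
    have : 0 < (m * r m) * u := by positivity
    linarith
  have hψm : 0 < (m : ℝ) * r m := by positivity
  refine ⟨?_, by rw [le_div_iff₀ hψm]; linarith⟩
  set P := overlapFactor r n m with hP
  have hPle : P ≤ largePart l u * largePart l v := largePart_mul_le l hupos.ne' hvpos.ne'
  have hP0 : 0 < P := by linarith
  set lam := r n * n.totient with hlamdef
  have hlam0 : 0 ≤ lam := by positivity
  rw [hmvg]
  set ρ := eulerProd g.primeFactors with hρ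
  have hρ0 : 0 < ρ := eulerProd_primeFactors_pos g
  -- One factor `lam` is spent on `n * r n ≤ m * r m`. The other keeps the Euler product of `g ∣ n`
  -- and uses `(n * r n) * v ≤ 4 ^ (l + 1)`.
  have h1 : lam ^ 2 ≤ (m * r m) * (4 ^ (l + 1) / v) * ρ := by
    have e1 : lam ≤ n * r n := by
      rw [hlamdef, mul_comm]
      gcongr
      exact Nat.totient_le n
    have e2 : lam ≤ (n * r n) * ρ := by
      have := eulerProd_anti_dvd (Nat.gcd_dvd_left n m) hn.ne'
      rw [hlamdef, cast_totient_eq]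
      calc r n * (n * eulerProd n.primeFactors) = (n * r n) * eulerProd n.primeFactors := by ring
        _ ≤ _ := by gcongr
    calc lam ^ 2 = lam * lam := sq lam
      _ ≤ (m * r m) * ((n * r n) * ρ) := by
          apply mul_le_mul (e1.trans hψ) e2 hlam0 hψm.le
      _ ≤ (m * r m) * ((4 ^ (l + 1) / v) * ρ) := by
          gcongr
          rw [le_div_iff₀ hv0]; exact hgapn
      _ = _ := by ring
  have h2 : lam ^ k ≤ lam ^ 2 := pow_le_pow_of_le_one hlam0 hlam hk
  -- Rankin's trick: `P > 32` trades `l` extra powers of `P`, whose moments are under control, for a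
  -- gain of `32 ^ l`.
  have h3 : P ^ k ≤ P ^ (k + l) / 32 ^ l := by
    rw [le_div_iff₀ (by positivity), pow_add]
    gcongr
  have h4 : P ^ (k + l) ≤ largePart l u ^ (k + l) * largePart l v ^ (k + l) := by
    rw [← mul_pow]
    gcongr
  have hLu := largePart_pos l u
  have hLv := largePart_pos l v
  calc (lam * P) ^ k = lam ^ k * P ^ k := mul_pow _ _ _
    _ ≤ ((m * r m) * (4 ^ (l + 1) / v) * ρ) *
        (largePart l u ^ (k + l) * largePart l v ^ (k + l) / 32 ^ l) := by
        refine mul_le_mul (h2.trans h1) (h3.trans ?_) (by positivity) (by positivity)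
        gcongr
    _ = _ := by ring

/-- For fixed `m` the terms are grouped by level. At level `l` the sum over `v ∣ m` is bounded and
that over `u` is at most `4 ^ (l + 1)` times a constant, giving `4 ^ (l + 1) * 4 ^ (l + 1) / 32 ^ l
= 16 * 2 ^ (-l)`. The threshold `32` is what makes this geometric series converge. -/
lemma sum_bad_le {k : ℕ} (hk : 2 ≤ k) {r : ℕ → ℝ} {m : ℕ} (hm : 0 < m) (hrm : 0 < r m)
    (F : Finset ℕ) (hF : ∀ n ∈ F, 0 < n ∧ 0 < r n ∧ r n * n.totient ≤ 1 ∧ n * r n ≤ m * r m ∧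
      1 ≤ gapBound r n m ∧ 32 < overlapFactor r n m) :
    ∑ n ∈ F, (r n * n.totient * overlapFactor r n m) ^ k ≤ 32 * momentBound k ^ 2 := by
  classical
  set L := F.sup (fun n => sieveLevel r n m) + 1 with hL
  have hψm : 0 < (m : ℝ) * r m := by
    have : (0 : ℝ) < m := by exact_mod_cast hm
    positivity
  have hmaps : ∀ n ∈ F, sieveLevel r n m ∈ Finset.range L := fun n hn =>
    Finset.mem_range.2 (Nat.lt_succ_of_le (Finset.le_sup (f := fun n => sieveLevel r n m) hn))
  rw [← Finset.sum_fiberwise_of_maps_to hmaps]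
  have hB := momentBound_pos k
  have hlevel : ∀ l ∈ Finset.range L, ∑ n ∈ F.filter (fun n => sieveLevel r n m = l),
      (r n * n.totient * overlapFactor r n m) ^ k ≤ 16 * momentBound k ^ 2 * (1 / 2) ^ l := by
    intro l _
    set a : ℕ → ℝ := fun v => eulerProd (m / v).primeFactors / v * largePart l v ^ (k + l) with ha
    set b : ℕ → ℝ := fun u => (m * r m) * largePart l u ^ (k + l) with hb
    set U := Finset.Ioc 0 ⌊(4 : ℝ) ^ (l + 1) / (m * r m)⌋₊ with hU
    have ha0 : ∀ v, 0 ≤ a v := fun v => by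
      have h1 := eulerProd_primeFactors_pos (m / v)
      have h2 := largePart_pos l v
      positivity
    have hb0 : ∀ u, 0 ≤ b u := fun u => by
      have h2 := largePart_pos l u
      positivity
    have hbsum : ∑ u ∈ U, b u ≤ 4 ^ (l + 1) * momentBound k := by
      rw [hb, ← Finset.mul_sum]
      calc (m * r m) * ∑ u ∈ U, largePart l u ^ (k + l)
          ≤ (m * r m) * (⌊(4 : ℝ) ^ (l + 1) / (m * r m)⌋₊ * momentBound k) := by
            gcongr
            exact sum_largePart_pow_le k l _
        _ ≤ (m * r m) * ((4 : ℝ) ^ (l + 1) / (m * r m) * momentBound k) := by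
            gcongr
            exact Nat.floor_le (by positivity)
        _ = _ := by field_simp
    have hasum : ∑ v ∈ m.divisors, a v ≤ momentBound k := sum_divisors_largePart_le k l hm
    set e : ℕ → ℕ × ℕ := fun n => (m / n.gcd m, n / n.gcd m) with he
    -- Given `m`, the quotient `m / gcd` determines the gcd, and then `n / gcd` determines `n`.
    have hinj : Set.InjOn e (F.filter (fun n => sieveLevel r n m = l)) := by
      intro n hn n' hn' hee
      have hpos := (hF n (Finset.mem_filter.1 hn).1).1
      have hpos' := (hF n' (Finset.mem_filter.1 hn').1).1
      simp only [he, Prod.mk.injEq] at hee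
      have h1 : n.gcd m = n'.gcd m := by
        have e1 := Nat.div_mul_cancel (Nat.gcd_dvd_right n m)
        have e2 := Nat.div_mul_cancel (Nat.gcd_dvd_right n' m)
        rw [← hee.1] at e2
        have hpos : 0 < m / n.gcd m :=
          Nat.div_pos (Nat.le_of_dvd hm (Nat.gcd_dvd_right n m)) (Nat.gcd_pos_of_pos_left m hpos)
        exact Nat.eq_of_mul_eq_mul_left hpos (e1.trans e2.symm)
      rw [← Nat.div_mul_cancel (Nat.gcd_dvd_left n m),
        ← Nat.div_mul_cancel (Nat.gcd_dvd_left n' m), hee.2, h1]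
    calc ∑ n ∈ F.filter (fun n => sieveLevel r n m = l),
        (r n * n.totient * overlapFactor r n m) ^ k
        ≤ ∑ n ∈ F.filter (fun n => sieveLevel r n m = l),
          4 ^ (l + 1) / 32 ^ l * (a (e n).1 * b (e n).2) := by
          refine Finset.sum_le_sum fun n hn => ?_
          obtain ⟨hnF, rfl⟩ := Finset.mem_filter.1 hn
          obtain ⟨h1, h2, h3, h4, h5, h6⟩ := hF n hnF
          have := (bad_term_le hk h1 hm h2 hrm h3 h4 h5 h6).1
          rw [← mul_assoc]
          exact this
      _ = 4 ^ (l + 1) / 32 ^ l * ∑ q ∈ (F.filter (fun n => sieveLevel r n m = l)).image e,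
          a q.1 * b q.2 := by
          rw [Finset.sum_image hinj, Finset.mul_sum]
      _ ≤ 4 ^ (l + 1) / 32 ^ l * ∑ q ∈ m.divisors ×ˢ U, a q.1 * b q.2 := by
          refine mul_le_mul_of_nonneg_left ?_ (by positivity)
          refine Finset.sum_le_sum_of_subset_of_nonneg ?_
            fun q _ _ => mul_nonneg (ha0 _) (hb0 _)
          intro q hq
          obtain ⟨n, hn, rfl⟩ := Finset.mem_image.1 hq
          obtain ⟨hnF, rfl⟩ := Finset.mem_filter.1 hn
          obtain ⟨h1, h2, h3, h4, h5, h6⟩ := hF n hnF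
          have := (bad_term_le hk h1 hm h2 hrm h3 h4 h5 h6).2
          rw [Finset.mem_product]
          refine ⟨Nat.mem_divisors.2 ⟨Nat.div_dvd_of_dvd (Nat.gcd_dvd_right n m), hm.ne'⟩, ?_⟩
          rw [hU, Finset.mem_Ioc]
          exact ⟨Nat.div_pos (Nat.le_of_dvd h1 (Nat.gcd_dvd_left n m))
            (Nat.gcd_pos_of_pos_left m h1), Nat.le_floor this⟩
      _ = 4 ^ (l + 1) / 32 ^ l * ((∑ v ∈ m.divisors, a v) * ∑ u ∈ U, b u) := by
          rw [Finset.sum_mul_sum, Finset.sum_product]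
      _ ≤ 4 ^ (l + 1) / 32 ^ l * (momentBound k * (4 ^ (l + 1) * momentBound k)) := by
          refine mul_le_mul_of_nonneg_left ?_ (by positivity)
          exact mul_le_mul hasum hbsum (Finset.sum_nonneg fun u _ => hb0 u) hB.le
      _ = 16 * momentBound k ^ 2 * (1 / 2) ^ l := by
          have : (4 : ℝ) ^ l * 4 ^ l = 32 ^ l * (1 / 2) ^ l := by
            rw [← mul_pow, ← mul_pow]; norm_num
          rw [pow_succ]
          field_simp
          linear_combination 16 * this
  calc _ ≤ ∑ l ∈ Finset.range L, 16 * momentBound k ^ 2 * (1 / 2 : ℝ) ^ l :=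
        Finset.sum_le_sum hlevel
    _ = 16 * momentBound k ^ 2 * ∑ l ∈ Finset.range L, (1 / 2 : ℝ) ^ l := by
        rw [Finset.mul_sum]
    _ ≤ 16 * momentBound k ^ 2 * 2 := by
        gcongr
        exact sum_geometric_two_le L
    _ = 32 * momentBound k ^ 2 := by ring

/-- Numerators of the reduced fractions with denominator `n` in `(0, 1]`. -/
noncomputable def numerators (n : ℕ) : Finset ℤ := (Finset.Icc 1 (n : ℤ)).filter fun a => Int.gcd a n = 1

lemma mem_numerators {n : ℕ} {a : ℤ} :
    a ∈ numerators n ↔ 1 ≤ a ∧ a ≤ n ∧ Int.gcd a n = 1 := by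
  simp [numerators, and_assoc]

lemma card_numerators (n : ℕ) : (numerators n).card = n.totient := by
  rw [← Nat.filter_coprime_Ico_eq_totient n 1]
  symm
  refine Finset.card_bij (fun a _ => (a : ℤ)) ?_ ?_ ?_
  · intro a ha
    obtain ⟨h1, h2⟩ := Finset.mem_filter.1 ha
    rw [Finset.mem_Ico] at h1
    rw [mem_numerators]
    refine ⟨by omega, by omega, ?_⟩
    rw [Int.gcd_natCast_natCast]
    exact h2.symm
  · intro a _ b _ h
    exact_mod_cast h
  · intro b hb
    rw [mem_numerators] at hb
    lift b to ℕ using by omega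
    refine ⟨b, Finset.mem_filter.2 ⟨Finset.mem_Ico.2 ⟨by omega, by omega⟩, ?_⟩, rfl⟩
    have := hb.2.2
    rw [Int.gcd_natCast_natCast] at this
    exact Nat.Coprime.symm this

/-- Pairs of numerators of fractions with denominators `n` and `m` whose neighbourhoods of radii
`r n` and `r m` may meet. -/
noncomputable def closePairs (r : ℕ → ℝ) (n m : ℕ) : Finset (ℤ × ℤ) :=
  (numerators n ×ˢ numerators m).filter fun q =>
    |(q.1 : ℝ) / n - q.2 / m| < 2 * max (r n) (r m)

/-- Distinct fractions differ by a nonzero integer over the lcm, so none are close when `gapBound`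
is below `1`. Otherwise the sieve bound is rewritten through `min * max = r n * r m` and `gcd * lcm
= n * m`, which produces the two factors `λ`. -/
lemma min_mul_card_distinct_le {r : ℕ → ℝ} {n m : ℕ} (hn : 0 < n) (hm : 0 < m) (hrn : 0 < r n)
    (hrm : 0 < r m) :
    ∃ c : ℝ, ((((closePairs r n m).filter fun q => (q.1 : ℝ) / n ≠ q.2 / m).card : ℝ) = c ∧
      (gapBound r n m < 1 → c = 0) ∧ (1 ≤ gapBound r n m → 2 * min (r n) (r m) * c ≤
        16 * Real.exp 6 * ((r n * n.totient) * (r m * m.totient) * overlapFactor r n m))) := by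
  refine ⟨_, rfl, ?_⟩
  set S := (closePairs r n m).filter fun q => (q.1 : ℝ) / n ≠ q.2 / m with hS
  set g := n.gcd m with hg
  have hgpos : 0 < g := Nat.gcd_pos_of_pos_left m hn
  set u := n / g with hu
  set v := m / g with hv
  have hnu : n = g * u := (Nat.mul_div_cancel' (Nat.gcd_dvd_left n m)).symm
  have hmv : m = g * v := (Nat.mul_div_cancel' (Nat.gcd_dvd_right n m)).symm
  have hupos : 0 < u := Nat.pos_of_ne_zero (by rintro h; rw [h] at hnu; omega)
  have hvpos : 0 < v := Nat.pos_of_ne_zero (by rintro h; rw [h] at hmv; omega)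
  have huv : u.Coprime v := Nat.coprime_div_gcd_div_gcd hgpos
  have hlcm : n.lcm m = g * u * v := by
    rw [Nat.lcm, ← hg]
    conv_lhs => rw [hnu, hmv]
    rw [show g * u * (g * v) = g * (g * u * v) by ring, Nat.mul_div_cancel_left _ hgpos]
  have hg0 : (0 : ℝ) < g := by exact_mod_cast hgpos
  have hu0 : (0 : ℝ) < u := by exact_mod_cast hupos
  have hv0 : (0 : ℝ) < v := by exact_mod_cast hvpos
  have hnR : (n : ℝ) = g * u := by exact_mod_cast hnu
  have hmR : (m : ℝ) = g * v := by exact_mod_cast hmv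
  have hdiff : ∀ q : ℤ × ℤ, ((q.1 * v - q.2 * u : ℤ) : ℝ) =
      ((q.1 : ℝ) / n - q.2 / m) * (n.lcm m : ℕ) := by
    intro q
    rw [hlcm, hnR, hmR]
    push_cast
    field_simp
  have hlcm0 : (0 : ℝ) < (n.lcm m : ℕ) := by exact_mod_cast Nat.lcm_pos hn hm
  have hmem : ∀ q ∈ S, 1 ≤ q.1 ∧ q.1 ≤ (g * u : ℕ) ∧ Int.gcd q.1 (g * u : ℕ) = 1 ∧
      Int.gcd q.2 (g * v : ℕ) = 1 ∧ q.1 * v - q.2 * u ≠ 0 ∧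
      |((q.1 * v - q.2 * u : ℤ) : ℝ)| < gapBound r n m := by
    intro q hq
    obtain ⟨hq1, hq2⟩ := Finset.mem_filter.1 hq
    obtain ⟨hq3, hq4⟩ := Finset.mem_filter.1 hq1
    obtain ⟨hq5, hq6⟩ := Finset.mem_product.1 hq3
    rw [mem_numerators] at hq5 hq6
    rw [← hnu, ← hmv]
    refine ⟨hq5.1, hq5.2.1, hq5.2.2, hq6.2.2, ?_, ?_⟩
    · intro h0
      have h1 := hdiff q
      rw [h0, Int.cast_zero, eq_comm, mul_eq_zero] at h1
      exact hq2 (sub_eq_zero.1 (h1.resolve_right hlcm0.ne'))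
    · rw [hdiff, abs_mul, abs_of_pos hlcm0]
      exact mul_lt_mul_of_pos_right hq4 hlcm0
  constructor
  · intro h1
    rw [Nat.cast_eq_zero, Finset.card_eq_zero, Finset.eq_empty_iff_forall_notMem]
    intro q hq
    obtain ⟨-, -, -, -, h2, h3⟩ := hmem q hq
    have h4 : |((q.1 * v - q.2 * u : ℤ) : ℝ)| < 1 := h3.trans h1
    rw [← Int.cast_abs] at h4
    exact h2 (Int.abs_lt_one_iff.1 (by exact_mod_cast h4))
  · intro h1
    obtain ⟨e1, e2⟩ := sieveLevel_spec h1
    have h2 := card_close_pairs_le hgpos hupos hvpos huv _ _ e1 e2 S hmem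
    have hmin : 0 < min (r n) (r m) := lt_min hrn hrm
    rw [← hnu, ← hmv] at h2
    refine (mul_le_mul_of_nonneg_left h2 (by positivity)).trans (le_of_eq ?_)
    calc _ = 16 * Real.exp 6 * ((min (r n) (r m) * max (r n) (r m)) * (g * (n.lcm m : ℕ)) *
          (eulerProd n.primeFactors * eulerProd m.primeFactors) *
          overlapFactor r n m) := by
          rw [gapBound, overlapFactor]; ring
      _ = _ := by
          rw [min_mul_max, ← Nat.cast_mul, Nat.gcd_mul_lcm, cast_totient_eq, cast_totient_eq]
          push_cast
          ring

/-- Coincident fractions therefore occur only on the diagonal `n = m` of the second moment. -/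
lemma eq_of_reduced_eq {n m : ℕ} (hn : 0 < n) (hm : 0 < m) {a b : ℤ} (ha : Int.gcd a n = 1)
    (hb : Int.gcd b m = 1) (h : (a : ℝ) / n = b / m) : n = m := by
  have hn0 : (n : ℝ) ≠ 0 := by exact_mod_cast hn.ne'
  have hm0 : (m : ℝ) ≠ 0 := by exact_mod_cast hm.ne'
  rw [div_eq_div_iff hn0 hm0] at h
  have h' : a * m = b * n := by exact_mod_cast h
  have ha' := (Int.isCoprime_iff_gcd_eq_one.2 ha).symm
  have hb' := (Int.isCoprime_iff_gcd_eq_one.2 hb).symm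
  have h1 : (n : ℤ) ∣ m := ha'.dvd_of_dvd_mul_left ⟨b, by rw [h']; ring⟩
  have h2 : (m : ℤ) ∣ n := hb'.dvd_of_dvd_mul_left ⟨a, by rw [← h']; ring⟩
  exact Nat.dvd_antisymm (by exact_mod_cast h1) (by exact_mod_cast h2)

/-- The second moment bound behind quasi-independence on average. -/
theorem exists_second_moment_bound {k : ℕ} (hk : 2 ≤ k) : ∃ C : ℝ, 0 < C ∧
    ∀ (r : ℕ → ℝ) (I : Finset ℕ), (∀ n ∈ I, 0 < n ∧ 0 < r n ∧ r n * n.totient ≤ 1) →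
    ∑ n ∈ I, ∑ m ∈ I, (2 * min (r n) (r m) * (closePairs r n m).card) ^ k ≤
      C * ((∑ n ∈ I, (r n * n.totient) ^ k) ^ 2 + ∑ n ∈ I, (r n * n.totient) ^ k) := by
  classical
  set C1 : ℝ := 16 * Real.exp 6 with hC1
  have hC1pos : 0 < C1 := by positivity
  have hBpos := momentBound_pos k
  refine ⟨(32 * C1) ^ k + 2 * C1 ^ k * (32 * momentBound k ^ 2) + (2 + C1) ^ k, by positivity, ?_⟩
  intro r I hI
  set lam : ℕ → ℝ := fun n => r n * n.totient with hlam
  have hlam0 : ∀ n ∈ I, 0 ≤ lam n := fun n hn => by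
    have := (hI n hn).2.1
    positivity
  -- A pair with large overlap factor is charged to whichever index has the larger `n * r n`, so
  -- that the sum over the other index is bounded by `sum_bad_le`.
  set bad : ℕ → ℕ → ℝ := fun n m =>
    if n * r n ≤ m * r m ∧ 1 ≤ gapBound r n m ∧ 32 < overlapFactor r n m then
      (lam n * overlapFactor r n m) ^ k else 0 with hbad
  have hov : ∀ n m, 0 < overlapFactor r n m := fun n m => largePart_pos _ _
  have hbad0 : ∀ n ∈ I, ∀ m, 0 ≤ bad n m := by
    intro n hn m
    simp only [hbad]
    split_ifs
    · have := hlam0 n hn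
      have := hov n m
      positivity
    · exact le_rfl
  have hbadsum : ∀ m ∈ I, ∑ n ∈ I, bad n m ≤ 32 * momentBound k ^ 2 := by
    intro m hm
    simp only [hbad]
    rw [← Finset.sum_filter]
    refine sum_bad_le hk (hI m hm).1 (hI m hm).2.1 _ ?_
    intro n hn
    obtain ⟨h1, h2, h3, h4⟩ := Finset.mem_filter.1 hn
    exact ⟨(hI n h1).1, (hI n h1).2.1, (hI n h1).2.2, h2, h3, h4⟩
  have hterm : ∀ n ∈ I, ∀ m ∈ I, (2 * min (r n) (r m) * (closePairs r n m).card) ^ k ≤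
      (32 * C1) ^ k * (lam n ^ k * lam m ^ k) + C1 ^ k * (lam m ^ k * bad n m) +
        C1 ^ k * (lam n ^ k * bad m n) + if n = m then (2 + C1) ^ k * lam n ^ k else 0 := by
    intro n hn m hm
    obtain ⟨hn0, hrn, hln⟩ := hI n hn
    obtain ⟨hm0, hrm, hlm⟩ := hI m hm
    have a1 := hlam0 n hn
    have a2 := hlam0 m hm
    have a3 := hbad0 n hn m
    have a4 := hbad0 m hm n
    obtain ⟨c, hc, hc0, hc1⟩ := min_mul_card_distinct_le hn0 hm0 hrn hrm
    have hmin : 0 < min (r n) (r m) := lt_min hrn hrm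
    by_cases hnm : n = m
    · subst hnm
      rw [if_pos rfl]
      have hnn : 0 ≤ (32 * C1) ^ k * (lam n ^ k * lam n ^ k) + C1 ^ k * (lam n ^ k * bad n n) +
        C1 ^ k * (lam n ^ k * bad n n) := by positivity
      -- On the diagonal the pairs `a = b` number `φ n`. They contribute the linear term `∑ λ ^ k`
      -- of the final bound.
      have hcard : ((closePairs r n n).card : ℝ) ≤ n.totient + c := by
        rw [← hc, ← Finset.card_filter_add_card_filter_not
          (s := closePairs r n n) (fun q => (q.1 : ℝ) / n = q.2 / n)]
        push_cast
        refine add_le_add ?_ le_rfl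
        rw [← card_numerators]
        refine Nat.cast_le.2 (Finset.card_le_card_of_injOn Prod.fst ?_ ?_)
        · intro q hq
          exact (Finset.mem_product.1 (Finset.mem_filter.1 (Finset.mem_filter.1 hq).1).1).1
        · intro q hq q' hq' he
          have hn' : (n : ℝ) ≠ 0 := by exact_mod_cast hn0.ne'
          have e1 := (Finset.mem_filter.1 hq).2
          have e2 := (Finset.mem_filter.1 hq').2
          simp only [div_left_inj' hn', Int.cast_inj] at e1 e2
          exact Prod.ext he (by rw [← e1, ← e2, he])
      have hone : overlapFactor r n n = 1 := by
        simp [overlapFactor, largePart, Nat.div_self hn0]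
      have hcb : 2 * min (r n) (r n) * c ≤ C1 * lam n := by
        rcases lt_or_ge (gapBound r n n) 1 with h | h
        · rw [hc0 h]
          simp only [mul_zero]
          positivity
        · refine (hc1 h).trans ?_
          rw [hone, mul_one]
          have : lam n * lam n ≤ lam n := mul_le_of_le_one_left a1 hln
          gcongr
      have hfin : (2 * min (r n) (r n) * (closePairs r n n).card) ^ k ≤
          ((2 + C1) * lam n) ^ k := by
        refine pow_le_pow_left₀ (by positivity) ?_ k
        calc 2 * min (r n) (r n) * ((closePairs r n n).card : ℝ)
            ≤ 2 * min (r n) (r n) * (n.totient + c) := by gcongr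
          _ = 2 * lam n + 2 * min (r n) (r n) * c := by rw [min_self, hlam]; ring
          _ ≤ (2 + C1) * lam n := by linarith
      rw [mul_pow (2 + C1)] at hfin
      linarith
    · rw [if_neg hnm, add_zero]
      have hall : (closePairs r n m).filter (fun q => (q.1 : ℝ) / n ≠ q.2 / m) =
          closePairs r n m := by
        refine Finset.filter_true_of_mem fun q hq hq' => hnm ?_
        obtain ⟨h1, h2⟩ := Finset.mem_product.1 (Finset.mem_filter.1 hq).1
        exact eq_of_reduced_eq hn0 hm0 (mem_numerators.1 h1).2.2 (mem_numerators.1 h2).2.2 hq'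
      rw [hall] at hc
      rw [hc]
      rcases lt_or_ge (gapBound r n m) 1 with h | h
      · rw [hc0 h, mul_zero, zero_pow (by omega)]
        positivity
      · have hov0 := hov n m
        have hc' : 0 ≤ c := by rw [← hc]; positivity
        have h1 : (2 * min (r n) (r m) * c) ^ k ≤
            (C1 * (lam n * lam m * overlapFactor r n m)) ^ k :=
          pow_le_pow_left₀ (by positivity) (hc1 h) k
        refine h1.trans ?_
        rcases le_or_gt (overlapFactor r n m) 32 with h32 | h32
        · have : (C1 * (lam n * lam m * overlapFactor r n m)) ^ k ≤
              (32 * C1) ^ k * (lam n ^ k * lam m ^ k) := by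
            rw [← mul_pow, ← mul_pow]
            refine pow_le_pow_left₀ (by positivity) ?_ k
            calc C1 * (lam n * lam m * overlapFactor r n m) ≤ C1 * (lam n * lam m * 32) := by
                  gcongr
              _ = _ := by ring
          have : 0 ≤ C1 ^ k * (lam m ^ k * bad n m) + C1 ^ k * (lam n ^ k * bad m n) := by
            positivity
          linarith
        · have hnn : 0 ≤ (32 * C1) ^ k * (lam n ^ k * lam m ^ k) := by positivity
          rcases le_total (n * r n) (m * r m) with hψ | hψ
          · have : bad n m = (lam n * overlapFactor r n m) ^ k := if_pos ⟨hψ, h, h32⟩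
            have h5 : (C1 * (lam n * lam m * overlapFactor r n m)) ^ k =
                C1 ^ k * (lam m ^ k * bad n m) := by
              rw [this, ← mul_pow, ← mul_pow]; ring
            have : 0 ≤ C1 ^ k * (lam n ^ k * bad m n) := by positivity
            linarith
          · have : bad m n = (lam m * overlapFactor r n m) ^ k := by
              rw [overlapFactor_comm]
              refine if_pos ⟨hψ, ?_, ?_⟩
              · rwa [gapBound_comm]
              · rwa [overlapFactor_comm]
            have h5 : (C1 * (lam n * lam m * overlapFactor r n m)) ^ k =
                C1 ^ k * (lam n ^ k * bad m n) := by
              rw [this, ← mul_pow, ← mul_pow]; ring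
            have : 0 ≤ C1 ^ k * (lam m ^ k * bad n m) := by positivity
            linarith
  set Λ := ∑ n ∈ I, lam n ^ k with hΛ
  have hΛ0 : 0 ≤ Λ := Finset.sum_nonneg fun n hn => pow_nonneg (hlam0 n hn) k
  have hgood : ∑ n ∈ I, ∑ m ∈ I, lam n ^ k * lam m ^ k = Λ ^ 2 := by
    rw [sq, hΛ, Finset.sum_mul_sum]
  have hbad1 : ∑ m ∈ I, ∑ n ∈ I, lam m ^ k * bad n m ≤ (32 * momentBound k ^ 2) * Λ := by
    rw [hΛ, Finset.mul_sum]
    refine Finset.sum_le_sum fun m hm => ?_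
    rw [← Finset.mul_sum, mul_comm]
    exact mul_le_mul_of_nonneg_right (hbadsum m hm) (pow_nonneg (hlam0 m hm) k)
  calc ∑ n ∈ I, ∑ m ∈ I, (2 * min (r n) (r m) * (closePairs r n m).card) ^ k
      ≤ ∑ n ∈ I, ∑ m ∈ I, ((32 * C1) ^ k * (lam n ^ k * lam m ^ k) +
        C1 ^ k * (lam m ^ k * bad n m) +
        C1 ^ k * (lam n ^ k * bad m n) + if n = m then (2 + C1) ^ k * lam n ^ k else 0) :=
        Finset.sum_le_sum fun n hn => Finset.sum_le_sum fun m hm => hterm n hn m hm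
    _ = (32 * C1) ^ k * Λ ^ 2 + C1 ^ k * (∑ m ∈ I, ∑ n ∈ I, lam m ^ k * bad n m) +
        C1 ^ k * (∑ m ∈ I, ∑ n ∈ I, lam m ^ k * bad n m) + (2 + C1) ^ k * Λ := by
        simp only [Finset.sum_add_distrib, ← Finset.mul_sum]
        congr 1
        · congr 1
          · congr 1
            · rw [← hgood]
              simp only [Finset.mul_sum]
            · rw [Finset.sum_comm]
              simp only [Finset.mul_sum]
        · rw [hΛ, Finset.mul_sum]
          refine Finset.sum_congr rfl fun n hn => ?_
          rw [Finset.sum_ite_eq, if_pos hn]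
    _ ≤ (32 * C1) ^ k * Λ ^ 2 + C1 ^ k * ((32 * momentBound k ^ 2) * Λ) +
        C1 ^ k * ((32 * momentBound k ^ 2) * Λ) + (2 + C1) ^ k * Λ := by gcongr
    _ ≤ _ := by
        have e1 : 0 ≤ (32 * C1) ^ k * Λ := by positivity
        have e2 : 0 ≤ (2 * C1 ^ k * (32 * momentBound k ^ 2) + (2 + C1) ^ k) * Λ ^ 2 := by
          positivity
        nlinarith

/-! ### Positive measure from the second moment -/

open MeasureTheory in
/-- A Borel–Cantelli lemma for counting functions with a second moment bound. -/
theorem measure_limsup_pos_of_second_moment {Ω : Type*} [MeasurableSpace Ω] (μ : Measure Ω)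
    (E : ℕ → Set Ω) (Z : ℕ → Ω → ℝ≥0∞) (hE : ∀ n, MeasurableSet (E n)) (hZ : ∀ n, Measurable (Z n))
    (hEZ : ∀ n, ∀ x ∉ E n, Z n x = 0) (hfin : μ (⋃ n, E n) ≠ ∞) (C : ℝ≥0∞) (hC : C ≠ ∞)
    (hZfin : ∀ n, ∫⁻ x, Z n x ∂μ ≠ ∞) (hdiv : ∑' n, ∫⁻ x, Z n x ∂μ = ∞)
    (hsecond : ∀ I : Finset ℕ, ∑ n ∈ I, ∑ m ∈ I, ∫⁻ x, Z n x * Z m x ∂μ ≤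
      C * ((∑ n ∈ I, ∫⁻ x, Z n x ∂μ) ^ 2 + ∑ n ∈ I, ∫⁻ x, Z n x ∂μ)) :
    0 < μ (limsup E atTop) := by
  set a : ℕ → ℝ≥0∞ := fun n => ∫⁻ x, Z n x ∂μ with ha
  have htail : ∀ M, 1 ≤ (2 * C) * μ (⋃ n ≥ M, E n) := by
    intro M
    set U := ⋃ n ≥ M, E n with hU
    have hUm : MeasurableSet U := MeasurableSet.biUnion (to_countable _) fun n _ => hE n
    have hN : ∃ N, 1 ≤ ∑ n ∈ Finset.Ico M N, a n := by
      have h1 : Tendsto (fun N => ∑ n ∈ Finset.range N, a n) atTop (𝓝 ∞) := by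
        have := ENNReal.summable.hasSum.tendsto_sum_nat (f := a)
        rwa [hdiv] at this
      have h2 : (∑ n ∈ Finset.range M, a n) + 1 < ∞ :=
        ENNReal.add_lt_top.2 ⟨ENNReal.sum_lt_top.2 fun n _ => (hZfin n).lt_top, ENNReal.one_lt_top⟩
      obtain ⟨N, hN, hMN⟩ := ((h1.eventually (lt_mem_nhds h2)).and (eventually_ge_atTop M)).exists
      refine ⟨N, ?_⟩
      rw [← Finset.sum_range_add_sum_Ico _ hMN] at hN
      exact ((ENNReal.add_lt_add_iff_left
        (ENNReal.sum_lt_top.2 fun n _ => (hZfin n).lt_top).ne).1 hN).le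
    obtain ⟨N, hN⟩ := hN
    set I := Finset.Ico M N with hI
    set s := ∑ n ∈ I, a n with hs
    have hsfin : s ≠ ∞ := (ENNReal.sum_lt_top.2 fun n _ => (hZfin n).lt_top).ne
    set f : Ω → ℝ≥0∞ := fun x => ∑ n ∈ I, Z n x with hf
    have hfm : Measurable f := Finset.measurable_fun_sum _ fun n _ => hZ n
    have hint : ∫⁻ x, f x ∂μ = s := lintegral_finsetSum _ fun n _ => hZ n
    set χ : Ω → ℝ≥0∞ := U.indicator 1 with hχ
    have hfU : ∀ x, f x = (f * χ) x := by
      intro x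
      by_cases hx : x ∈ U
      · simp [hχ, hx]
      · have : f x = 0 := by
          refine Finset.sum_eq_zero fun n hn => hEZ n x fun hxn => hx ?_
          exact mem_iUnion₂.2 ⟨n, (Finset.mem_Ico.1 hn).1, hxn⟩
        simp [this]
    -- The block sum `f` vanishes off the tail union `U`, so Cauchy–Schwarz against the indicator of
    -- `U` gives `(∫ f) ^ 2 ≤ (∫ f ^ 2) * μ U`.
    have hCS := ENNReal.lintegral_mul_le_Lp_mul_Lq μ Real.HolderConjugate.two_two
      hfm.aemeasurable (g := χ) ((measurable_one.indicator hUm).aemeasurable)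
    have hind : ∫⁻ x, χ x ^ (2 : ℝ) ∂μ = μ U := by
      rw [← lintegral_indicator_one hUm]
      refine lintegral_congr fun x => ?_
      by_cases hx : x ∈ U <;> simp [hχ, hx]
    have hsq : ∫⁻ x, f x ^ (2 : ℝ) ∂μ ≤ C * (s ^ 2 + s) := by
      refine le_trans (le_of_eq ?_) (hsecond I)
      have : ∀ x, f x ^ (2 : ℝ) = ∑ n ∈ I, ∑ m ∈ I, Z n x * Z m x := by
        intro x
        rw [ENNReal.rpow_two, sq, hf, Finset.sum_mul_sum]
      rw [lintegral_congr this, lintegral_finsetSum]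
      · refine Finset.sum_congr rfl fun n _ => ?_
        rw [lintegral_finsetSum]
        exact fun m _ => (hZ n).mul (hZ m)
      · exact fun n _ => Finset.measurable_fun_sum _ fun m _ => (hZ n).mul (hZ m)
    have h1 : s ^ 2 ≤ (C * (s ^ 2 + s)) * μ U := by
      rw [← hint, lintegral_congr hfU]
      calc _ ≤ ((∫⁻ x, f x ^ (2 : ℝ) ∂μ) ^ (1 / (2 : ℝ)) *
            (∫⁻ x, χ x ^ (2 : ℝ) ∂μ) ^ (1 / (2 : ℝ))) ^ 2 := by
            gcongr
        _ = (∫⁻ x, f x ^ (2 : ℝ) ∂μ) * μ U := by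
            rw [hind, mul_pow, ← ENNReal.rpow_two, ← ENNReal.rpow_two, ← ENNReal.rpow_mul,
              ← ENNReal.rpow_mul]
            norm_num
        _ ≤ _ := by
            rw [← lintegral_congr hfU, hint]
            gcongr
    have hs0 : s ≠ 0 := (zero_lt_one.trans_le hN).ne'
    have h2 : s ^ 2 * 1 ≤ s ^ 2 * ((2 * C) * μ U) := by
      rw [mul_one]
      refine h1.trans ?_
      have : s ≤ s ^ 2 := by
        rw [sq]
        exact le_mul_of_one_le_right' hN
      calc (C * (s ^ 2 + s)) * μ U ≤ (C * (s ^ 2 + s ^ 2)) * μ U := by gcongr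
        _ = s ^ 2 * ((2 * C) * μ U) := by ring
    exact (ENNReal.mul_le_mul_iff_right (pow_ne_zero 2 hs0) (ENNReal.pow_ne_top hsfin)).1 h2
  have hlim : Tendsto (fun M => μ (⋃ n ≥ M, E n)) atTop (𝓝 (μ (limsup E atTop))) := by
    rw [limsup_eq_iInf_iSup_of_nat]
    refine tendsto_measure_iInter_atTop
      (fun M => (MeasurableSet.biUnion (to_countable _) fun n _ => hE n).nullMeasurableSet) ?_
      ⟨0, ne_top_of_le_ne_top hfin (measure_mono (iUnion₂_subset fun n _ =>
        subset_iUnion E n))⟩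
    intro M M' hMM
    exact biUnion_subset_biUnion_left fun n hn => le_trans hMM hn
  have h2 : (2 * C)⁻¹ ≤ μ (limsup E atTop) := by
    refine ge_of_tendsto' hlim fun M => ?_
    rw [ENNReal.inv_le_iff_le_mul (by intro _ h0; have := htail M; rw [h0, zero_mul] at this; exact absurd this (by simp))
      (by intro h; exact absurd h (ENNReal.mul_ne_top (by simp) hC))]
    exact htail M
  exact (ENNReal.inv_pos.2 (ENNReal.mul_ne_top (by simp) hC)).trans_le h2

/-- Points all of whose coordinates are reduced fractions with denominator `n`. -/
def fracPoints (k n : ℕ) : Set (Fin k → ℝ) :=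
  {x | ∃ p : Fin k → ℤ, ∀ i, Int.gcd (p i) n = 1 ∧ x i = p i / n}

/-- The points within `r n` of `fracPoints k n` for infinitely many `n`. -/
def approxSet (k : ℕ) (r : ℕ → ℝ) : Set (Fin k → ℝ) :=
  limsup (fun n => Metric.thickening (r n) (fracPoints k n)) atTop

/-- The numerators of the points of `fracPoints k n` in the unit cube. -/
noncomputable def numeratorVectors (k n : ℕ) : Finset (Fin k → ℤ) :=
  Fintype.piFinset fun _ => numerators n

/-- The ball of radius `r n` about the point with numerators `a` and denominator `n`. -/
def fracBall {k : ℕ} (r : ℕ → ℝ) (n : ℕ) (a : Fin k → ℤ) : Set (Fin k → ℝ) :=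
  Metric.ball (fun i => (a i : ℝ) / n) (r n)

/-- The number of reduced fractions in the unit cube with denominator `n` within `r n`. -/
noncomputable def counting (k : ℕ) (r : ℕ → ℝ) (n : ℕ) (x : Fin k → ℝ) : ℝ≥0∞ :=
  ∑ a ∈ numeratorVectors k n, (fracBall r n a).indicator 1 x

lemma measurableSet_fracBall {k : ℕ} (r : ℕ → ℝ) (n : ℕ) (a : Fin k → ℤ) :
    MeasurableSet (fracBall r n a) := measurableSet_ball

lemma measurable_counting (k : ℕ) (r : ℕ → ℝ) (n : ℕ) : Measurable (counting k r n) :=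
  Finset.measurable_fun_sum _ fun a _ => measurable_one.indicator (measurableSet_fracBall r n a)

open MeasureTheory in
lemma volume_fracBall {k : ℕ} {r : ℕ → ℝ} {n : ℕ} (hk : k ≠ 0) (hr : 0 ≤ r n) (a : Fin k → ℤ) :
    volume (fracBall r n a) = ENNReal.ofReal ((2 * r n) ^ k) := by
  rcases hr.eq_or_lt with h | h
  · rw [fracBall, ← h]; simp [hk]
  · rw [fracBall, Real.volume_pi_ball _ h, Fintype.card_fin]

open MeasureTheory in
lemma lintegral_counting {k : ℕ} {r : ℕ → ℝ} {n : ℕ} (hk : k ≠ 0) (hr : 0 ≤ r n) :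
    ∫⁻ x, counting k r n x = ENNReal.ofReal ((2 * (r n * n.totient)) ^ k) := by
  simp only [counting]
  rw [lintegral_finsetSum _ fun a _ => measurable_one.indicator (measurableSet_fracBall r n a),
    Finset.sum_congr rfl (g := fun _ => ENNReal.ofReal ((2 * r n) ^ k)) fun a _ => by
      rw [lintegral_indicator_one (measurableSet_fracBall r n a), volume_fracBall hk hr],
    Finset.sum_const, numeratorVectors, Fintype.card_piFinset, Finset.prod_const, card_numerators,
    Finset.card_univ, Fintype.card_fin, nsmul_eq_mul, ← ENNReal.ofReal_natCast,
    ← ENNReal.ofReal_mul (by positivity)]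
  congr 1
  push_cast
  rw [← mul_pow]
  ring

open MeasureTheory in
-- In the sup metric, two balls that meet have close centres in every coordinate, and their
-- intersection lies in the smaller one.
lemma volume_fracBall_inter_le {k : ℕ} {r : ℕ → ℝ} {n m : ℕ} (hk : k ≠ 0) (hrn : 0 ≤ r n)
    (hrm : 0 ≤ r m) {a b : Fin k → ℤ} (ha : a ∈ numeratorVectors k n)
    (hb : b ∈ numeratorVectors k m) :
    volume (fracBall r n a ∩ fracBall r m b) ≤
      if (fun i => (a i, b i)) ∈ Fintype.piFinset (fun _ : Fin k => closePairs r n m) then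
        ENNReal.ofReal ((2 * min (r n) (r m)) ^ k) else 0 := by
  split_ifs with h
  · rcases le_total (r n) (r m) with h' | h'
    · rw [min_eq_left h', ← volume_fracBall hk hrn a]
      exact measure_mono inter_subset_left
    · rw [min_eq_right h', ← volume_fracBall hk hrm b]
      exact measure_mono inter_subset_right
  · have : fracBall r n a ∩ fracBall r m b = ∅ := by
      by_contra hne
      obtain ⟨x, hx1, hx2⟩ := nonempty_iff_ne_empty.2 hne
      refine h (Fintype.mem_piFinset.2 fun i => ?_)
      refine Finset.mem_filter.2 ⟨Finset.mem_product.2 ⟨Fintype.mem_piFinset.1 ha i,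
        Fintype.mem_piFinset.1 hb i⟩, ?_⟩
      have h1 : |x i - (a i : ℝ) / n| < r n := lt_of_le_of_lt
        (dist_le_pi_dist x (fun i => (a i : ℝ) / n) i) (Metric.mem_ball.1 hx1)
      have h2 : |x i - (b i : ℝ) / m| < r m := lt_of_le_of_lt
        (dist_le_pi_dist x (fun i => (b i : ℝ) / m) i) (Metric.mem_ball.1 hx2)
      have h3 := le_max_left (r n) (r m)
      have h4 := le_max_right (r n) (r m)
      rw [abs_lt] at h1 h2 ⊢
      constructor <;> simp only <;> linarith [h1.1, h1.2, h2.1, h2.2]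
    rw [this, measure_empty]

open MeasureTheory in
-- Closeness is a condition on each coordinate separately, so the number of admissible pairs of
-- vectors is at most the `k`th power of the one-dimensional count.
lemma lintegral_counting_mul_le {k : ℕ} {r : ℕ → ℝ} {n m : ℕ} (hk : k ≠ 0) (hrn : 0 ≤ r n)
    (hrm : 0 ≤ r m) :
    ∫⁻ x, counting k r n x * counting k r m x ≤
      ENNReal.ofReal ((2 * min (r n) (r m) * (closePairs r n m).card) ^ k) := by
  classical
  have h1 : ∀ x, counting k r n x * counting k r m x =
      ∑ q ∈ numeratorVectors k n ×ˢ numeratorVectors k m,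
        (fracBall r n q.1 ∩ fracBall r m q.2).indicator 1 x := by
    intro x
    rw [counting, counting, Finset.sum_mul_sum, Finset.sum_product]
    refine Finset.sum_congr rfl fun a _ => Finset.sum_congr rfl fun b _ => ?_
    by_cases h1 : x ∈ fracBall r n a <;> by_cases h2 : x ∈ fracBall r m b <;> simp [h1, h2]
  have hmeas : ∀ q : (Fin k → ℤ) × (Fin k → ℤ),
      MeasurableSet (fracBall r n q.1 ∩ fracBall r m q.2) := fun q =>
    (measurableSet_fracBall r n q.1).inter (measurableSet_fracBall r m q.2)
  rw [lintegral_congr h1, lintegral_finsetSum _ fun q _ => measurable_one.indicator (hmeas q)]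
  calc ∑ q ∈ numeratorVectors k n ×ˢ numeratorVectors k m,
        ∫⁻ x, (fracBall r n q.1 ∩ fracBall r m q.2).indicator 1 x
      ≤ ∑ q ∈ numeratorVectors k n ×ˢ numeratorVectors k m,
        if (fun i => (q.1 i, q.2 i)) ∈ Fintype.piFinset (fun _ : Fin k => closePairs r n m) then
        ENNReal.ofReal ((2 * min (r n) (r m)) ^ k) else 0 := by
        refine Finset.sum_le_sum fun q hq => ?_
        rw [lintegral_indicator_one (hmeas q)]
        exact volume_fracBall_inter_le hk hrn hrm (Finset.mem_product.1 hq).1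
          (Finset.mem_product.1 hq).2
    _ ≤ ((closePairs r n m).card ^ k : ℕ) * ENNReal.ofReal ((2 * min (r n) (r m)) ^ k) := by
        rw [← Finset.sum_filter, Finset.sum_const, nsmul_eq_mul]
        gcongr
        calc _ ≤ (Fintype.piFinset (fun _ : Fin k => closePairs r n m)).card := by
              refine Finset.card_le_card_of_injOn (fun q i => (q.1 i, q.2 i)) ?_ ?_
              · intro q hq
                exact (Finset.mem_filter.1 hq).2
              · intro q _ q' _ h
                refine Prod.ext (funext fun i => ?_) (funext fun i => ?_)
                · exact congrArg Prod.fst (congrFun h i)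
                · exact congrArg Prod.snd (congrFun h i)
          _ = (closePairs r n m).card ^ k := by
              rw [Fintype.card_piFinset, Finset.prod_const, Finset.card_univ, Fintype.card_fin]
    _ = _ := by
        rw [← ENNReal.ofReal_natCast, ← ENNReal.ofReal_mul (by positivity)]
        congr 1
        push_cast
        rw [← mul_pow]
        ring

open MeasureTheory in
theorem volume_approxSet_pos {k : ℕ} (hk : 2 ≤ k) (r : ℕ → ℝ) (hr : ∀ n, 0 ≤ r n) (hr0 : r 0 = 0)
    (hlam : ∀ n, r n * n.totient ≤ 1)
    (hdiv : ∑' n, ENNReal.ofReal ((r n * n.totient) ^ k) = ∞) :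
    0 < volume (approxSet k r) := by
  classical
  obtain ⟨C, hC, hbound⟩ := exists_second_moment_bound hk
  have hk0 : k ≠ 0 := by omega
  set E : ℕ → Set (Fin k → ℝ) := fun n => ⋃ a ∈ numeratorVectors k n, fracBall r n a with hE
  have hr1 : ∀ n, r n ≤ 1 := by
    intro n
    rcases Nat.eq_zero_or_pos n with rfl | hn
    · rw [hr0]; exact zero_le_one
    · refine le_trans ?_ (hlam n)
      exact le_mul_of_one_le_right (hr n) (by exact_mod_cast Nat.totient_pos.2 hn)
  have hsub : limsup E atTop ⊆ approxSet k r := by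
    refine limsup_le_limsup (Eventually.of_forall fun n => ?_)
    refine iUnion₂_subset fun a ha x hx => ?_
    rw [Metric.mem_thickening_iff]
    refine ⟨fun i => (a i : ℝ) / n, ⟨a, fun i => ⟨?_, rfl⟩⟩, Metric.mem_ball.1 hx⟩
    exact (mem_numerators.1 (Fintype.mem_piFinset.1 ha i)).2.2
  refine lt_of_lt_of_le ?_ (measure_mono hsub)
  have hpow : ∀ n, ENNReal.ofReal ((2 * (r n * n.totient)) ^ k) =
      ENNReal.ofReal (2 ^ k) * ENNReal.ofReal ((r n * n.totient) ^ k) := fun n => by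
    rw [mul_pow, ENNReal.ofReal_mul (by positivity)]
  refine measure_limsup_pos_of_second_moment volume E (counting k r)
    (fun n => Finset.measurableSet_biUnion _ fun a _ => measurableSet_fracBall r n a)
    (measurable_counting k r) ?_ ?_ (ENNReal.ofReal C) ENNReal.ofReal_ne_top ?_ ?_ ?_
  · intro n x hx
    refine Finset.sum_eq_zero fun a ha => indicator_of_notMem (fun h => hx ?_) _
    exact mem_iUnion₂.2 ⟨a, ha, h⟩
  · refine ne_top_of_le_ne_top (measure_closedBall_lt_top (x := (0 : Fin k → ℝ)) (r := 2)).ne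
      (measure_mono (iUnion_subset fun n => iUnion₂_subset fun a ha x hx => ?_))
    rw [Metric.mem_closedBall, dist_pi_le_iff (by norm_num)]
    intro i
    have h1 : |x i - (a i : ℝ) / n| < r n := lt_of_le_of_lt
      (dist_le_pi_dist x (fun i => (a i : ℝ) / n) i) (Metric.mem_ball.1 hx)
    obtain ⟨h2, h3, -⟩ := mem_numerators.1 (Fintype.mem_piFinset.1 ha i)
    have hn : (0 : ℝ) < n := by
      have : (0 : ℤ) < n := by omega
      exact_mod_cast this
    have h4 : 0 ≤ (a i : ℝ) / n := by
      have : (0 : ℝ) ≤ a i := by exact_mod_cast (by omega : (0 : ℤ) ≤ a i)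
      positivity
    have h5 : (a i : ℝ) / n ≤ 1 := by
      rw [div_le_one hn]; exact_mod_cast h3
    have h6 := hr1 n
    rw [Real.dist_eq, Pi.zero_apply, sub_zero]
    rw [abs_lt] at h1
    rw [abs_le]
    constructor <;> linarith [h1.1, h1.2]
  · intro n
    rw [lintegral_counting hk0 (hr n)]
    exact ENNReal.ofReal_ne_top
  · rw [tsum_congr fun n => (lintegral_counting hk0 (hr n)).trans (hpow n), ENNReal.tsum_mul_left,
      hdiv, ENNReal.mul_top]
    simp
  · intro I
    -- The second moment bound is stated for positive radii; indices with `r n = 0` add nothing to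
    -- either side.
    set J := I.filter fun n => 0 < r n with hJ
    have hzero : ∀ n ∈ I, n ∉ J → r n = 0 := fun n hn hnJ =>
      le_antisymm (not_lt.1 fun h => hnJ (Finset.mem_filter.2 ⟨hn, h⟩)) (hr n)
    set lam : ℕ → ℝ := fun n => r n * n.totient with hlamdef
    have hlam0 : ∀ n, 0 ≤ lam n := fun n => mul_nonneg (hr n) (Nat.cast_nonneg _)
    have hJb := hbound r J fun n hn => by
      have h1 := (Finset.mem_filter.1 hn).2
      refine ⟨Nat.pos_of_ne_zero ?_, h1, hlam n⟩
      rintro rfl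
      exact h1.ne' hr0
    have hmin0 : ∀ n m, r n = 0 ∨ r m = 0 → min (r n) (r m) = 0 := by
      rintro n m (h | h)
      · rw [h, min_eq_left (hr m)]
      · rw [h, min_eq_right (hr n)]
    have hIJ : ∑ n ∈ I, ∑ m ∈ I, (2 * min (r n) (r m) * (closePairs r n m).card) ^ k =
        ∑ n ∈ J, ∑ m ∈ J, (2 * min (r n) (r m) * (closePairs r n m).card) ^ k := by
      symm
      rw [← Finset.sum_product', ← Finset.sum_product']
      refine Finset.sum_subset (Finset.product_subset_product (Finset.filter_subset _ _)
        (Finset.filter_subset _ _)) fun q hq hqJ => ?_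
      rw [Finset.mem_product] at hq hqJ
      rw [hmin0 q.1 q.2, mul_zero, zero_mul, zero_pow hk0]
      by_contra! hcon
      exact hqJ ⟨by_contra fun h => hcon.1 (hzero _ hq.1 h), by_contra fun h =>
        hcon.2 (hzero _ hq.2 h)⟩
    have hlamJ : ∑ n ∈ I, lam n ^ k = ∑ n ∈ J, lam n ^ k := by
      symm
      refine Finset.sum_subset (Finset.filter_subset _ _) fun n hn hnJ => ?_
      simp only [hlamdef]
      rw [hzero n hn hnJ, zero_mul, zero_pow hk0]
    set Λ := ∑ n ∈ I, lam n ^ k with hΛ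
    have hΛ0 : 0 ≤ Λ := Finset.sum_nonneg fun n _ => pow_nonneg (hlam0 n) k
    have hsum : ∑ n ∈ I, ∫⁻ x, counting k r n x = ENNReal.ofReal (2 ^ k * Λ) := by
      rw [Finset.sum_congr rfl fun n _ => lintegral_counting hk0 (hr n),
        ← ENNReal.ofReal_sum_of_nonneg fun n _ => by have := hlam0 n; positivity]
      congr 1
      rw [hΛ, Finset.mul_sum]
      exact Finset.sum_congr rfl fun n _ => mul_pow _ _ _
    rw [hsum]
    calc ∑ n ∈ I, ∑ m ∈ I, ∫⁻ x, counting k r n x * counting k r m x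
        ≤ ∑ n ∈ I, ∑ m ∈ I,
          ENNReal.ofReal ((2 * min (r n) (r m) * (closePairs r n m).card) ^ k) :=
          Finset.sum_le_sum fun n _ => Finset.sum_le_sum fun m _ =>
            lintegral_counting_mul_le hk0 (hr n) (hr m)
      _ = ENNReal.ofReal (∑ n ∈ I, ∑ m ∈ I,
          (2 * min (r n) (r m) * (closePairs r n m).card) ^ k) := by
          have hnn : ∀ n m, 0 ≤ (2 * min (r n) (r m) * (closePairs r n m).card) ^ k := fun n m => by
            have := le_min (hr n) (hr m)
            positivity
          rw [ENNReal.ofReal_sum_of_nonneg fun n _ => Finset.sum_nonneg fun m _ => hnn n m]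
          refine Finset.sum_congr rfl fun n _ => ?_
          rw [ENNReal.ofReal_sum_of_nonneg fun m _ => hnn n m]
      _ ≤ ENNReal.ofReal (C * ((2 ^ k * Λ) ^ 2 + 2 ^ k * Λ)) := by
          refine ENNReal.ofReal_le_ofReal ?_
          rw [hIJ]
          refine hJb.trans ?_
          rw [← hlamJ]
          have h2k : (1 : ℝ) ≤ 2 ^ k := one_le_pow₀ (by norm_num)
          have h3 : Λ ≤ 2 ^ k * Λ := le_mul_of_one_le_left hΛ0 h2k
          gcongr
      _ = _ := by
          rw [ENNReal.ofReal_mul hC.le, ENNReal.ofReal_add (by positivity) (by positivity),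
            ENNReal.ofReal_pow (by positivity)]

open MeasureTheory

/-! ### Periodic sets -/

/-- The embedding of `ℤ^k` in `ℝ^k` with image the lattice of mesh `s`. -/
def latticeHom (k : ℕ) (s : ℝ) : (Fin k → ℤ) →+ (Fin k → ℝ) where
  toFun z i := s * z i
  map_zero' := by ext; simp
  map_add' a b := by ext; simp [mul_add]

instance (k : ℕ) (s : ℝ) : Countable (latticeHom k s).range :=
  (Set.countable_range (latticeHom k s)).to_subtype

/-- The half-open cube with centre `x` and side `s`. -/
def halfOpenCube {k : ℕ} (x : Fin k → ℝ) (s : ℝ) : Set (Fin k → ℝ) :=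
  Set.pi univ fun i => Ico (x i - s / 2) (x i - s / 2 + s)

lemma isAddFundamentalDomain_halfOpenCube {k : ℕ} (x : Fin k → ℝ) {s : ℝ} (hs : 0 < s) :
    IsAddFundamentalDomain (latticeHom k s).range (halfOpenCube x s) volume := by
  refine IsAddFundamentalDomain.mk'
    (MeasurableSet.univ_pi fun i => measurableSet_Ico).nullMeasurableSet fun y => ?_
  choose z hz hzu using fun i => existsUnique_add_zsmul_mem_Ico hs (y i) (x i - s / 2)
  refine ⟨⟨latticeHom k s z, z, rfl⟩, ?_, ?_⟩
  · intro i _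
    have := hz i
    simp only [zsmul_eq_mul] at this
    change s * z i + y i ∈ _
    rwa [mul_comm, add_comm]
  · rintro ⟨_, z', rfl⟩ h
    have : z' = z := by
      funext i
      refine hzu i (z' i) ?_
      have h1 : s * z' i + y i ∈ Ico (x i - s / 2) (x i - s / 2 + s) := h i (mem_univ i)
      simp only [zsmul_eq_mul]
      rwa [add_comm (y i), mul_comm]
    subst this
    rfl

lemma halfOpenCube_ae_eq {k : ℕ} (x : Fin k → ℝ) {s : ℝ} (hs : 0 < s) :
    halfOpenCube x s =ᵐ[volume] Metric.closedBall x (s / 2) := by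
  rw [closedBall_pi _ (by positivity)]
  simp only [Real.closedBall_eq_Icc]
  have h : ∀ i, x i - s / 2 + s = x i + s / 2 := fun i => by ring
  simp only [halfOpenCube, h]
  exact Measure.pi_Ico_ae_eq_pi_Icc

lemma volume_inter_congr {k : ℕ} {V W : Set (Fin k → ℝ)} (h : V =ᵐ[volume] W)
    (B : Set (Fin k → ℝ)) : volume (V ∩ B) = volume (W ∩ B) :=
  measure_congr (h.inter (ae_eq_refl B))

/-- Invariance under the lattice of mesh `s`. -/
def IsPeriodic {k : ℕ} (s : ℝ) (G : Set (Fin k → ℝ)) : Prop :=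
  ∀ z : Fin k → ℤ, ∀ x ∈ G, latticeHom k s z + x ∈ G

/-- Sup-metric balls of radius `s / 2` are, up to null sets, half-open cubes of side `s`, hence
fundamental domains of the same lattice. A periodic set meets any two of them in equal measure. -/
lemma IsPeriodic.volume_inter_closedBall {k : ℕ} {s : ℝ} {G : Set (Fin k → ℝ)} (hs : 0 < s)
    (hG : IsPeriodic s G) (hGm : MeasurableSet G) (x y : Fin k → ℝ) :
    volume (G ∩ Metric.closedBall x (s / 2)) = volume (G ∩ Metric.closedBall y (s / 2)) := by
  rw [← measure_congr ((ae_eq_refl G).inter (halfOpenCube_ae_eq x hs)),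
    ← measure_congr ((ae_eq_refl G).inter (halfOpenCube_ae_eq y hs))]
  refine (isAddFundamentalDomain_halfOpenCube x hs).measure_set_eq
    (isAddFundamentalDomain_halfOpenCube y hs) hGm ?_
  rintro ⟨_, z, rfl⟩
  ext w
  constructor
  · intro h
    have := hG (-z) _ h
    change latticeHom k s (-z) + (latticeHom k s z + w) ∈ G at this
    rwa [map_neg, neg_add_cancel_left] at this
  · exact hG z w

lemma volume_closedBall_half {k : ℕ} (x : Fin k → ℝ) {s : ℝ} (hs : 0 < s) :
    volume (Metric.closedBall x (s / 2)) = ENNReal.ofReal (s ^ k) := by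
  rw [Real.volume_pi_closedBall _ (by positivity), Fintype.card_fin]
  congr 2
  ring

lemma exists_density_point {k : ℕ} {W : Set (Fin k → ℝ)} (hW : 0 < volume W) :
    ∃ x, ∀ δ : ℕ → ℝ, Tendsto δ atTop (𝓝[>] 0) →
      Tendsto (fun j => volume (W ∩ Metric.closedBall x (δ j)) /
        volume (Metric.closedBall x (δ j))) atTop (𝓝 1) := by
  have h := IsUnifLocDoublingMeasure.ae_tendsto_measure_inter_div
    (volume : Measure (Fin k → ℝ)) W 1
  have hne : NeBot (ae (volume.restrict W)) := by
    rw [ae_neBot, Ne, Measure.restrict_eq_zero]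
    exact hW.ne'
  obtain ⟨x, hx⟩ := h.exists
  refine ⟨x, fun δ hδ => hx (fun _ => x) δ hδ ?_⟩
  filter_upwards [hδ.eventually self_mem_nhdsWithin] with j hj
  rw [one_mul]
  exact Metric.mem_closedBall_self (le_of_lt hj)

lemma tendsto_inv_two_nat {N : ℕ → ℕ} (hN : ∀ j, j < N j) :
    Tendsto (fun j => (1 / (N j : ℝ)) / 2) atTop (𝓝[>] 0) := by
  rw [tendsto_nhdsWithin_iff]
  constructor
  · have h1 : Tendsto (fun j => (N j : ℝ)) atTop atTop :=
      tendsto_natCast_atTop_atTop.comp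
        (tendsto_atTop_mono (fun j => (hN j).le) tendsto_id)
    simpa using (h1.const_div_atTop 1).div_const 2
  · refine Eventually.of_forall fun j => ?_
    have : (0 : ℝ) < N j := by exact_mod_cast (Nat.zero_le j).trans_lt (hN j)
    simp only [mem_Ioi]
    positivity

open scoped Pointwise in
/-- A periodic set of positive measure that arbitrarily large dilations map into itself up to null
sets has full measure. -/
theorem ae_mem_of_expanding {k : ℕ} {W : Set (Fin k → ℝ)} (hW : 0 < volume W)
    (hWm : MeasurableSet W) (hper : IsPeriodic 1 W)
    (hexp : ∀ M : ℕ, ∃ N : ℕ, M < N ∧ ∃ c : Fin k → ℝ, ∃ V : Set (Fin k → ℝ), V =ᵐ[volume] W ∧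
      ∀ x ∈ W, (N : ℝ) • x + c ∈ V) : ∀ᵐ x, x ∈ W := by
  obtain ⟨x, hx⟩ := exists_density_point hW
  choose N hN c V hV hmap using hexp
  have hlim := hx _ (tendsto_inv_two_nat hN)
  -- The cube of side `1 / N` about a density point is expanded to a unit cube, in which `W` then
  -- has proportion at least that density. Periodicity moves this cube to the origin, and the
  -- densities tend to `1`.
  have hone : (1 : ℝ≥0∞) ≤ volume (W ∩ Metric.closedBall 0 (1 / 2)) := by
    refine le_of_tendsto' hlim fun j => ?_
    have hNj : (0 : ℝ) < N j := by exact_mod_cast (Nat.zero_le j).trans_lt (hN j)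
    have hs : (0 : ℝ) < 1 / N j := by positivity
    rw [volume_closedBall_half x hs]
    refine ENNReal.div_le_of_le_mul ?_
    have h1 : volume ((fun y => (N j : ℝ) • y + c j) ''
        (W ∩ Metric.closedBall x (1 / N j / 2))) =
        ENNReal.ofReal ((N j : ℝ) ^ k) * volume (W ∩ Metric.closedBall x (1 / N j / 2)) := by
      have : (fun y => (N j : ℝ) • y + c j) '' (W ∩ Metric.closedBall x (1 / N j / 2)) =
          (fun y => y + c j) '' ((N j : ℝ) • (W ∩ Metric.closedBall x (1 / N j / 2))) := by
        rw [← image_smul, image_image]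
      rw [this, image_add_right, measure_preimage_add_right, Measure.addHaar_smul]
      simp [abs_of_pos hNj]
    have h2 : (fun y => (N j : ℝ) • y + c j) '' (W ∩ Metric.closedBall x (1 / N j / 2)) ⊆
        V j ∩ Metric.closedBall ((N j : ℝ) • x + c j) (1 / 2) := by
      rintro _ ⟨y, ⟨hy1, hy2⟩, rfl⟩
      refine ⟨hmap j y hy1, ?_⟩
      rw [Metric.mem_closedBall] at hy2 ⊢
      rw [dist_add_right, dist_smul₀, Real.norm_eq_abs, abs_of_pos hNj]
      calc (N j : ℝ) * dist y x ≤ N j * (1 / N j / 2) := by gcongr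
        _ = 1 / 2 := by field_simp
    have h3 := measure_mono (μ := volume) h2
    rw [h1, volume_inter_congr (hV j),
      hper.volume_inter_closedBall one_pos hWm _ 0] at h3
    calc volume (W ∩ Metric.closedBall x (1 / N j / 2))
        = (ENNReal.ofReal ((1 / N j : ℝ) ^ k) * ENNReal.ofReal ((N j : ℝ) ^ k)) *
          volume (W ∩ Metric.closedBall x (1 / N j / 2)) := by
          rw [← ENNReal.ofReal_mul (by positivity), ← mul_pow, one_div,
            inv_mul_cancel₀ hNj.ne', one_pow, ENNReal.ofReal_one, one_mul]
      _ ≤ ENNReal.ofReal ((1 / N j : ℝ) ^ k) * volume (W ∩ Metric.closedBall 0 (1 / 2)) := by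
          rw [mul_assoc]
          gcongr
      _ = _ := mul_comm _ _
  rw [ae_iff]
  refine measure_null_of_locally_null _ fun y _ => ⟨Wᶜ ∩ Metric.closedBall y (1 / 2), ?_, ?_⟩
  · exact inter_mem self_mem_nhdsWithin
      (mem_nhdsWithin_of_mem_nhds (Metric.closedBall_mem_nhds y (by norm_num)))
  · have h1 : volume (Metric.closedBall y (1 / 2)) = 1 := by
      rw [volume_closedBall_half y one_pos]; simp
    have h2 := measure_inter_add_sdiff (μ := volume) (Metric.closedBall y (1 / 2)) hWm
    rw [inter_comm, hper.volume_inter_closedBall one_pos hWm y 0, h1] at h2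
    have h3 : volume (Metric.closedBall y (1 / 2) \ W) = 0 := by
      by_contra hne
      have : (1 : ℝ≥0∞) + 0 < volume (W ∩ Metric.closedBall 0 (1 / 2)) +
          volume (Metric.closedBall y (1 / 2) \ W) :=
        ENNReal.add_lt_add_of_le_of_lt ENNReal.one_ne_top hone (pos_iff_ne_zero.2 hne)
      rw [h2] at this
      simp at this
    rwa [inter_comm, ← Set.sdiff_eq]

/-- A set of positive measure that agrees, up to null sets, with sets of arbitrarily small period
has full measure. -/
theorem ae_mem_of_fine_periods {k : ℕ} {W : Set (Fin k → ℝ)} (hW : 0 < volume W)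
    (hWm : MeasurableSet W)
    (hfine : ∀ M : ℕ, ∃ N : ℕ, M < N ∧ ∃ V : Set (Fin k → ℝ), MeasurableSet V ∧
      V =ᵐ[volume] W ∧ IsPeriodic (1 / (N : ℝ)) V) : ∀ᵐ x, x ∈ W := by
  rw [ae_iff]
  by_contra hne
  obtain ⟨x, hx⟩ := exists_density_point hW
  obtain ⟨y, hy⟩ := exists_density_point (W := Wᶜ) (pos_iff_ne_zero.2 hne)
  choose N hN V hVm hV hper using hfine
  have hx' := hx _ (tendsto_inv_two_nat hN)
  have hy' := hy _ (tendsto_inv_two_nat hN)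
  have hsum := hx'.add hy'
  -- By periodicity `W` has the same proportion in the cubes of side `1 / N` at `x` and at `y`. The
  -- proportions of `W` at `x` and of `Wᶜ` at `y` thus add to `1`, whereas their limits add to `2`.
  have hconst : ∀ j, volume (W ∩ Metric.closedBall x (1 / N j / 2)) /
      volume (Metric.closedBall x (1 / (N j : ℝ) / 2)) +
      volume (Wᶜ ∩ Metric.closedBall y (1 / N j / 2)) /
      volume (Metric.closedBall y (1 / (N j : ℝ) / 2)) = 1 := by
    intro j
    have hNj : (0 : ℝ) < N j := by exact_mod_cast (Nat.zero_le j).trans_lt (hN j)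
    have hs : (0 : ℝ) < 1 / N j := by positivity
    rw [← volume_inter_congr (hV j),
      (hper j).volume_inter_closedBall hs (hVm j) x y,
      volume_inter_congr (hV j), volume_closedBall_half x hs,
      ← volume_closedBall_half y hs, ← ENNReal.add_div, inter_comm W, inter_comm Wᶜ, ← Set.sdiff_eq,
      measure_inter_add_sdiff _ hWm, ENNReal.div_self]
    · rw [volume_closedBall_half y hs]
      simp only [ne_eq, ENNReal.ofReal_eq_zero, not_le]
      positivity
    · exact measure_closedBall_lt_top.ne
  have := tendsto_nhds_unique hsum (tendsto_const_nhds.congr fun j => (hconst j).symm)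
  norm_num at this

/-! ### The sets `approxSet` -/

lemma mem_approxSet {k : ℕ} {r : ℕ → ℝ} {x : Fin k → ℝ} :
    x ∈ approxSet k r ↔ ∃ᶠ n in atTop, x ∈ Metric.thickening (r n) (fracPoints k n) :=
  mem_limsup_iff_frequently_mem

lemma measurableSet_approxSet (k : ℕ) (r : ℕ → ℝ) : MeasurableSet (approxSet k r) :=
  MeasurableSet.measurableSet_limsup fun _ => Metric.isOpen_thickening.measurableSet

lemma approxSet_mono {k : ℕ} {r r' : ℕ → ℝ} (h : ∀ᶠ n in atTop, r n ≤ r' n) :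
    approxSet k r ⊆ approxSet k r' := fun x hx => by
  rw [mem_approxSet] at hx ⊢
  refine hx.mp (h.mono fun n hn hxn => ?_)
  exact Metric.thickening_mono hn _ hxn

/-- A Lebesgue density statement in the spirit of Cassels: scaling all radii by a constant changes
the limsup set by a null set only. It undoes the dilation of radii under affine maps, and later
makes the constant `η` in `TransferData.full` harmless. -/
lemma approxSet_mul_ae_eq (k : ℕ) {r : ℕ → ℝ} (hr : Tendsto r atTop (𝓝 0)) {M : ℝ} (hM : 0 < M) :
    approxSet k (fun n => M * r n) =ᵐ[volume] approxSet k r := by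
  rw [approxSet, approxSet, ← blimsup_true, ← blimsup_true]
  exact blimsup_thickening_mul_ae_eq (volume : Measure (Fin k → ℝ)) (fun _ => True)
    (fun n => fracPoints k n) hM r hr

/-- An affine map that acts on fractions maps `approxSet` into a rescaled `approxSet`. -/
lemma smul_add_mem_approxSet {k : ℕ} {r : ℕ → ℝ} {a : ℝ} (ha : 0 < a) {c : Fin k → ℝ}
    (h : ∀ᶠ n in atTop, 0 < r n → ∀ y ∈ fracPoints k n, a • y + c ∈ fracPoints k n) {x : Fin k → ℝ}
    (hx : x ∈ approxSet k r) : a • x + c ∈ approxSet k (fun n => a * r n) := by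
  rw [mem_approxSet] at hx ⊢
  refine hx.mp (h.mono fun n hn hxn => ?_)
  obtain ⟨y, hy, hxy⟩ := Metric.mem_thickening_iff.1 hxn
  refine Metric.mem_thickening_iff.2 ⟨_, hn (dist_nonneg.trans_lt hxy) y hy, ?_⟩
  rw [dist_add_right, dist_smul₀, Real.norm_eq_abs, abs_of_pos ha]
  gcongr

lemma isPeriodic_approxSet {k : ℕ} {r : ℕ → ℝ} {s : ℝ}
    (h : ∀ᶠ n in atTop, 0 < r n → ∀ z : Fin k → ℤ, ∀ y ∈ fracPoints k n,
      latticeHom k s z + y ∈ fracPoints k n) : IsPeriodic s (approxSet k r) := by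
  intro z x hx
  have := smul_add_mem_approxSet (k := k) (r := r) one_pos (c := latticeHom k s z)
    (h.mono fun n hn hr y hy => by rw [one_smul, add_comm]; exact hn hr z y hy) hx
  simpa [add_comm] using this

lemma isPeriodic_one_approxSet (k : ℕ) (r : ℕ → ℝ) : IsPeriodic 1 (approxSet k r) := by
  refine isPeriodic_approxSet ((eventually_gt_atTop 0).mono fun n hn _ z y hy => ?_)
  obtain ⟨p, hp⟩ := hy
  refine ⟨fun i => p i + n * z i, fun i => ⟨?_, ?_⟩⟩
  · rw [Int.gcd_add_mul_left_left]; exact (hp i).1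
  · have hn' : (n : ℝ) ≠ 0 := by exact_mod_cast hn.ne'
    simp only [Pi.add_apply, latticeHom, AddMonoidHom.coe_mk, ZeroHom.coe_mk, (hp i).2]
    push_cast
    field_simp
    ring

lemma fracPoints_smul {k n p : ℕ} (hp : p.Prime) (hpn : ¬ p ∣ n) {y : Fin k → ℝ}
    (hy : y ∈ fracPoints k n) : (p : ℝ) • y + 0 ∈ fracPoints k n := by
  obtain ⟨a, ha⟩ := hy
  refine ⟨fun i => p * a i, fun i => ⟨?_, ?_⟩⟩
  · rw [← Int.isCoprime_iff_gcd_eq_one]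
    exact (Nat.isCoprime_iff_coprime.2 ((Nat.Prime.coprime_iff_not_dvd hp).2 hpn)).mul_left
      (Int.isCoprime_iff_gcd_eq_one.2 (ha i).1)
  · simp only [add_zero, Pi.smul_apply, (ha i).2, smul_eq_mul]
    push_cast
    ring

/-- With `n = p n'` and `p ∤ n'`, the new numerator is `p a + n'`. It is prime to `p` because `n'`
is, and prime to `n'` because `p a` is. -/
lemma fracPoints_smul_add {k n p : ℕ} (hp : p.Prime) (hn : 0 < n) (hpn : p ∣ n)
    (hpn2 : ¬ p ^ 2 ∣ n) {y : Fin k → ℝ} (hy : y ∈ fracPoints k n) :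
    (p : ℝ) • y + (fun _ => 1 / (p : ℝ)) ∈ fracPoints k n := by
  obtain ⟨a, ha⟩ := hy
  obtain ⟨n', rfl⟩ := hpn
  have hpn' : ¬ p ∣ n' := fun ⟨c, hc⟩ => hpn2 ⟨c, by rw [hc]; ring⟩
  have hcop : IsCoprime (p : ℤ) n' :=
    Nat.isCoprime_iff_coprime.2 ((Nat.Prime.coprime_iff_not_dvd hp).2 hpn')
  have hn'0 : (n' : ℝ) ≠ 0 := by
    rintro h
    have : n' = 0 := by exact_mod_cast h
    simp [this] at hn
  have hp0 : (p : ℝ) ≠ 0 := by exact_mod_cast hp.ne_zero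
  refine ⟨fun i => p * a i + n', fun i => ⟨?_, ?_⟩⟩
  · have hai := Int.isCoprime_iff_gcd_eq_one.2 (ha i).1
    rw [← Int.isCoprime_iff_gcd_eq_one]
    push_cast at hai ⊢
    refine IsCoprime.mul_right ?_ ?_
    · have := (IsCoprime.add_mul_left_left_iff (z := a i)).2 hcop.symm
      rwa [add_comm] at this
    · have h1 : IsCoprime ((p : ℤ) * a i) n' := hcop.mul_left hai.of_mul_right_right
      have := (IsCoprime.add_mul_left_left_iff (z := 1)).2 h1
      rwa [mul_one] at this
  · simp only [Pi.add_apply, Pi.smul_apply, (ha i).2, smul_eq_mul]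
    push_cast
    field_simp

/-- Translation by `z / p` adds a multiple of `n / p` to the numerator. When `p ^ 2 ∣ n`, the number
`n / p` has the same prime factors as `n`, so coprimality survives. -/
lemma fracPoints_add_div {k n p : ℕ} (hp : p.Prime) (hn : 0 < n) (hpn : p ^ 2 ∣ n)
    (z : Fin k → ℤ) {y : Fin k → ℝ} (hy : y ∈ fracPoints k n) :
    latticeHom k (1 / (p : ℝ)) z + y ∈ fracPoints k n := by
  obtain ⟨a, ha⟩ := hy
  obtain ⟨n', rfl⟩ := hpn
  have hn'0 : (n' : ℝ) ≠ 0 := by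
    rintro h
    have : n' = 0 := by exact_mod_cast h
    simp [this] at hn
  have hp0 : (p : ℝ) ≠ 0 := by exact_mod_cast hp.ne_zero
  refine ⟨fun i => a i + (p * n' : ℕ) * z i, fun i => ⟨?_, ?_⟩⟩
  · have hai := Int.isCoprime_iff_gcd_eq_one.2 (ha i).1
    rw [← Int.isCoprime_iff_gcd_eq_one]
    have h1 : ((p ^ 2 * n' : ℕ) : ℤ) = p * (p * n' : ℕ) := by push_cast; ring
    rw [h1] at hai ⊢
    have h2 := (IsCoprime.add_mul_left_left_iff (z := z i)).2 hai.of_mul_right_right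
    refine IsCoprime.mul_right ?_ h2
    push_cast at h2 ⊢
    exact h2.of_mul_right_left
  · simp only [Pi.add_apply, latticeHom, AddMonoidHom.coe_mk, ZeroHom.coe_mk, (ha i).2]
    push_cast
    field_simp
    ring

open scoped Pointwise in
/-- The convergence part of the Borel–Cantelli lemma for `approxSet`. -/
theorem volume_approxSet_eq_zero {k : ℕ} (hk : k ≠ 0) (r : ℕ → ℝ) (hr : ∀ n, 0 ≤ r n)
    (hconv : ∑' n, ENNReal.ofReal ((r n * n.totient) ^ k) ≠ ∞) : volume (approxSet k r) = 0 := by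
  set D : Set (Fin k → ℝ) := halfOpenCube 0 1 with hD
  have hDf := isAddFundamentalDomain_halfOpenCube (0 : Fin k → ℝ) one_pos
  have hper := isPeriodic_one_approxSet k r
  have hterm : ∀ n, 0 < n → (volume.restrict D) (Metric.thickening (r n) (fracPoints k n)) ≤
      ENNReal.ofReal (2 ^ k) * ENNReal.ofReal ((r n * n.totient) ^ k) := by
    intro n hn
    have hn' : (n : ℝ) ≠ 0 := by exact_mod_cast hn.ne'
    set E : Set (Fin k → ℝ) := ⋃ a ∈ numeratorVectors k n, fracBall r n a with hE
    have hEv : volume E ≤ ENNReal.ofReal (2 ^ k) * ENNReal.ofReal ((r n * n.totient) ^ k) := by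
      calc volume E ≤ ∑ a ∈ numeratorVectors k n, volume (fracBall r n a) :=
            measure_biUnion_finset_le _ _
        _ = ∑ a ∈ numeratorVectors k n, ∫⁻ x, (fracBall r n a).indicator 1 x :=
            Finset.sum_congr rfl fun a _ =>
              (lintegral_indicator_one (measurableSet_fracBall r n a)).symm
        _ = ∫⁻ x, counting k r n x := (lintegral_finsetSum _ fun a _ =>
            measurable_one.indicator (measurableSet_fracBall r n a)).symm
        _ = _ := by
            rw [lintegral_counting hk (hr n), mul_pow, ENNReal.ofReal_mul (by positivity)]
    have hcover : Metric.thickening (r n) (fracPoints k n) ⊆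
        ⋃ g : (latticeHom k 1).range, (g +ᵥ E) := by
      intro x hx
      obtain ⟨y, ⟨p, hp⟩, hxy⟩ := Metric.mem_thickening_iff.1 hx
      obtain ⟨z, hz⟩ : ∃ z : Fin k → ℤ, ∀ i, p i - n * z i ∈ numerators n := by
        -- The shift by one puts the representative in `[1, n]`, the range of `numerators`, and not
        -- in `[0, n - 1]`.
        refine ⟨fun i => (p i - 1) / n, fun i => ?_⟩
        have h1 := Int.emod_add_mul_ediv (p i - 1) n
        have h2 := Int.emod_nonneg (p i - 1) (by omega : (n : ℤ) ≠ 0)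
        have h3 := Int.emod_lt_of_pos (p i - 1) (by omega : (0 : ℤ) < n)
        rw [mem_numerators]
        refine ⟨by linarith, by linarith, ?_⟩
        rw [Int.gcd_sub_mul_left_left]
        exact (hp i).1
      refine mem_iUnion.2 ⟨⟨latticeHom k 1 z, z, rfl⟩, ?_⟩
      rw [mem_vadd_set_iff_neg_vadd_mem]
      refine mem_iUnion₂.2 ⟨fun i => p i - n * z i, Fintype.mem_piFinset.2 hz, ?_⟩
      change -latticeHom k 1 z + x ∈ _
      rw [fracBall, Metric.mem_ball]
      have : (fun i => ((p i - n * z i : ℤ) : ℝ) / n) = -latticeHom k 1 z + y := by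
        funext i
        simp only [Pi.add_apply, Pi.neg_apply, latticeHom, AddMonoidHom.coe_mk, ZeroHom.coe_mk,
          (hp i).2]
        push_cast
        field_simp
        ring
      rw [this, dist_add_left]
      exact hxy
    calc (volume.restrict D) (Metric.thickening (r n) (fracPoints k n))
        = volume (Metric.thickening (r n) (fracPoints k n) ∩ D) :=
          Measure.restrict_apply Metric.isOpen_thickening.measurableSet
      _ ≤ volume (⋃ g : (latticeHom k 1).range, ((g +ᵥ E) ∩ D)) := by
          rw [← iUnion_inter]
          exact measure_mono (inter_subset_inter_left _ hcover)
      _ ≤ ∑' g : (latticeHom k 1).range, volume ((g +ᵥ E) ∩ D) := measure_iUnion_le _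
      _ = volume E := (hDf.measure_eq_tsum E).symm
      _ ≤ _ := hEv
  have hnull : (volume.restrict D) (approxSet k r) = 0 := by
    -- The index `0` is dropped, since the bound `hterm` needs a positive denominator.
    have hshift : approxSet k r =
        limsup (fun n => Metric.thickening (r (n + 1)) (fracPoints k (n + 1))) atTop :=
      (limsup_nat_add (fun n => Metric.thickening (r n) (fracPoints k n)) 1).symm
    rw [hshift]
    refine measure_limsup_atTop_eq_zero (ne_top_of_le_ne_top ?_
      (ENNReal.tsum_le_tsum fun n => hterm (n + 1) n.succ_pos))
    rw [ENNReal.tsum_mul_left]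
    refine ENNReal.mul_ne_top ENNReal.ofReal_ne_top (ne_top_of_le_ne_top hconv ?_)
    exact ENNReal.tsum_comp_le_tsum_of_injective (add_left_injective 1) _
  rw [Measure.restrict_apply (measurableSet_approxSet k r)] at hnull
  refine hDf.measure_zero_of_invariant _ ?_ hnull
  rintro ⟨_, z, rfl⟩
  ext x
  rw [mem_vadd_set_iff_neg_vadd_mem]
  change -latticeHom k 1 z + x ∈ _ ↔ _
  constructor
  · intro h
    have := hper z _ h
    rwa [add_neg_cancel_left] at this
  · intro h
    have := hper (-z) _ h
    rwa [map_neg] at this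

/-! ### The zero–one law and full measure -/

/-- If the truncated series converged, only finitely many terms could be truncated, and those are
finite. -/
lemma tsum_min_one_eq_top {a : ℕ → ℝ≥0∞} (ha : ∀ n, a n ≠ ∞) (h : ∑' n, a n = ∞) :
    ∑' n, min (a n) 1 = ∞ := by
  classical
  by_contra hne
  have hlim := ENNReal.tendsto_cofinite_zero_of_tsum_ne_top hne
  have hev := hlim.eventually (gt_mem_nhds zero_lt_one)
  rw [eventually_cofinite] at hev
  set S := hev.toFinset with hS
  have hle : ∀ n, a n ≤ min (a n) 1 + if n ∈ S then a n else 0 := by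
    intro n
    by_cases hn : n ∈ S
    · rw [if_pos hn]; exact le_add_self
    · rw [if_neg hn, add_zero, le_min_iff]
      have : min (a n) 1 < 1 := by
        by_contra hcon
        exact hn (hev.mem_toFinset.2 hcon)
      exact ⟨le_rfl, ((min_lt_iff.1 this).resolve_right (lt_irrefl _)).le⟩
  have h1 : ∑' n, (if n ∈ S then a n else 0) ≠ ∞ := by
    rw [tsum_eq_sum (s := S) fun n hn => if_neg hn]
    refine (ENNReal.sum_lt_top.2 fun n hn => ?_).ne
    rw [if_pos hn]
    exact (ha n).lt_top
  have h2 := ENNReal.tsum_le_tsum hle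
  rw [h, ENNReal.tsum_add, top_le_iff] at h2
  exact ENNReal.add_ne_top.2 ⟨hne, h1⟩ h2

/-- The radii restricted to the denominators in a set. -/
noncomputable def restrictRadii (r : ℕ → ℝ) (J : Set ℕ) : ℕ → ℝ := J.indicator r

lemma restrictRadii_le {r : ℕ → ℝ} (hr : ∀ n, 0 ≤ r n) (J : Set ℕ) (n : ℕ) :
    restrictRadii r J n ≤ r n := indicator_le_self' (fun _ _ => hr _) n

lemma restrictRadii_nonneg {r : ℕ → ℝ} (hr : ∀ n, 0 ≤ r n) (J : Set ℕ) (n : ℕ) :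
    0 ≤ restrictRadii r J n := indicator_nonneg (fun n _ => hr n) n

lemma mem_of_restrictRadii_pos {r : ℕ → ℝ} {J : Set ℕ} {n : ℕ} (h : 0 < restrictRadii r J n) :
    n ∈ J := by
  by_contra hn
  rw [restrictRadii, indicator_of_notMem hn] at h
  exact lt_irrefl _ h

/-- A thickening of radius `0` is empty, so restricting the radii to a set of indices really
discards the other denominators. -/
lemma approxSet_union {k : ℕ} {r : ℕ → ℝ} (J K : Set ℕ) :
    approxSet k (restrictRadii r (J ∪ K)) ⊆
      approxSet k (restrictRadii r J) ∪ approxSet k (restrictRadii r K) := by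
  intro x hx
  rw [mem_union, mem_approxSet, mem_approxSet, ← frequently_or_distrib]
  refine (mem_approxSet.1 hx).mono fun n hn => ?_
  have hnJ := mem_of_restrictRadii_pos (Metric.thickening_nonempty_iff.1 ⟨x, hn⟩).1
  rw [restrictRadii, indicator_of_mem hnJ] at hn
  rcases hnJ with h | h
  · left; rwa [restrictRadii, indicator_of_mem h]
  · right; rwa [restrictRadii, indicator_of_mem h]

/-- Iterating the affine map gives dilations by `p ^ M`, which multiply the radii by `p ^ M`. The
enlarged limsup set agrees with the original almost everywhere, as `ae_mem_of_expanding` requires.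
-/
lemma ae_mem_approxSet_of_affine {k : ℕ} (hk : 2 ≤ k) (r : ℕ → ℝ) (hr : ∀ n, 0 ≤ r n)
    (hr0 : r 0 = 0) (hlim : Tendsto r atTop (𝓝 0)) (hlam : ∀ n, r n * n.totient ≤ 1)
    (hdiv : ∑' n, ENNReal.ofReal ((r n * n.totient) ^ k) = ∞) {p : ℕ} (hp : p.Prime)
    (c : Fin k → ℝ) (h : ∀ n, 0 < n → 0 < r n → ∀ y ∈ fracPoints k n,
      (p : ℝ) • y + c ∈ fracPoints k n) : ∀ᵐ x, x ∈ approxSet k r := by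
  refine ae_mem_of_expanding (volume_approxSet_pos hk r hr hr0 hlam hdiv)
    (measurableSet_approxSet k r) (isPeriodic_one_approxSet k r) fun M => ?_
  refine ⟨p ^ M, Nat.lt_pow_self hp.one_lt, ?_⟩
  have hp0 : (0 : ℝ) < p := by exact_mod_cast hp.pos
  have key : ∀ j : ℕ, ∃ c' : Fin k → ℝ, ∀ x ∈ approxSet k r,
      ((p ^ j : ℕ) : ℝ) • x + c' ∈ approxSet k (fun n => (p : ℝ) ^ j * r n) := by
    intro j
    induction j with
    | zero => exact ⟨0, fun x hx => by simpa using hx⟩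
    | succ j ih =>
      obtain ⟨c', hc'⟩ := ih
      refine ⟨(p : ℝ) • c' + c, fun x hx => ?_⟩
      have h1 := smul_add_mem_approxSet (c := c) hp0 ((eventually_gt_atTop 0).mono
        fun n hn hrn => h n hn ((mul_pos_iff_of_pos_left (by positivity)).1 hrn)) (hc' x hx)
      have h2 : (fun n => (p : ℝ) * ((p : ℝ) ^ j * r n)) = fun n => (p : ℝ) ^ (j + 1) * r n := by
        funext n; ring
      rw [h2] at h1
      convert h1 using 1
      rw [smul_add, smul_smul, add_assoc]
      push_cast
      rw [pow_succ, mul_comm]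
  obtain ⟨c', hc'⟩ := key M
  exact ⟨c', _, approxSet_mul_ae_eq k hlim (by positivity), hc'⟩

/-- The higher-dimensional Duffin–Schaeffer theorem of Pollington and Vaughan. -/
theorem ae_mem_approxSet {k : ℕ} (hk : 2 ≤ k) (r : ℕ → ℝ) (hr : ∀ n, 0 ≤ r n)
    (hlim : Tendsto r atTop (𝓝 0))
    (hdiv : ∑' n, ENNReal.ofReal ((r n * n.totient) ^ k) = ∞) : ∀ᵐ x, x ∈ approxSet k r := by
  have hk0 : k ≠ 0 := by omega
  -- Truncation enforces `ρ n * φ n ≤ 1` and keeps divergence, since a truncated term equals `1`. At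
  -- `n = 0` the convention `1 / 0 = 0` gives `ρ 0 = 0`.
  set ρ : ℕ → ℝ := fun n => min (r n) (1 / n.totient) with hρ
  have hρ0 : ∀ n, 0 ≤ ρ n := fun n => le_min (hr n) (by positivity)
  have hρr : ∀ n, ρ n ≤ r n := fun n => min_le_left _ _
  have hρz : ρ 0 = 0 := by simp [hρ, hr 0]
  have hρlim : Tendsto ρ atTop (𝓝 0) := squeeze_zero hρ0 hρr hlim
  have hρlam : ∀ n, ρ n * n.totient ≤ 1 := by
    intro n
    calc ρ n * n.totient ≤ 1 / n.totient * n.totient := by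
          gcongr; exact min_le_right _ _
      _ ≤ 1 := by rw [one_div]; exact inv_mul_le_one
  have hρdiv : ∑' n, ENNReal.ofReal ((ρ n * n.totient) ^ k) = ∞ := by
    refine top_le_iff.1 ((tsum_min_one_eq_top (fun n => ENNReal.ofReal_ne_top) hdiv).symm.le.trans
      (ENNReal.tsum_le_tsum fun n => ?_))
    rcases Nat.eq_zero_or_pos n with rfl | hn
    · simp [hk0]
    · have hφ : (0 : ℝ) < n.totient := by exact_mod_cast Nat.totient_pos.2 hn
      rcases min_choice (r n) (1 / (n.totient : ℝ)) with h | h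
      · simp only [hρ, h]; exact min_le_left _ _
      · simp only [hρ, h]
        rw [one_div, inv_mul_cancel₀ hφ.ne', one_pow, ENNReal.ofReal_one]
        exact min_le_right _ _
  refine (?_ : ∀ᵐ x, x ∈ approxSet k ρ).mono
    (approxSet_mono (Eventually.of_forall hρr))
  have hsub : ∀ J : Set ℕ, ∀ᵐ x, x ∈ approxSet k (restrictRadii ρ J) → x ∈ approxSet k ρ :=
    fun J => Eventually.of_forall
      (approxSet_mono (Eventually.of_forall (restrictRadii_le hρ0 J)))
  have haffine : ∀ (J : Set ℕ) (p : ℕ), p.Prime → ∀ c : Fin k → ℝ,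
      (∀ n, 0 < n → n ∈ J → ∀ y ∈ fracPoints k n, (p : ℝ) • y + c ∈ fracPoints k n) →
      ∑' n, ENNReal.ofReal ((restrictRadii ρ J n * n.totient) ^ k) = ∞ →
      ∀ᵐ x, x ∈ approxSet k ρ := by
    intro J p hp c hc hJ
    have h1 := restrictRadii_le hρ0 J
    have h0 := restrictRadii_nonneg hρ0 J
    refine (ae_mem_approxSet_of_affine hk (restrictRadii ρ J) h0
      (le_antisymm ((h1 0).trans hρz.le) (h0 0)) (squeeze_zero h0 h1 hρlim)
      (fun n => le_trans (by gcongr; exact h1 n) (hρlam n)) hJ hp c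
      fun n hn hrn => hc n hn (mem_of_restrictRadii_pos hrn)).mp (hsub J)
  by_cases hA : ∃ p : ℕ, p.Prime ∧ ∑' n : ℕ,
      ENNReal.ofReal ((restrictRadii ρ {n | ¬ p ∣ n} n * n.totient) ^ k) = ∞
  · obtain ⟨p, hp, hsum⟩ := hA
    exact haffine _ p hp 0 (fun n _ hn y hy => fracPoints_smul hp hn hy) hsum
  by_cases hB : ∃ p : ℕ, p.Prime ∧ ∑' n : ℕ,
      ENNReal.ofReal ((restrictRadii ρ {n | p ∣ n ∧ ¬ p ^ 2 ∣ n} n * n.totient) ^ k) = ∞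
  · obtain ⟨p, hp, hsum⟩ := hB
    exact haffine _ p hp _ (fun n hn0 hn y hy => fracPoints_smul_add hp hn0 hn.1 hn.2 hy) hsum
  -- In the remaining case, for every prime `p` the denominators not divisible by `p ^ 2` form
  -- convergent series and contribute null sets. The limsup set then agrees almost everywhere with a
  -- `1 / p`-periodic one, for arbitrarily large `p`.
  push Not at hA hB
  refine ae_mem_of_fine_periods (volume_approxSet_pos hk ρ hρ0 hρz hρlam hρdiv)
    (measurableSet_approxSet k ρ) fun M => ?_
  obtain ⟨p, hMp, hp⟩ := Nat.exists_infinite_primes (M + 1)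
  refine ⟨p, hMp, approxSet k (restrictRadii ρ {n | p ^ 2 ∣ n}), measurableSet_approxSet _ _, ?_,
    isPeriodic_approxSet ((eventually_gt_atTop 0).mono fun n hn hrn z y hy =>
      fracPoints_add_div hp hn (mem_of_restrictRadii_pos hrn) z hy)⟩
  have hnullA := volume_approxSet_eq_zero hk0 _ (restrictRadii_nonneg hρ0 _) (hA p hp)
  have hnullB := volume_approxSet_eq_zero hk0 _ (restrictRadii_nonneg hρ0 _) (hB p hp)
  have hcover : approxSet k ρ ⊆ approxSet k (restrictRadii ρ {n | p ^ 2 ∣ n}) ∪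
      (approxSet k (restrictRadii ρ {n | ¬ p ∣ n}) ∪
        approxSet k (restrictRadii ρ {n | p ∣ n ∧ ¬ p ^ 2 ∣ n})) := by
    have huniv : ({n | p ^ 2 ∣ n} ∪ ({n | ¬ p ∣ n} ∪ {n | p ∣ n ∧ ¬ p ^ 2 ∣ n}) : Set ℕ) = univ := by
      ext n
      simp only [mem_union, mem_ofPred_eq, mem_univ, iff_true]
      tauto
    have h1 := approxSet_union (k := k) (r := ρ) {n | p ^ 2 ∣ n}
      ({n | ¬ p ∣ n} ∪ {n | p ∣ n ∧ ¬ p ^ 2 ∣ n})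
    rw [huniv, restrictRadii, indicator_univ] at h1
    exact h1.trans (union_subset_union_right _ (approxSet_union _ _))
  refine (ae_le_set.2 ?_).antisymm (ae_le_set.2 ?_)
  · have : approxSet k (restrictRadii ρ {n | p ^ 2 ∣ n}) ⊆ approxSet k ρ :=
      approxSet_mono (Eventually.of_forall (restrictRadii_le hρ0 _))
    rw [sdiff_eq_empty.2 this, measure_empty]
  · refine measure_mono_null ?_ (measure_union_null hnullA hnullB)
    rw [sdiff_subset_iff]
    exact hcover

/-! ### Mass transference -/

/-- The data of a mass transference: a dimension function `f` with `f r / r ^ k` decreasing and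
unbounded, and radii `δ` for which the limsup set of the balls of radii a multiple of
`f (δ n) ^ (1 / k)` has full measure. -/
structure TransferData (k : ℕ) (f : ℝ → ℝ) (δ : ℕ → ℝ) : Prop where
  dim_ne_zero : k ≠ 0
  pos : ∀ r, 0 < r → 0 < f r
  mono : MonotoneOn f (Ioi 0)
  anti : AntitoneOn (fun r => f r / r ^ k) (Ioi 0)
  large : ∀ K : ℝ, ∃ ρ > 0, ∀ r, 0 < r → r ≤ ρ → K * r ^ k ≤ f r
  radius_pos : ∀ n, 0 < δ n
  radius_tendsto : Tendsto δ atTop (𝓝 0)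
  dim_tendsto : Tendsto (fun n => f (δ n)) atTop (𝓝 0)
  full : ∀ η : ℝ, 0 < η → ∀ᵐ x, x ∈ approxSet k (fun n => η * f (δ n) ^ (1 / (k : ℝ)))

lemma TransferData.le_scale {k : ℕ} {f : ℝ → ℝ} {δ : ℕ → ℝ} (h : TransferData k f δ) {r t : ℝ}
    (hr : 0 < r) (hrt : r ≤ t) : f t * (r / t) ^ k ≤ f r := by
  have ht : 0 < t := hr.trans_le hrt
  have h1 := h.anti (mem_Ioi.2 hr) (mem_Ioi.2 ht) hrt
  simp only at h1
  rw [div_le_iff₀ (by positivity)] at h1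
  rw [div_pow]
  have hrk : (0 : ℝ) < r ^ k := by positivity
  have htk : (0 : ℝ) < t ^ k := by positivity
  calc f t * (r ^ k / t ^ k) ≤ (f r / r ^ k * t ^ k) * (r ^ k / t ^ k) := by gcongr
    _ = f r := by field_simp

lemma TransferData.two_mul_le {k : ℕ} {f : ℝ → ℝ} {δ : ℕ → ℝ} (h : TransferData k f δ) {r : ℝ}
    (hr : 0 < r) : f (2 * r) ≤ 2 ^ k * f r := by
  have h1 := h.le_scale hr (by linarith : r ≤ 2 * r)
  have h2 : r / (2 * r) = 1 / 2 := by field_simp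
  rw [h2, one_div, inv_pow] at h1
  have h2k : (0 : ℝ) < 2 ^ k := by positivity
  calc f (2 * r) = 2 ^ k * (f (2 * r) * ((2 : ℝ) ^ k)⁻¹) := by field_simp
    _ ≤ 2 ^ k * f r := by gcongr

/-! ### The Cantor construction -/

/-- A ball of the construction: centre, radius and weight. -/
abbrev WeightedBall (k : ℕ) := (Fin k → ℝ) × ℝ × ℝ

/-- The closed ball underlying a weighted ball. -/
def WeightedBall.set {k : ℕ} (c : WeightedBall k) : Set (Fin k → ℝ) := Metric.closedBall c.1 c.2.1

/-- At most one of the balls of `I` meets `A`. -/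
def MeetsAtMostOne {k : ℕ} (I : Finset (WeightedBall k)) (A : Set (Fin k → ℝ)) : Prop :=
  ∀ c ∈ I, ∀ c' ∈ I, (c.set ∩ A).Nonempty → (c'.set ∩ A).Nonempty → c = c'

open Classical in
/-- The total weight of the balls of `I` that meet `A`. -/
noncomputable def massMeeting {k : ℕ} (I : Finset (WeightedBall k)) (A : Set (Fin k → ℝ)) : ℝ :=
  ∑ c ∈ I.filter (fun c => (c.set ∩ A).Nonempty), c.2.2

/-- The constant of the mass estimate. -/
def massConst (k : ℕ) : ℝ := 2 * 70 ^ k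

lemma one_le_massConst (k : ℕ) : 1 ≤ massConst k := by
  have : (1 : ℝ) ≤ 70 ^ k := one_le_pow₀ (by norm_num)
  rw [massConst]; linarith

/-- A finite disjoint family of large balls in `closedBall x s` with comparable total volume. -/
lemma TransferData.exists_packing {k : ℕ} {f : ℝ → ℝ} {δ : ℕ → ℝ} (h : TransferData k f δ)
    (x : Fin k → ℝ) {s η ε : ℝ} (hs : 0 < s) (hη : 0 < η) (hε : 0 < ε) (N : ℕ) :
    ∃ J : Finset ((Fin k → ℝ) × ℕ),
      (∀ q ∈ J, q.1 ∈ fracPoints k q.2 ∧ N ≤ q.2 ∧ δ q.2 ≤ ε ∧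
        δ q.2 ≤ η * f (δ q.2) ^ (1 / (k : ℝ)) ∧
        Metric.closedBall q.1 (η * f (δ q.2) ^ (1 / (k : ℝ))) ⊆ Metric.closedBall x s) ∧
      ((J : Set ((Fin k → ℝ) × ℕ)).PairwiseDisjoint fun q =>
        Metric.closedBall q.1 (η * f (δ q.2) ^ (1 / (k : ℝ)))) ∧
      s ^ k ≤ 2 * 10 ^ k * ∑ q ∈ J, (η * f (δ q.2) ^ (1 / (k : ℝ))) ^ k := by
  have hk := h.dim_ne_zero
  set R : ℕ → ℝ := fun n => η * f (δ n) ^ (1 / (k : ℝ)) with hR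
  have hRpos : ∀ n, 0 < R n := fun n =>
    mul_pos hη (Real.rpow_pos_of_pos (h.pos _ (h.radius_pos n)) _)
  have hRpow : ∀ n, R n ^ k = η ^ k * f (δ n) := fun n => by
    simp only [hR]
    rw [mul_pow, one_div, Real.rpow_inv_natCast_pow (h.pos _ (h.radius_pos n)).le hk]
  have hRlim : Tendsto R atTop (𝓝 0) := by
    have h1 : Tendsto (fun n => f (δ n) ^ (1 / (k : ℝ))) atTop (𝓝 (0 ^ (1 / (k : ℝ)))) :=
      h.dim_tendsto.rpow_const (Or.inr (by positivity))
    rw [Real.zero_rpow (by positivity)] at h1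
    have h2 := h1.const_mul η
    rw [mul_zero] at h2
    exact h2
  obtain ⟨ρ, hρ, hρf⟩ := h.large ((η ^ k)⁻¹)
  -- Since `f r / r ^ k` is unbounded at `0`, the enlarged radius `R n` eventually exceeds `δ n`,
  -- however small `η` is. The bound `s / 4` keeps balls near the half-sized cube inside `closedBall
  -- x s`.
  have hev : ∀ᶠ n in atTop, N ≤ n ∧ δ n ≤ ε ∧ δ n ≤ R n ∧ R n ≤ s / 4 := by
    filter_upwards [eventually_ge_atTop N, h.radius_tendsto.eventually (ge_mem_nhds hε),
      h.radius_tendsto.eventually (ge_mem_nhds hρ),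
      hRlim.eventually (ge_mem_nhds (by positivity : 0 < s / 4))] with n h1 h2 h3 h4
    refine ⟨h1, h2, ?_, h4⟩
    have h5 := hρf (δ n) (h.radius_pos n) h3
    rw [inv_mul_le_iff₀ (by positivity), ← hRpow] at h5
    exact le_of_pow_le_pow_left₀ hk (hRpos n).le h5
  set t : Set ((Fin k → ℝ) × ℕ) := {q | q.1 ∈ fracPoints k q.2 ∧ N ≤ q.2 ∧ δ q.2 ≤ ε ∧
    δ q.2 ≤ R q.2 ∧ R q.2 ≤ s / 4 ∧ Metric.closedBall q.1 (R q.2) ⊆ Metric.closedBall x s} with ht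
  obtain ⟨u, hut, hdisj, hcov⟩ := Vitali.exists_disjoint_subfamily_covering_enlargement_closedBall
    t (fun q => q.1) (fun q => R q.2) (s / 4) (fun q hq => hq.2.2.2.2.1) 5 (by norm_num)
  have hucount : u.Countable := by
    refine hdisj.countable_of_nonempty_interior fun q _ => ?_
    exact ⟨q.1, interior_mono Metric.ball_subset_closedBall
      (by rw [Metric.isOpen_ball.interior_eq]; exact Metric.mem_ball_self (hRpos _))⟩
  have hball : (Metric.closedBall x (s / 2) ∩ approxSet k R : Set (Fin k → ℝ)) ⊆
      ⋃ q ∈ u, Metric.closedBall q.1 (5 * R q.2) := by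
    rintro y ⟨hy1, hy2⟩
    obtain ⟨n, hyn, h1, h2, h3, h4⟩ := ((mem_approxSet.1 hy2).and_eventually hev).exists
    obtain ⟨z, hz, hyz⟩ := Metric.mem_thickening_iff.1 hyn
    have hmem : (z, n) ∈ t := by
      refine ⟨hz, h1, h2, h3, h4, fun w hw => ?_⟩
      rw [Metric.mem_closedBall] at hw hy1 ⊢
      have e1 := dist_triangle w z x
      have e2 := dist_triangle z y x
      rw [dist_comm z y] at e2
      simp only at hw
      linarith
    obtain ⟨b, hb, hsub⟩ := hcov _ hmem
    exact mem_iUnion₂.2 ⟨b, hb, hsub (Metric.mem_closedBall.2 hyz.le)⟩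
  have hvol : ENNReal.ofReal (s ^ k) ≤ ∑' q : u, ENNReal.ofReal ((10 * R q.1.2) ^ k) := by
    calc ENNReal.ofReal (s ^ k) = volume (Metric.closedBall x (s / 2)) :=
          (volume_closedBall_half x hs).symm
      _ = volume (Metric.closedBall x (s / 2) ∩ approxSet k R : Set (Fin k → ℝ)) := by
          refine measure_congr ?_
          filter_upwards [h.full η hη] with y hy
          exact propext ⟨fun h1 => ⟨h1, hy⟩, fun h1 => h1.1⟩
      _ ≤ volume (⋃ q ∈ u, Metric.closedBall q.1 (5 * R q.2)) := measure_mono hball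
      _ ≤ ∑' q : u, volume (Metric.closedBall q.1.1 (5 * R q.1.2)) :=
          measure_biUnion_le _ hucount _
      _ = _ := by
          refine tsum_congr fun q => ?_
          rw [Real.volume_pi_closedBall _ (mul_pos (by norm_num) (hRpos _)).le, Fintype.card_fin]
          congr 2
          ring
  -- Halving makes the inequality strict, so a finite subfamily suffices. This is the `2` of `2 * 10
  -- ^ k`; the `10` is the side of a Vitali enlargement by `5`.
  have hlt : ENNReal.ofReal (s ^ k / 2) <
      ∑' q : u, ENNReal.ofReal ((10 * R q.1.2) ^ k) := by
    refine lt_of_lt_of_le ?_ hvol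
    have : 0 < s ^ k := by positivity
    rw [ENNReal.ofReal_lt_ofReal_iff this]
    linarith
  rw [ENNReal.tsum_eq_iSup_sum, lt_iSup_iff] at hlt
  obtain ⟨J, hJ⟩ := hlt
  refine ⟨J.map (Function.Embedding.subtype _), ?_, ?_, ?_⟩
  · intro q hq
    obtain ⟨q', -, rfl⟩ := Finset.mem_map.1 hq
    obtain ⟨h1, h2, h3, h4, -, h5⟩ := hut q'.2
    exact ⟨h1, h2, h3, h4, h5⟩
  · refine hdisj.subset fun q hq => ?_
    obtain ⟨q', -, rfl⟩ := Finset.mem_map.1 (Finset.mem_coe.1 hq)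
    exact q'.2
  · rw [Finset.sum_map]
    rw [← ENNReal.ofReal_sum_of_nonneg fun q _ => by have := hRpos q.1.2; positivity] at hJ
    have h1 := (ENNReal.ofReal_lt_ofReal_iff_of_nonneg (by positivity)).1 hJ
    simp only [mul_pow (10 : ℝ), ← Finset.mul_sum] at h1
    simp only [Function.Embedding.coe_subtype]
    change s ^ k ≤ 2 * 10 ^ k * ∑ q ∈ J, R q.1.2 ^ k
    linarith

/-- Small balls inside a given ball that carry its weight. -/
lemma TransferData.exists_children {k : ℕ} {f : ℝ → ℝ} {δ : ℕ → ℝ} (h : TransferData k f δ)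
    (b : WeightedBall k) {κ ε : ℝ} (hs : 0 < b.2.1) (hw : 0 < b.2.2) (hκ : 0 < κ) (hε : 0 < ε)
    (N : ℕ) :
    ∃ I : Finset (WeightedBall k),
      (∀ c ∈ I, 0 < c.2.1 ∧ c.2.1 ≤ ε ∧ 0 < c.2.2 ∧ c.2.2 ≤ κ * f c.2.1 ∧ c.set ⊆ b.set ∧
        ∃ n, N ≤ n ∧ c.set ⊆ Metric.thickening (δ n) (fracPoints k n)) ∧
      ∑ c ∈ I, c.2.2 = b.2.2 ∧
      ((I : Set (WeightedBall k)).PairwiseDisjoint WeightedBall.set) ∧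
      ∀ z r, 0 < r → MeetsAtMostOne I (Metric.closedBall z r) ∨
        massMeeting I (Metric.closedBall z r) ≤ massConst k * (b.2.2 * (r / b.2.1) ^ k) := by
  classical
  obtain ⟨x, s, w⟩ := b
  simp only at hs hw ⊢
  have hk := h.dim_ne_zero
  -- `η ^ k ≤ B` is what bounds a child's weight `w * R ^ k / V` by `κ * f (δ / 2)`. The factor `2 ^
  -- k` is the doubling constant of `f`, and `2 * 10 ^ k` comes from the packing.
  set B : ℝ := κ * s ^ k / (w * 2 ^ k * (2 * 10 ^ k)) with hB
  have hBpos : 0 < B := by positivity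
  set η := min 1 B with hη
  have hηpos : 0 < η := lt_min one_pos hBpos
  have hηk : η ^ k ≤ B := by
    calc η ^ k ≤ η := pow_le_of_le_one hηpos.le (min_le_left _ _) hk
      _ ≤ B := min_le_right _ _
  obtain ⟨J, hJ, hdisj, hvol⟩ := h.exists_packing x hs hηpos (by positivity : 0 < 2 * ε) N
  set R : ℕ → ℝ := fun n => η * f (δ n) ^ (1 / (k : ℝ)) with hR
  have hRpos : ∀ n, 0 < R n := fun n =>
    mul_pos hηpos (Real.rpow_pos_of_pos (h.pos _ (h.radius_pos n)) _)
  have hRpow : ∀ n, R n ^ k = η ^ k * f (δ n) := fun n => by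
    simp only [hR]
    rw [mul_pow, one_div, Real.rpow_inv_natCast_pow (h.pos _ (h.radius_pos n)).le hk]
  change s ^ k ≤ 2 * 10 ^ k * ∑ q ∈ J, R q.2 ^ k at hvol
  set V := ∑ q ∈ J, R q.2 ^ k with hV
  have hsk : 0 < s ^ k := by positivity
  have hVpos : 0 < V := by
    by_contra hcon
    have : 2 * 10 ^ k * V ≤ 0 := mul_nonpos_of_nonneg_of_nonpos (by positivity) (not_lt.1 hcon)
    linarith
  have hVinv : V⁻¹ ≤ 2 * 10 ^ k / s ^ k := by
    rw [inv_le_comm₀ hVpos (by positivity), inv_div, div_le_iff₀ (by positivity)]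
    linarith
  -- Weight is shared in proportion to the volume of the enlarged balls. The radius is `δ / 2`, so
  -- that the closed child lies in the open neighbourhood of radius `δ`.
  set child : (Fin k → ℝ) × ℕ → WeightedBall k := fun q =>
    (q.1, δ q.2 / 2, w * R q.2 ^ k * V⁻¹) with hchild
  have hset : ∀ q ∈ J, (child q).set ⊆ Metric.closedBall q.1 (R q.2) := fun q hq =>
    Metric.closedBall_subset_closedBall (by
      have h1 := (hJ q hq).2.2.2.1
      have h2 := h.radius_pos q.2
      change δ q.2 / 2 ≤ R q.2
      change δ q.2 ≤ R q.2 at h1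
      linarith)
  have hpd : ∀ q ∈ J, ∀ q' ∈ J, q ≠ q' →
      Disjoint (Metric.closedBall q.1 (R q.2)) (Metric.closedBall q'.1 (R q'.2)) :=
    fun q hq q' hq' hne => hdisj hq hq' hne
  have hinj : Set.InjOn child J := by
    intro q hq q' hq' he
    by_contra hne
    have h1 : q.1 = q'.1 := congrArg (fun c : WeightedBall k => c.1) he
    refine Set.disjoint_left.1 (hpd q hq q' hq' hne)
      (Metric.mem_closedBall_self (hRpos q.2).le) ?_
    rw [h1]
    exact Metric.mem_closedBall_self (hRpos q'.2).le
  refine ⟨J.image child, ?_, ?_, ?_, ?_⟩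
  · intro c hc
    obtain ⟨q, hq, rfl⟩ := Finset.mem_image.1 hc
    obtain ⟨h1, h2, h3, h4, h5⟩ := hJ q hq
    have hδ := h.radius_pos q.2
    refine ⟨by simp only [hchild]; positivity, by simp only [hchild]; linarith,
      by have := hRpos q.2; simp only [hchild]; positivity, ?_, (hset q hq).trans h5, q.2, h2, ?_⟩
    · simp only [hchild]
      have e1 := h.two_mul_le (half_pos hδ)
      rw [mul_div_cancel₀ _ (two_ne_zero)] at e1
      have e3 := h.pos _ (half_pos hδ)
      calc w * R q.2 ^ k * V⁻¹ = w * (η ^ k * f (δ q.2)) * V⁻¹ := by rw [hRpow]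
        _ ≤ w * (B * (2 ^ k * f (δ q.2 / 2))) * (2 * 10 ^ k / s ^ k) := by
            have := (h.pos _ hδ).le
            gcongr
        _ = κ * f (δ q.2 / 2) := by
            rw [hB]; field_simp
    · intro y hy
      refine Metric.mem_thickening_iff.2 ⟨q.1, h1, lt_of_le_of_lt (Metric.mem_closedBall.1 hy) ?_⟩
      exact half_lt_self hδ
  · rw [Finset.sum_image hinj]
    simp only [hchild]
    rw [← Finset.sum_mul, ← Finset.mul_sum, mul_assoc, mul_inv_cancel₀ hVpos.ne', mul_one]
  · intro c hc c' hc' hne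
    obtain ⟨q, hq, rfl⟩ := Finset.mem_image.1 (Finset.mem_coe.1 hc)
    obtain ⟨q', hq', rfl⟩ := Finset.mem_image.1 (Finset.mem_coe.1 hc')
    exact (hpd q hq q' hq' fun hqq => hne (by rw [hqq])).mono (hset q hq) (hset q' hq')
  · intro z r hr
    rw [or_iff_not_imp_left]
    intro hnot
    rw [MeetsAtMostOne] at hnot
    push Not at hnot
    obtain ⟨c1, hc1, c2, hc2, hm1, hm2, hne⟩ := hnot
    obtain ⟨q1, hq1, rfl⟩ := Finset.mem_image.1 hc1
    obtain ⟨q2, hq2, rfl⟩ := Finset.mem_image.1 hc2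
    set J' := J.filter (fun q => ((child q).set ∩ Metric.closedBall z r).Nonempty) with hJ'
    have hfilter : (J.image child).filter (fun c => (c.set ∩ Metric.closedBall z r).Nonempty) =
        J'.image child := Finset.filter_image
    have hmass : massMeeting (J.image child) (Metric.closedBall z r) =
        w * V⁻¹ * ∑ q ∈ J', R q.2 ^ k := by
      rw [massMeeting, hfilter, Finset.sum_image (hinj.mono (Finset.filter_subset _ _)),
        Finset.mul_sum]
      exact Finset.sum_congr rfl fun q _ => by simp only [hchild]; ring
    -- A ball of radius `r` that meets two children leaves the enlarged ball about `q`, yet meets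
    -- its child of radius at most `R / 2`. Hence `R < 2 r + R / 2`, that is `R < 4 r`, and the
    -- enlarged ball lies within `R + R / 2 + r < 7 r` of `z`.
    have hsub : ∀ q ∈ J', Metric.closedBall q.1 (R q.2) ⊆ Metric.closedBall z (7 * r) := by
      intro q hq
      obtain ⟨hqJ, y, hy1, hy2⟩ := Finset.mem_filter.1 hq
      obtain ⟨q', hq', hqq', y', hy1', hy2'⟩ : ∃ q' ∈ J, q' ≠ q ∧
          ((child q').set ∩ Metric.closedBall z r).Nonempty := by
        by_cases hq1q : q1 = q
        · exact ⟨q2, hq2, fun h2 => hne (by rw [hq1q, h2]), hm2⟩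
        · exact ⟨q1, hq1, hq1q, hm1⟩
      have hout : R q.2 < dist y' q.1 := by
        by_contra hcon
        exact Set.disjoint_left.1 (hpd q hqJ q' hq' hqq'.symm)
          (Metric.mem_closedBall.2 (not_lt.1 hcon)) (hset q' hq' hy1')
      have hδR : δ q.2 ≤ R q.2 := (hJ q hqJ).2.2.2.1
      have hyq : dist y q.1 ≤ δ q.2 / 2 := Metric.mem_closedBall.1 hy1
      rw [Metric.mem_closedBall] at hy2 hy2'
      have e1 := dist_triangle y' y q.1
      have e2 := dist_triangle_right y' y z
      have e3 := dist_triangle_left q.1 z y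
      intro v hv
      rw [Metric.mem_closedBall] at hv ⊢
      have e4 := dist_triangle v q.1 z
      linarith
    have hJ'vol : ∑ q ∈ J', R q.2 ^ k ≤ (7 * r) ^ k := by
      have e1 : ∑ q ∈ J', volume (Metric.closedBall q.1 (R q.2)) ≤
          volume (Metric.closedBall z (7 * r)) := by
        rw [← measure_biUnion_finset]
        · exact measure_mono (iUnion₂_subset hsub)
        · exact fun q hq q' hq' hne => hpd q (Finset.mem_filter.1 hq).1 q'
            (Finset.mem_filter.1 hq').1 hne
        · exact fun q _ => measurableSet_closedBall
      rw [Real.volume_pi_closedBall _ (by positivity), Fintype.card_fin,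
        Finset.sum_congr rfl fun q _ => Real.volume_pi_closedBall q.1 (hRpos q.2).le,
        Fintype.card_fin,
        ← ENNReal.ofReal_sum_of_nonneg fun q _ => by have := hRpos q.2; positivity,
        ENNReal.ofReal_le_ofReal_iff (by positivity)] at e1
      simp only [mul_pow (2 : ℝ), ← Finset.mul_sum] at e1
      exact le_of_mul_le_mul_left e1 (by positivity)
    rw [hmass]
    calc w * V⁻¹ * ∑ q ∈ J', R q.2 ^ k ≤ w * (2 * 10 ^ k / s ^ k) * (7 * r) ^ k := by
          gcongr
          exact Finset.sum_nonneg fun q _ => by have := hRpos q.2; positivity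
      _ = massConst k * (w * (r / s) ^ k) := by
          rw [massConst, show (70 : ℝ) = 10 * 7 by norm_num, mul_pow, mul_pow, div_pow]
          field_simp

/-- A level of the Cantor construction. -/
structure IsLevel (k : ℕ) (f : ℝ → ℝ) (κ ρ : ℝ) (I : Finset (WeightedBall k)) : Prop where
  radius_pos : ∀ c ∈ I, 0 < c.2.1
  weight_pos : ∀ c ∈ I, 0 < c.2.2
  weight_le : ∀ c ∈ I, ∀ r, 0 < r → r ≤ ρ → c.2.2 * min 1 ((r / c.2.1) ^ k) ≤ κ * f r
  total : ∑ c ∈ I, c.2.2 = 1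
  disj : (I : Set (WeightedBall k)).PairwiseDisjoint WeightedBall.set
  mass : ∀ z r, 0 < r → r ≤ ρ → MeetsAtMostOne I (Metric.closedBall z r) ∨
    massMeeting I (Metric.closedBall z r) ≤ massConst k * (κ * f r)

lemma massMeeting_le_sum {k : ℕ} {I : Finset (WeightedBall k)} (hI : ∀ c ∈ I, 0 < c.2.2)
    (A : Set (Fin k → ℝ)) : massMeeting I A ≤ ∑ c ∈ I, c.2.2 := by
  classical
  exact Finset.sum_le_sum_of_subset_of_nonneg (Finset.filter_subset _ _)
    fun c hc _ => (hI c hc).le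

lemma massMeeting_eq_zero {k : ℕ} {I : Finset (WeightedBall k)} {A : Set (Fin k → ℝ)}
    (h : ∀ c ∈ I, ¬ (c.set ∩ A).Nonempty) : massMeeting I A = 0 := by
  classical
  rw [massMeeting, Finset.filter_false_of_mem h, Finset.sum_empty]

/-- Each ball is replaced by its children. A test ball meeting several parents keeps its old mass
bound, because children carry exactly their parent's weight. One meeting a single parent either
meets a single child, which defers the estimate to a later level, or is controlled by volume through
`weight_le`. The constant therefore does not grow with the level. -/
theorem TransferData.exists_next_level {k : ℕ} {f : ℝ → ℝ} {δ : ℕ → ℝ} (h : TransferData k f δ)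
    {κ ρ : ℝ} (hκ : 0 < κ) {I : Finset (WeightedBall k)} (hI : IsLevel k f κ ρ I) {ε : ℝ}
    (hε : 0 < ε) (N : ℕ) :
    ∃ I' : Finset (WeightedBall k), IsLevel k f κ ρ I' ∧ ∀ c' ∈ I', c'.2.1 ≤ ε ∧
      (∃ c ∈ I, c'.set ⊆ c.set) ∧
      ∃ n, N ≤ n ∧ c'.set ⊆ Metric.thickening (δ n) (fracPoints k n) := by
  classical
  have hch : ∀ c : WeightedBall k, ∃ I' : Finset (WeightedBall k), c ∈ I →
      (∀ c' ∈ I', 0 < c'.2.1 ∧ c'.2.1 ≤ ε ∧ 0 < c'.2.2 ∧ c'.2.2 ≤ κ * f c'.2.1 ∧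
        c'.set ⊆ c.set ∧
        ∃ n, N ≤ n ∧ c'.set ⊆ Metric.thickening (δ n) (fracPoints k n)) ∧
      ∑ c' ∈ I', c'.2.2 = c.2.2 ∧
      ((I' : Set (WeightedBall k)).PairwiseDisjoint WeightedBall.set) ∧
      ∀ z r, 0 < r → MeetsAtMostOne I' (Metric.closedBall z r) ∨
        massMeeting I' (Metric.closedBall z r) ≤ massConst k * (c.2.2 * (r / c.2.1) ^ k) := by
    intro c
    by_cases hc : c ∈ I
    · obtain ⟨I', hI'⟩ := h.exists_children c (hI.radius_pos c hc) (hI.weight_pos c hc) hκ hε N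
      exact ⟨I', fun _ => hI'⟩
    · exact ⟨∅, fun hc' => absurd hc' hc⟩
  choose ch hch using hch
  have hne : ∀ c ∈ I, ∀ c' ∈ ch c, c'.set.Nonempty := fun c hc c' hc' =>
    ⟨c'.1, Metric.mem_closedBall_self ((hch c hc).1 c' hc').1.le⟩
  have hpd : (I : Set (WeightedBall k)).PairwiseDisjoint ch := by
    intro c hc d hd hcd
    rw [Function.onFun, Finset.disjoint_left]
    intro e he he'
    obtain ⟨y, hy⟩ := hne c hc e he
    exact Set.disjoint_left.1 (hI.disj hc hd hcd) (((hch c hc).1 e he).2.2.2.2.1 hy)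
      (((hch d hd).1 e he').2.2.2.2.1 hy)
  have hmeet : ∀ A : Set (Fin k → ℝ), massMeeting (I.biUnion ch) A =
      ∑ c ∈ I, massMeeting (ch c) A := by
    intro A
    simp only [massMeeting]
    rw [Finset.filter_biUnion, Finset.sum_biUnion]
    exact fun c hc d hd hcd => Finset.disjoint_filter_filter (hpd hc hd hcd)
  have hparent : ∀ c ∈ I, ∀ A : Set (Fin k → ℝ), ¬ (c.set ∩ A).Nonempty →
      massMeeting (ch c) A = 0 := fun c hc A hcA => massMeeting_eq_zero fun c' hc' hm =>
    hcA (hm.mono (inter_subset_inter_left _ ((hch c hc).1 c' hc').2.2.2.2.1))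
  have hle : ∀ c ∈ I, ∀ A : Set (Fin k → ℝ), massMeeting (ch c) A ≤ c.2.2 := fun c hc A =>
    (massMeeting_le_sum (fun c' hc' => ((hch c hc).1 c' hc').2.2.1) A).trans_eq (hch c hc).2.1
  refine ⟨I.biUnion ch, ⟨?_, ?_, ?_, ?_, ?_, ?_⟩, ?_⟩
  · intro c' hc'
    obtain ⟨c, hc, hcc⟩ := Finset.mem_biUnion.1 hc'
    exact ((hch c hc).1 c' hcc).1
  · intro c' hc'
    obtain ⟨c, hc, hcc⟩ := Finset.mem_biUnion.1 hc'
    exact ((hch c hc).1 c' hcc).2.2.1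
  · intro c' hc' r hr hrρ
    obtain ⟨c, hc, hcc⟩ := Finset.mem_biUnion.1 hc'
    obtain ⟨h1, -, h2, h3, -⟩ := (hch c hc).1 c' hcc
    rcases le_total r c'.2.1 with hrt | hrt
    · calc c'.2.2 * min 1 ((r / c'.2.1) ^ k) ≤ (κ * f c'.2.1) * (r / c'.2.1) ^ k :=
            mul_le_mul h3 (min_le_right _ _) (by positivity) (h2.le.trans h3)
        _ = κ * (f c'.2.1 * (r / c'.2.1) ^ k) := by ring
        _ ≤ κ * f r := by gcongr; exact h.le_scale hr hrt
    · calc c'.2.2 * min 1 ((r / c'.2.1) ^ k) ≤ c'.2.2 * 1 :=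
            mul_le_mul_of_nonneg_left (min_le_left _ _) h2.le
        _ ≤ κ * f c'.2.1 := by rw [mul_one]; exact h3
        _ ≤ κ * f r := by gcongr; exact h.mono (mem_Ioi.2 h1) (mem_Ioi.2 hr) hrt
  · rw [Finset.sum_biUnion hpd, Finset.sum_congr rfl fun c hc => (hch c hc).2.1, hI.total]
  · intro c' hc' d' hd' hcd
    obtain ⟨c, hc, hcc⟩ := Finset.mem_biUnion.1 (Finset.mem_coe.1 hc')
    obtain ⟨d, hd, hdd⟩ := Finset.mem_biUnion.1 (Finset.mem_coe.1 hd')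
    by_cases hcd' : c = d
    · subst hcd'
      exact (hch c hc).2.2.1 hcc hdd hcd
    · exact (hI.disj hc hd hcd').mono ((hch c hc).1 c' hcc).2.2.2.2.1
        ((hch d hd).1 d' hdd).2.2.2.2.1
  · intro z r hr hrρ
    set A := Metric.closedBall z r with hA
    have hA1 := one_le_massConst k
    rcases hI.mass z r hr hrρ with hone | hmass
    · by_cases hex : ∃ c ∈ I, (c.set ∩ A).Nonempty
      · obtain ⟨c, hc, hcA⟩ := hex
        have honly : ∀ d ∈ I, d ≠ c → ¬ (d.set ∩ A).Nonempty := fun d hd hdc hdA =>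
          hdc (hone d hd c hc hdA hcA)
        rcases (hch c hc).2.2.2 z r hr with hone' | hmass'
        · left
          have hin : ∀ c' ∈ I.biUnion ch, (c'.set ∩ A).Nonempty → c' ∈ ch c := by
            intro c' hc' hm
            obtain ⟨d, hd, hdd⟩ := Finset.mem_biUnion.1 hc'
            by_cases hdc : d = c
            · rwa [hdc] at hdd
            · exact absurd (hm.mono (inter_subset_inter_left _
                ((hch d hd).1 c' hdd).2.2.2.2.1)) (honly d hd hdc)
          intro c1 hc1 c2 hc2 hm1 hm2
          exact hone' c1 (hin c1 hc1 hm1) c2 (hin c2 hc2 hm2) hm1 hm2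
        · right
          have hwc := hI.weight_le c hc r hr hrρ
          have hwp := hI.weight_pos c hc
          rw [hmeet, Finset.sum_eq_single c (fun d hd hdc => hparent d hd A (honly d hd hdc))
            (fun hcn => absurd hc hcn)]
          refine le_trans ?_ (mul_le_mul_of_nonneg_left hwc (zero_le_one.trans hA1))
          rcases min_choice (1 : ℝ) ((r / c.2.1) ^ k : ℝ) with hmin | hmin
          · rw [hmin, mul_one]
            exact (hle c hc A).trans (le_mul_of_one_le_left hwp.le hA1)
          · rw [hmin]; exact hmass'
      · left
        intro c1 hc1 c2 hc2 hm1 hm2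
        obtain ⟨d, hd, hdd⟩ := Finset.mem_biUnion.1 hc1
        exact absurd ⟨d, hd, hm1.mono (inter_subset_inter_left _
          ((hch d hd).1 c1 hdd).2.2.2.2.1)⟩ hex
    · right
      refine le_trans ?_ hmass
      rw [hmeet, massMeeting, Finset.sum_filter]
      refine Finset.sum_le_sum fun c hc => ?_
      split_ifs with hcA
      · exact hle c hc A
      · exact (hparent c hc A hcA).le
  · intro c' hc'
    obtain ⟨c, hc, hcc⟩ := Finset.mem_biUnion.1 hc'
    obtain ⟨-, h2, -, -, h5, h6⟩ := (hch c hc).1 c' hcc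
    exact ⟨h2, ⟨c, hc, h5⟩, h6⟩

/-- A level of small radii bounds from below the weight of the covers of its balls. -/
lemma TransferData.one_le_sum_of_level {k : ℕ} {f : ℝ → ℝ} {δ : ℕ → ℝ} (h : TransferData k f δ)
    {κ ρ : ℝ} (hκ : 0 < κ) {I : Finset (WeightedBall k)} (hI : IsLevel k f κ ρ I)
    (S : Finset ((Fin k → ℝ) × ℝ)) (hS : ∀ b ∈ S, 0 < b.2 ∧ 2 * b.2 ≤ ρ)
    (hsmall : ∀ c ∈ I, ∀ b ∈ S, c.2.1 ≤ 2 * b.2)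
    (hcov : ∀ c ∈ I, ∃ b ∈ S, c.1 ∈ Metric.closedBall b.1 (2 * b.2)) :
    1 ≤ massConst k * κ * 2 ^ k * ∑ b ∈ S, f b.2 := by
  classical
  have hA1 := one_le_massConst k
  have hball : ∀ b ∈ S, massMeeting I (Metric.closedBall b.1 (2 * b.2)) ≤
      massConst k * κ * 2 ^ k * f b.2 := by
    intro b hb
    obtain ⟨hb0, hbρ⟩ := hS b hb
    have h2b : 0 < 2 * b.2 := by positivity
    have hf2 := h.pos _ h2b
    have hmain : massMeeting I (Metric.closedBall b.1 (2 * b.2)) ≤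
        massConst k * (κ * f (2 * b.2)) := by
      -- The deferred alternative is settled here: the balls of the level are smaller than the test
      -- ball, so the minimum in `weight_le` is `1` and bounds the whole weight of the one ball met.
      rcases hI.mass b.1 (2 * b.2) h2b hbρ with hone | hmass
      · by_cases hex : ∃ c ∈ I, (c.set ∩ Metric.closedBall b.1 (2 * b.2)).Nonempty
        · obtain ⟨c, hc, hcA⟩ := hex
          have : I.filter (fun c => (c.set ∩ Metric.closedBall b.1 (2 * b.2)).Nonempty) = {c} := by
            ext d
            rw [Finset.mem_filter, Finset.mem_singleton]
            exact ⟨fun hd => hone d hd.1 c hc hd.2 hcA, fun hd => by rw [hd]; exact ⟨hc, hcA⟩⟩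
          rw [massMeeting, this, Finset.sum_singleton]
          have hw := hI.weight_le c hc (2 * b.2) h2b hbρ
          rw [min_eq_left, mul_one] at hw
          · refine hw.trans (le_mul_of_one_le_left (by positivity) hA1)
          · exact one_le_pow₀ ((one_le_div (hI.radius_pos c hc)).2 (hsmall c hc b hb))
        · rw [massMeeting_eq_zero fun c hc hm => hex ⟨c, hc, hm⟩]
          positivity
      · exact hmass
    calc _ ≤ massConst k * (κ * f (2 * b.2)) := hmain
      _ ≤ massConst k * (κ * (2 ^ k * f b.2)) := by gcongr; exact h.two_mul_le hb0
      _ = _ := by ring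
  rw [Finset.mul_sum, ← hI.total]
  refine le_trans ?_ (Finset.sum_le_sum hball)
  simp only [massMeeting, Finset.sum_filter]
  rw [Finset.sum_comm]
  refine Finset.sum_le_sum fun c hc => ?_
  obtain ⟨b, hb, hcb⟩ := hcov c hc
  have hw := hI.weight_pos c hc
  have : c.2.2 = if (c.set ∩ Metric.closedBall b.1 (2 * b.2)).Nonempty then c.2.2 else 0 := by
    rw [if_pos ⟨c.1, Metric.mem_closedBall_self (hI.radius_pos c hc).le, hcb⟩]
  refine this.trans_le (Finset.single_le_sum (f := fun b : (Fin k → ℝ) × ℝ =>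
    if (c.set ∩ Metric.closedBall b.1 (2 * b.2)).Nonempty then c.2.2 else 0) (fun b _ => ?_) hb)
  split_ifs
  · exact hw.le
  · exact le_rfl

/-- The mass transference principle: lower bound for ball covers of a limsup set. -/
theorem TransferData.exists_lower_bound {k : ℕ} {f : ℝ → ℝ} {δ : ℕ → ℝ} (h : TransferData k f δ)
    {κ : ℝ} (hκ : 0 < κ) : ∃ ρ > 0, ∀ T : Set ((Fin k → ℝ) × ℝ),
      IsBallCover ρ (approxSet k δ ∩ Metric.closedBall (fun _ => 1 / 2) (1 / 2)) T →
      1 ≤ ENNReal.ofReal (massConst k * κ * 2 ^ k) * ∑' b : T, ENNReal.ofReal (f b.1.2) := by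
  classical
  -- This threshold makes the unit cube with weight `1` an admissible initial level: `(2 r) ^ k ≤ κ
  -- * f r` for `r ≤ ρ`. Covers use `ρ / 2` because their balls get doubled.
  obtain ⟨ρ, hρ, hρf⟩ := h.large (2 ^ k / κ)
  refine ⟨ρ / 2, by positivity, ?_⟩
  rintro T ⟨-, hTr, hTcov⟩
  set x0 : Fin k → ℝ := fun _ => 1 / 2 with hx0
  have hI0 : IsLevel k f κ ρ {(x0, 1 / 2, 1)} := by
    refine ⟨?_, ?_, ?_, by simp, by simp, ?_⟩
    · intro c hc; rw [Finset.mem_singleton.1 hc]; norm_num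
    · intro c hc; rw [Finset.mem_singleton.1 hc]; norm_num
    · intro c hc r hr hrρ
      rw [Finset.mem_singleton.1 hc]
      have h1 := hρf r hr hrρ
      rw [div_mul_eq_mul_div, div_le_iff₀ hκ] at h1
      calc (1 : ℝ) * min 1 ((r / (1 / 2)) ^ k) ≤ (r / (1 / 2)) ^ k := by
            rw [one_mul]; exact min_le_right _ _
        _ = 2 ^ k * r ^ k := by rw [← mul_pow]; congr 1; ring
        _ ≤ κ * f r := by linarith
    · intro z r _ _
      left
      intro c hc c' hc' _ _
      rw [Finset.mem_singleton.1 hc, Finset.mem_singleton.1 hc']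
  have hstep : ∀ (j : ℕ) (I : {I : Finset (WeightedBall k) // IsLevel k f κ ρ I}),
      ∃ I' : {I : Finset (WeightedBall k) // IsLevel k f κ ρ I}, ∀ c' ∈ I'.1,
        c'.2.1 ≤ 1 / ((j : ℝ) + 1) ∧ (∃ c ∈ I.1, c'.set ⊆ c.set) ∧
        ∃ n, j ≤ n ∧ c'.set ⊆ Metric.thickening (δ n) (fracPoints k n) := by
    intro j I
    obtain ⟨I', h1, h2⟩ := h.exists_next_level hκ I.2 (ε := 1 / ((j : ℝ) + 1)) (by positivity) j
    exact ⟨⟨I', h1⟩, h2⟩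
  choose next hnext using hstep
  let L : ℕ → {I : Finset (WeightedBall k) // IsLevel k f κ ρ I} := fun j =>
    Nat.rec ⟨_, hI0⟩ (fun j I => next j I) j
  have hL : ∀ j, L (j + 1) = next j (L j) := fun j => rfl
  let K : ℕ → Set (Fin k → ℝ) := fun j => ⋃ c ∈ (L j).1, WeightedBall.set c
  have hKanti : Antitone K := by
    refine antitone_nat_of_succ_le fun j => iUnion₂_subset fun c' hc' => ?_
    rw [hL] at hc'
    obtain ⟨-, ⟨c, hc, hsub⟩, -⟩ := hnext j (L j) c' hc'
    exact hsub.trans (subset_biUnion_of_mem (u := WeightedBall.set) hc)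
  have hKcomp : ∀ j, IsCompact (K j) := fun j =>
    (L j).1.isCompact_biUnion fun c _ => isCompact_closedBall c.1 c.2.1
  have hKsub : (⋂ j, K j) ⊆ approxSet k δ ∩ Metric.closedBall x0 (1 / 2) := by
    intro y hy
    rw [mem_iInter] at hy
    constructor
    · rw [mem_approxSet, frequently_atTop]
      intro j
      obtain ⟨c, hc, hyc⟩ := mem_iUnion₂.1 (hy (j + 1))
      rw [hL] at hc
      obtain ⟨-, -, n, hn, hsub⟩ := hnext j (L j) c hc
      exact ⟨n, hn, hsub hyc⟩
    · obtain ⟨c, hc, hyc⟩ := mem_iUnion₂.1 (hy 0)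
      rw [Finset.mem_singleton.1 hc] at hyc
      exact hyc
  have hopen : IsOpen (⋃ b ∈ T, Metric.ball b.1 (2 * b.2)) :=
    isOpen_biUnion fun b _ => Metric.isOpen_ball
  -- Doubling turns the closed balls of the cover into open ones; by compactness they contain an
  -- entire level of the nested construction, not only the limit set.
  obtain ⟨j0, hj0⟩ : ∃ j, K j ⊆ ⋃ b ∈ T, Metric.ball b.1 (2 * b.2) := by
    refine exists_subset_nhds_of_isCompact' hKanti.directed_ge hKcomp
      (fun j => (hKcomp j).isClosed) fun y hy => hopen.mem_nhds ?_
    obtain ⟨b, hb, hyb⟩ := mem_iUnion₂.1 (hTcov (hKsub hy))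
    refine mem_iUnion₂.2 ⟨b, hb, ?_⟩
    have := (hTr b hb).1
    exact Metric.closedBall_subset_ball (by linarith) hyb
  obtain ⟨T', hT'T, hT'fin, hT'cov⟩ := (hKcomp j0).elim_finite_subcover_image
    (fun b _ => Metric.isOpen_ball) hj0
  set S := hT'fin.toFinset with hS
  have hST : ∀ b ∈ S, b ∈ T := fun b hb => hT'T (hT'fin.mem_toFinset.1 hb)
  have hSpos : ∀ b ∈ S, 0 < b.2 ∧ 2 * b.2 ≤ ρ := fun b hb => by
    obtain ⟨h1, h2⟩ := hTr b (hST b hb)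
    exact ⟨h1, by linarith⟩
  -- Only finitely many covering balls remain, so a deep enough level has radii below all of theirs.
  have hev : ∀ᶠ j : ℕ in atTop, ∀ b ∈ S, 1 / ((j : ℝ) + 1) ≤ 2 * b.2 := by
    rw [eventually_all_finset]
    intro b hb
    have := (hSpos b hb).1
    exact tendsto_one_div_add_atTop_nhds_zero_nat.eventually (ge_mem_nhds (by positivity))
  obtain ⟨j, hj, hjj⟩ := (hev.and (eventually_ge_atTop j0)).exists
  have hone := h.one_le_sum_of_level hκ (L (j + 1)).2 S hSpos
    (fun c hc b hb => by
      rw [hL] at hc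
      exact (hnext j (L j) c hc).1.trans (hj b hb))
    (fun c hc => by
      have h1 : c.1 ∈ K (j + 1) := mem_iUnion₂.2 ⟨c, hc,
        Metric.mem_closedBall_self ((L (j + 1)).2.radius_pos c hc).le⟩
      obtain ⟨b, hb, hcb⟩ := mem_iUnion₂.1 (hT'cov (hKanti (by omega : j0 ≤ j + 1) h1))
      exact ⟨b, hT'fin.mem_toFinset.2 hb, Metric.ball_subset_closedBall hcb⟩)
  have hfin : ∑ b ∈ S, ENNReal.ofReal (f b.2) ≤ ∑' b : T, ENNReal.ofReal (f b.1.2) := by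
    rw [← Finset.sum_coe_sort S]
    have hinj : Function.Injective (fun b : S => (⟨b.1, hST b.1 b.2⟩ : T)) := fun b b' hb =>
      Subtype.ext (congrArg (fun t : T => t.1) hb)
    calc ∑ b : S, ENNReal.ofReal (f b.1.2) = ∑' b : S, ENNReal.ofReal (f b.1.2) :=
          (tsum_fintype _).symm
      _ ≤ _ := ENNReal.tsum_comp_le_tsum_of_injective hinj
        (fun b : T => ENNReal.ofReal (f b.1.2))
  have hA1 := one_le_massConst k
  calc (1 : ℝ≥0∞) = ENNReal.ofReal 1 := ENNReal.ofReal_one.symm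
    _ ≤ ENNReal.ofReal (massConst k * κ * 2 ^ k * ∑ b ∈ S, f b.2) := ENNReal.ofReal_le_ofReal hone
    _ = ENNReal.ofReal (massConst k * κ * 2 ^ k) * ∑ b ∈ S, ENNReal.ofReal (f b.2) := by
        rw [ENNReal.ofReal_mul (by positivity), ENNReal.ofReal_sum_of_nonneg]
        exact fun b hb => (h.pos _ (hSpos b hb).1).le
    _ ≤ _ := by gcongr

/-! ### Hausdorff measures -/

lemma IsBallCover.mono {X : Type*} [MetricSpace X] {ρ : ℝ} {F G : Set X} (h : F ⊆ G)
    {T : Set (X × ℝ)} (hT : IsBallCover ρ G T) : IsBallCover ρ F T :=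
  ⟨hT.1, hT.2.1, h.trans hT.2.2⟩

lemma hausdorffMeasure_mono {X : Type*} [MetricSpace X] (f : ℝ → ℝ) {F G : Set X} (h : F ⊆ G) :
    hausdorffMeasure f F ≤ hausdorffMeasure f G :=
  iSup₂_mono fun _ _ => le_iInf₂ fun T hT => iInf₂_le T (hT.mono h)

lemma hausdorffContent_union_le {X : Type*} [MetricSpace X] (f : ℝ → ℝ) (ρ : ℝ) (F G : Set X) :
    hausdorffContent f ρ (F ∪ G) ≤ hausdorffContent f ρ F + hausdorffContent f ρ G := by
  refine ENNReal.le_iInf₂_add_iInf₂ fun T hT T' hT' => ?_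
  refine (iInf₂_le (T ∪ T') ⟨hT.1.union hT'.1, ?_, ?_⟩).trans
    (ENNReal.tsum_union_le (fun b : X × ℝ => ENNReal.ofReal (f b.2)) T T')
  · rintro b (hb | hb)
    · exact hT.2.1 b hb
    · exact hT'.2.1 b hb
  · rw [biUnion_union]
    exact union_subset_union hT.2.2 hT'.2.2

lemma hausdorffMeasure_union_le {X : Type*} [MetricSpace X] (f : ℝ → ℝ) (F G : Set X) :
    hausdorffMeasure f (F ∪ G) ≤ hausdorffMeasure f F + hausdorffMeasure f G :=
  iSup₂_le fun ρ hρ => (hausdorffContent_union_le f ρ F G).trans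
    (add_le_add (le_iSup₂ (f := fun (ρ : ℝ) (_ : 0 < ρ) => hausdorffContent f ρ F) ρ hρ)
      (le_iSup₂ (f := fun (ρ : ℝ) (_ : 0 < ρ) => hausdorffContent f ρ G) ρ hρ))

/-- A Lebesgue null set is `𝓗^f`-null if `f r = O(r ^ k)`. -/
lemma hausdorffMeasure_eq_zero_of_volume_eq_zero {k : ℕ} {f : ℝ → ℝ} {K ρ₀ : ℝ} (hρ₀ : 0 < ρ₀)
    (hf : ∀ r, 0 < r → r ≤ ρ₀ → f r ≤ K * r ^ k) {Z : Set (EuclideanSpace ℝ (Fin k))}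
    (hZ : volume Z = 0) : hausdorffMeasure f Z = 0 := by
  refine le_antisymm (iSup₂_le fun ρ hρ => ?_) zero_le
  set c := volume (Metric.ball (0 : EuclideanSpace ℝ (Fin k)) 1) with hc
  have hc0 : c ≠ 0 := (Metric.measure_ball_pos volume _ one_pos).ne'
  have hc1 : c ≠ ∞ := measure_ball_lt_top.ne
  have hC : ENNReal.ofReal K * c⁻¹ ≠ ∞ :=
    ENNReal.mul_ne_top ENNReal.ofReal_ne_top (ENNReal.inv_ne_top.2 hc0)
  have key : ∀ ε : ℝ≥0∞, ε ≠ 0 → hausdorffContent f ρ Z ≤ ENNReal.ofReal K * c⁻¹ * ε := by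
    intro ε hε
    -- Besicovitch's theorem covers the null set by small balls of total volume at most `ε`, and `f
    -- r ≤ K * r ^ k` compares the sum of `f` with that volume.
    obtain ⟨t, r, htc, -, htr, htcov, htsum⟩ :=
      Besicovitch.exists_closedBall_covering_tsum_measure_le volume hε
        (fun _ => Ioc 0 (min ρ ρ₀)) Z (fun x _ δ hδ => by
          have h0 : 0 < min (min ρ ρ₀) (δ / 2) := lt_min (lt_min hρ hρ₀) (by positivity)
          exact ⟨_, ⟨h0, min_le_left _ _⟩, h0, (min_le_right _ _).trans_lt (by linarith)⟩)
    rw [hZ, zero_add] at htsum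
    have hcover : IsBallCover ρ Z ((fun x => (x, r x)) '' t) := by
      refine ⟨htc.image _, ?_, ?_⟩
      · rintro _ ⟨x, hx, rfl⟩
        exact ⟨(htr x hx).1, (htr x hx).2.trans (min_le_left _ _)⟩
      · rw [biUnion_image]
        exact htcov
    refine (iInf₂_le _ hcover).trans ?_
    rw [tsum_image (fun b : EuclideanSpace ℝ (Fin k) × ℝ => ENNReal.ofReal (f b.2))
      (fun x _ y _ h => congrArg Prod.fst h)]
    refine le_trans ?_ (mul_le_mul_right htsum (ENNReal.ofReal K * c⁻¹))
    rw [← ENNReal.tsum_mul_left]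
    refine ENNReal.tsum_le_tsum fun x => ?_
    obtain ⟨h1, h2⟩ := htr x x.2
    rw [Measure.addHaar_closedBall volume _ h1.le, finrank_euclideanSpace_fin, ← hc]
    calc ENNReal.ofReal (f (r x)) ≤ ENNReal.ofReal (K * r x ^ k) :=
          ENNReal.ofReal_le_ofReal (hf _ h1 (h2.trans (min_le_right _ _)))
      _ = ENNReal.ofReal K * ENNReal.ofReal (r x ^ k) := ENNReal.ofReal_mul' (by positivity)
      _ = ENNReal.ofReal K * ENNReal.ofReal (r x ^ k) * (c⁻¹ * c) := by
          rw [ENNReal.inv_mul_cancel hc0 hc1, mul_one]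
      _ = _ := by ring
  have hlim : Tendsto (fun n : ℕ => ENNReal.ofReal K * c⁻¹ * (n : ℝ≥0∞)⁻¹) atTop
      (𝓝 (ENNReal.ofReal K * c⁻¹ * 0)) :=
    ENNReal.Tendsto.const_mul ENNReal.tendsto_inv_nat_nhds_zero (Or.inr hC)
  rw [mul_zero] at hlim
  exact ge_of_tendsto' hlim fun n => key _ (ENNReal.inv_ne_zero.2 (ENNReal.natCast_ne_top n))

/-! ### The approximable points -/

/-- Different denominators give different pairs, so infinitely many pairs come from infinitely many
`n`; sup-metric closeness is coordinatewise closeness. -/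
lemma mem_simApprox_of_mem_approxSet {k : ℕ} {ψ : ℝ → ℝ} {δ : ℕ → ℝ}
    (hδ : ∀ n : ℕ, 0 < n → δ n ≤ ψ n / n) {y : EuclideanSpace ℝ (Fin k)} (hy : y ∈ unitCube k)
    (h : WithLp.ofLp y ∈ approxSet k δ) : y ∈ simApprox k ψ := by
  refine ⟨hy, ?_⟩
  have h1 := Nat.frequently_atTop_iff_infinite.1
    ((mem_approxSet.1 h).and_eventually (eventually_gt_atTop 0))
  refine Set.Infinite.of_image Prod.fst (h1.mono ?_)
  rintro n ⟨hn, hn0⟩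
  obtain ⟨z, ⟨p, hp⟩, hyz⟩ := Metric.mem_thickening_iff.1 hn
  refine ⟨(n, p), ⟨hn0, fun i => ⟨?_, (hp i).1⟩⟩, rfl⟩
  have h2 := (dist_le_pi_dist (WithLp.ofLp y) z i).trans_lt hyz
  rw [Real.dist_eq, (hp i).2] at h2
  exact h2.trans_le (hδ n hn0)

lemma ofLp_mem_closedBall_iff {k : ℕ} {y : EuclideanSpace ℝ (Fin k)} :
    WithLp.ofLp y ∈ Metric.closedBall (fun _ : Fin k => (1 / 2 : ℝ)) (1 / 2) ↔ y ∈ unitCube k := by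
  rw [Metric.mem_closedBall, dist_pi_le_iff (by norm_num)]
  refine forall_congr' fun i => ?_
  rw [Real.dist_eq, abs_le, mem_Icc]
  constructor <;> rintro ⟨h1, h2⟩ <;> constructor <;> linarith

/-- The mass transference principle: the approximable points have infinite `𝓗^f`-measure. -/
theorem TransferData.hausdorffMeasure_simApprox {k : ℕ} {f ψ : ℝ → ℝ} {δ : ℕ → ℝ}
    (h : TransferData k f δ) (hδ : ∀ n : ℕ, 0 < n → δ n ≤ ψ n / n) :
    hausdorffMeasure f (simApprox k ψ) = ∞ := by
  refine ENNReal.eq_top_of_forall_nnreal_le fun N => ?_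
  have hA := one_le_massConst k
  have hN : (0 : ℝ) < N + 1 := by positivity
  obtain ⟨ρ, hρ, hlow⟩ := h.exists_lower_bound
    -- This `κ` makes the constant of the lower bound equal to `1 / (N + 1)`.
    (by positivity : (0 : ℝ) < (massConst k * 2 ^ k * (N + 1))⁻¹)
  have hconst : massConst k * (massConst k * 2 ^ k * (N + 1 : ℝ))⁻¹ * 2 ^ k = (N + 1 : ℝ)⁻¹ := by
    have : massConst k ≠ 0 := by positivity
    field_simp
  rw [hconst] at hlow
  refine le_trans (le_iInf₂ fun T hT => ?_) (le_iSup₂ (f := fun (ρ : ℝ) (_ : 0 < ρ) =>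
    hausdorffContent f ρ (simApprox k ψ)) ρ hρ)
  obtain ⟨hTc, hTr, hTcov⟩ := hT
  set g : EuclideanSpace ℝ (Fin k) × ℝ → (Fin k → ℝ) × ℝ := fun b => (WithLp.ofLp b.1, b.2) with hg
  have hginj : Function.Injective g := fun b b' hb => by
    have h1 : WithLp.ofLp b.1 = WithLp.ofLp b'.1 :=
      congrArg (fun c : (Fin k → ℝ) × ℝ => c.1) hb
    exact Prod.ext (WithLp.ofLp_injective 2 h1) (congrArg (fun c : (Fin k → ℝ) × ℝ => c.2) hb)
  have hcover : IsBallCover ρ (approxSet k δ ∩ Metric.closedBall (fun _ => 1 / 2) (1 / 2))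
      (g '' T) := by
    refine ⟨hTc.image _, ?_, ?_⟩
    · rintro _ ⟨b, hb, rfl⟩
      exact hTr b hb
    · rintro y ⟨hy1, hy2⟩
      have hy : WithLp.toLp 2 y ∈ simApprox k ψ :=
        mem_simApprox_of_mem_approxSet hδ (ofLp_mem_closedBall_iff.1 hy2) hy1
      obtain ⟨b, hb, hyb⟩ := mem_iUnion₂.1 (hTcov hy)
      refine mem_iUnion₂.2 ⟨g b, mem_image_of_mem g hb, ?_⟩
      -- The sup distance is at most the Euclidean one, so a Euclidean cover becomes a sup-metric
      -- cover with the same centres and radii.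
      have h1 := (PiLp.lipschitzWith_ofLp 2 (fun _ : Fin k => ℝ)).dist_le_mul (WithLp.toLp 2 y) b.1
      rw [NNReal.coe_one, one_mul] at h1
      exact h1.trans hyb
  have h1 := hlow _ hcover
  rw [tsum_image (fun b : (Fin k → ℝ) × ℝ => ENNReal.ofReal (f b.2)) hginj.injOn] at h1
  calc (N : ℝ≥0∞) ≤ ENNReal.ofReal (N + 1) := by
        rw [← ENNReal.ofReal_coe_nnreal]
        exact ENNReal.ofReal_le_ofReal (by linarith)
    _ = ENNReal.ofReal (N + 1) * 1 := (mul_one _).symm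
    _ ≤ ENNReal.ofReal (N + 1) * (ENNReal.ofReal (N + 1 : ℝ)⁻¹ *
        ∑' b : T, ENNReal.ofReal (f b.1.2)) := by gcongr
    _ = ∑' b : T, ENNReal.ofReal (f b.1.2) := by
        rw [← mul_assoc, ← ENNReal.ofReal_mul hN.le, mul_inv_cancel₀ hN.ne', ENNReal.ofReal_one,
          one_mul]

lemma tsum_eq_top_of_eventually_le {a b : ℕ → ℝ≥0∞} (ha : ∀ n, a n ≠ ∞) {C : ℝ≥0∞} (hC : C ≠ ∞)
    (h : ∀ᶠ n in atTop, a n ≤ C * b n) (hsum : ∑' n, a n = ∞) : ∑' n, b n = ∞ := by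
  by_contra hne
  obtain ⟨N, hN⟩ := eventually_atTop.1 h
  have h1 : ∑' n, a (n + N) ≤ C * ∑' n, b n := by
    calc ∑' n, a (n + N) ≤ ∑' n, C * b (n + N) := ENNReal.tsum_le_tsum fun n => hN _ (by omega)
      _ = C * ∑' n, b (n + N) := ENNReal.tsum_mul_left
      _ ≤ C * ∑' n, b n :=
          mul_le_mul_right (ENNReal.tsum_comp_le_tsum_of_injective (add_left_injective N) b) C
  have h2 := ENNReal.summable.sum_add_tsum_nat_add' (f := a) (k := N)
  rw [hsum, ENNReal.add_eq_top] at h2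
  rcases h2 with h2 | h2
  · exact absurd h2 (ENNReal.sum_ne_top.2 fun n _ => ha n)
  · exact ne_top_of_le_ne_top (ENNReal.mul_ne_top hC hne) h1 h2

/-- The case of a dimension function with `f r = O(r ^ k)`. -/
theorem hausdorffMeasure_simApprox_of_le {k : ℕ} (hk : 2 ≤ k) {f ψ : ℝ → ℝ} {δ : ℕ → ℝ} {K ρ₀ : ℝ}
    (hρ₀ : 0 < ρ₀) (hf : ∀ r, 0 < r → r ≤ ρ₀ → f r ≤ K * r ^ k) (hδ0 : ∀ n, 0 < δ n)
    (hlim : Tendsto δ atTop (𝓝 0)) (hδ : ∀ n : ℕ, 0 < n → δ n ≤ ψ n / n)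
    (hdiv : ∑' n, ENNReal.ofReal (f (δ n) * (n.totient : ℝ) ^ k) = ∞) :
    hausdorffMeasure f (simApprox k ψ) = hausdorffMeasure f (unitCube k) := by
  have hdiv' : ∑' n, ENNReal.ofReal ((δ n * n.totient) ^ k) = ∞ := by
    refine tsum_eq_top_of_eventually_le (fun n => ENNReal.ofReal_ne_top)
      (ENNReal.ofReal_ne_top (r := K)) ?_ hdiv
    filter_upwards [hlim.eventually (ge_mem_nhds hρ₀)] with n hn
    have hpos := hδ0 n
    rw [← ENNReal.ofReal_mul' (by positivity)]
    refine ENNReal.ofReal_le_ofReal ?_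
    rw [mul_pow, ← mul_assoc]
    exact mul_le_mul_of_nonneg_right (hf _ hpos hn) (by positivity)
  have hfull := ae_mem_approxSet hk δ (fun n => (hδ0 n).le) hlim hdiv'
  have hfull' : ∀ᵐ y : EuclideanSpace ℝ (Fin k), WithLp.ofLp y ∈ approxSet k δ :=
    (PiLp.volume_preserving_ofLp (Fin k)).quasiMeasurePreserving.ae hfull
  have hnull : volume (unitCube k \ simApprox k ψ) = 0 := by
    rw [ae_iff] at hfull'
    refine measure_mono_null (t := {y | ¬ WithLp.ofLp y ∈ approxSet k δ}) (fun y hy => ?_) hfull'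
    exact fun hy' => hy.2 (mem_simApprox_of_mem_approxSet hδ hy.1 hy')
  refine le_antisymm (hausdorffMeasure_mono f fun y hy => hy.1) ?_
  calc hausdorffMeasure f (unitCube k)
      ≤ hausdorffMeasure f (simApprox k ψ ∪ unitCube k \ simApprox k ψ) :=
        hausdorffMeasure_mono f (by rw [union_sdiff_self]; exact subset_union_right)
    _ ≤ hausdorffMeasure f (simApprox k ψ) + hausdorffMeasure f (unitCube k \ simApprox k ψ) :=
        hausdorffMeasure_union_le f _ _
    _ = hausdorffMeasure f (simApprox k ψ) := by
        rw [hausdorffMeasure_eq_zero_of_volume_eq_zero hρ₀ hf hnull, add_zero]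

/-! ### Small radii -/

/-- Each prime power `p ^ a ∣ n` with `a > 0` is at most `2 * φ (p ^ a) ≤ 2 * φ n`. Consequently `n
≤ (2 * φ n)!`, an elementary proof that `φ` tends to infinity. -/
lemma dvd_factorial_two_mul_totient {n : ℕ} (hn : n ≠ 0) :
    n ∣ (2 * n.totient).factorial := by
  refine (Nat.dvd_iff_prime_pow_dvd_dvd _ _).2 fun p a hp hpa => ?_
  rcases Nat.eq_zero_or_pos a with rfl | ha
  · simp
  refine Nat.dvd_factorial (pow_pos hp.pos a) ?_
  have h1 := Nat.le_of_dvd (Nat.totient_pos.2 (Nat.pos_of_ne_zero hn))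
    (Nat.totient_dvd_of_dvd hpa)
  rw [Nat.totient_prime_pow hp ha] at h1
  have h2 : p ≤ 2 * (p - 1) := by have := hp.two_le; omega
  calc p ^ a = p ^ (a - 1) * p := (pow_sub_one_mul ha.ne' p).symm
    _ ≤ p ^ (a - 1) * (2 * (p - 1)) := Nat.mul_le_mul_left _ h2
    _ = 2 * (p ^ (a - 1) * (p - 1)) := by ring
    _ ≤ 2 * n.totient := Nat.mul_le_mul_left _ h1

lemma tendsto_totient_atTop : Tendsto Nat.totient atTop atTop := by
  refine tendsto_atTop.2 fun N => ?_
  filter_upwards [eventually_gt_atTop (2 * N).factorial] with n hn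
  by_contra hlt
  have h1 := Nat.le_of_dvd (Nat.factorial_pos _)
    (dvd_factorial_two_mul_totient (Nat.ne_zero_of_lt hn))
  have h2 : (2 * n.totient).factorial ≤ (2 * N).factorial := Nat.factorial_le (by omega)
  omega

/-- A sequence that tends to `0` so slowly that `f (ε n) * a n ≥ 1`. -/
lemma exists_slow_sequence {f : ℝ → ℝ} (hf : ∀ r, 0 < r → 0 < f r) {a : ℕ → ℝ}
    (ha : Tendsto a atTop atTop) :
    ∃ ε : ℕ → ℝ, (∀ n, 0 < ε n) ∧ Tendsto ε atTop (𝓝 0) ∧ ∀ᶠ n in atTop, 1 ≤ f (ε n) * a n := by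
  classical
  have hpos : ∀ j : ℕ, (0 : ℝ) < 1 / (j + 1) := fun j => by positivity
  have hev : ∀ j : ℕ, ∀ᶠ n in atTop, 1 ≤ f (1 / (j + 1)) * a n := fun j =>
    (ha.const_mul_atTop (hf _ (hpos j))).eventually_ge_atTop 1
  -- `findGreatest` returns `0` when no index qualifies; the inequality at `0` holds eventually, so
  -- this default is harmless.
  set J : ℕ → ℕ := fun n => Nat.findGreatest (fun j => 1 ≤ f (1 / (j + 1)) * a n) n with hJ
  refine ⟨fun n => 1 / (J n + 1), fun n => hpos _, ?_, ?_⟩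
  · refine tendsto_one_div_add_atTop_nhds_zero_nat.comp (tendsto_atTop.2 fun M => ?_)
    filter_upwards [eventually_ge_atTop M, hev M] with n h1 h2
    exact Nat.le_findGreatest h1 h2
  · filter_upwards [hev 0] with n h1
    exact Nat.findGreatest_spec (P := fun j : ℕ => 1 ≤ f (1 / (j + 1)) * a n) (Nat.zero_le n) h1

/-- The radii `ψ n / n` may be replaced by smaller ones that tend to `0`. -/
lemma exists_radii {k : ℕ} (hk : k ≠ 0) {ψ f : ℝ → ℝ} (hψ : IsApproximatingFunction ψ)
    (hf : IsDimensionFunction f)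
    (hdiv : ∑' n : ℕ+, ENNReal.ofReal
      (f (ψ ((n : ℕ) : ℝ) / ((n : ℕ) : ℝ)) * (Nat.totient (n : ℕ) : ℝ) ^ k) = ⊤) :
    ∃ δ : ℕ → ℝ, (∀ n, 0 < δ n) ∧ Tendsto δ atTop (𝓝 0) ∧ (∀ n : ℕ, 0 < n → δ n ≤ ψ n / n) ∧
      ∑' n, ENNReal.ofReal (f (δ n) * (n.totient : ℝ) ^ k) = ∞ := by
  obtain ⟨ε, hε0, hεlim, hε⟩ := exists_slow_sequence hf.pos (a := fun n => (n.totient : ℝ) ^ k)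
    ((tendsto_pow_atTop hk).comp (tendsto_natCast_atTop_atTop.comp tendsto_totient_atTop))
  set δ : ℕ → ℝ := fun n => if n = 0 then 1 else min (ψ n / n) (ε n) with hδ
  have hδpos : ∀ n, 0 < δ n := fun n => by
    simp only [hδ]
    split_ifs with hn
    · exact one_pos
    · have hn' : (0 : ℝ) < n := by positivity
      exact lt_min (div_pos (hψ _ hn') hn') (hε0 n)
  have hδle : ∀ n : ℕ, n ≠ 0 → δ n = min (ψ n / n) (ε n) := fun n hn => if_neg hn
  refine ⟨δ, hδpos, ?_, fun n hn => (hδle n hn.ne').trans_le (min_le_left _ _), ?_⟩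
  · refine squeeze_zero' (Eventually.of_forall fun n => (hδpos n).le) ?_ hεlim
    filter_upwards [eventually_ne_atTop 0] with n hn
    exact (hδle n hn).trans_le (min_le_right _ _)
  · set a : ℕ → ℝ≥0∞ := fun n => ENNReal.ofReal (f (ψ n / n) * (n.totient : ℝ) ^ k) with ha
    have hdiv' : ∑' n, a n = ∞ := by
      refine top_le_iff.1 (hdiv.symm.le.trans ?_)
      exact ENNReal.tsum_comp_le_tsum_of_injective PNat.coe_injective a
    -- Each new term is either the old one or at least `1`, hence at least the minimum of the old
    -- term and `1`.
    have hmin := tsum_min_one_eq_top (fun n => ENNReal.ofReal_ne_top) hdiv'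
    refine tsum_eq_top_of_eventually_le
      (fun n => ne_top_of_le_ne_top ENNReal.one_ne_top (min_le_right _ _)) ENNReal.one_ne_top ?_ hmin
    filter_upwards [hε, eventually_ne_atTop 0] with n h2 h3
    rw [hδle _ h3, one_mul]
    rcases min_choice (ψ n / n) (ε n) with h4 | h4
    · rw [h4]
      exact min_le_left _ _
    · rw [h4]
      exact (min_le_right _ _).trans (ENNReal.one_le_ofReal.2 h2)

/-- The hypotheses of the mass transference hold if `f r / r ^ k` is decreasing and unbounded. -/
lemma transferData_of_antitoneOn {k : ℕ} (hk : 2 ≤ k) {f : ℝ → ℝ} {δ : ℕ → ℝ}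
    (hf : IsDimensionFunction f) (hanti : AntitoneOn (fun r : ℝ => f r / r ^ k) (Ioi 0))
    (hunb : ∀ K : ℝ, ∃ r, 0 < r ∧ K * r ^ k < f r) (hδ0 : ∀ n, 0 < δ n)
    (hlim : Tendsto δ atTop (𝓝 0))
    (hdiv : ∑' n, ENNReal.ofReal (f (δ n) * (n.totient : ℝ) ^ k) = ∞) : TransferData k f δ := by
  have hk0 : k ≠ 0 := by omega
  have hfδ : Tendsto (fun n => f (δ n)) atTop (𝓝 0) :=
    hf.tendsto_zero.comp (tendsto_nhdsWithin_iff.2 ⟨hlim, Eventually.of_forall hδ0⟩)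
  refine ⟨hk0, hf.pos, hf.monotoneOn, hanti, fun K => ?_, hδ0, hlim, hfδ, fun η hη => ?_⟩
  · obtain ⟨ρ, hρ, hKρ⟩ := hunb K
    refine ⟨ρ, hρ, fun r hr hrρ => ?_⟩
    have h1 := hanti (mem_Ioi.2 hr) (mem_Ioi.2 hρ) hrρ
    have h2 := (lt_div_iff₀ (by positivity : 0 < ρ ^ k)).2 hKρ
    exact (le_div_iff₀ (by positivity)).1 (h2.le.trans h1)
  · have hfpos : ∀ n, 0 < f (δ n) := fun n => hf.pos _ (hδ0 n)
    have hR0 : Tendsto (fun n => f (δ n) ^ (1 / (k : ℝ))) atTop (𝓝 0) := by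
      have h1 := hfδ.rpow_const (p := 1 / (k : ℝ)) (Or.inr (by positivity))
      rwa [Real.zero_rpow (by positivity)] at h1
    -- The `k`th power of `f (δ n) ^ (1 / k) * φ n` is exactly the term of the given divergent
    -- series.
    have hfull := ae_mem_approxSet hk (fun n => f (δ n) ^ (1 / (k : ℝ)))
      (fun n => Real.rpow_nonneg (hfpos n).le _) hR0 (by
        rw [← hdiv]
        refine tsum_congr fun n => ?_
        rw [mul_pow, one_div, Real.rpow_inv_natCast_pow (hfpos n).le hk0])
    filter_upwards [hfull, approxSet_mul_ae_eq k hR0 hη] with x hx hx'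
    exact (iff_of_eq hx').2 hx

end DuffinSchaeffer

/-! ### The dichotomy on the dimension function -/

theorem corollary1 (k : ℕ) (hk : 2 ≤ k) (ψ f : ℝ → ℝ)
    (hψ : DuffinSchaeffer.IsApproximatingFunction ψ)
    (hf : DuffinSchaeffer.IsDimensionFunction f)
    (hmono : MonotoneOn (fun r : ℝ => f r / r ^ k) (Set.Ioi 0) ∨
      AntitoneOn (fun r : ℝ => f r / r ^ k) (Set.Ioi 0))
    (hdiv : ∑' n : ℕ+, ENNReal.ofReal
      (f (ψ ((n : ℕ) : ℝ) / ((n : ℕ) : ℝ)) * (Nat.totient (n : ℕ) : ℝ) ^ k) = ⊤) :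
    DuffinSchaeffer.hausdorffMeasure f (DuffinSchaeffer.simApprox k ψ) =
      DuffinSchaeffer.hausdorffMeasure f (DuffinSchaeffer.unitCube k) := by
  obtain ⟨δ, hδ0, hlim, hδ, hsum⟩ := DuffinSchaeffer.exists_radii (by omega) hψ hf hdiv
  by_cases hB : ∃ K ρ₀ : ℝ, 0 < ρ₀ ∧ ∀ r, 0 < r → r ≤ ρ₀ → f r ≤ K * r ^ k
  · obtain ⟨K, ρ₀, hρ₀, hK⟩ := hB
    exact DuffinSchaeffer.hausdorffMeasure_simApprox_of_le hk hρ₀ hK hδ0 hlim hδ hsum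
  · push Not at hB
    have hanti : AntitoneOn (fun r : ℝ => f r / r ^ k) (Set.Ioi 0) := by
      -- A nondecreasing quotient would give `f r ≤ f 1 * r ^ k` on `(0, 1]`, which belongs to the
      -- other case.
      refine hmono.resolve_left fun hm => ?_
      obtain ⟨r, hr, hr1, hlt⟩ := hB (f 1) 1 one_pos
      have h1 := hm (Set.mem_Ioi.2 hr) (Set.mem_Ioi.2 one_pos) hr1
      simp only [one_pow, div_one] at h1
      exact absurd ((div_le_iff₀ (by positivity)).1 h1) (not_le.2 hlt)
    have htop := (DuffinSchaeffer.transferData_of_antitoneOn hk hf hanti (fun K => by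
      obtain ⟨r, hr, -, hlt⟩ := hB K 1 one_pos
      exact ⟨r, hr, hlt⟩) hδ0 hlim hsum).hausdorffMeasure_simApprox hδ
    refine le_antisymm (DuffinSchaeffer.hausdorffMeasure_mono f fun y hy => hy.1) ?_
    rw [htop]
    exact le_top
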